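/- **Setting.** Let $M$ be a closed $C^\infty$ Riemannian manifold of dimension $d\ge 2$ and diameter less than $1$. Let $0<\beta\le 1$ and let $f:M\to M$ be a $C^{1+\beta}$ map whose singular set $\Gamma_\infty=\{x: d_xf \text{ is degenerate}\}$ is nonempty. Fix $r\in(0,1)$ such that for every $x\in M$ the exponential map $\exp_x$ is a $C^\infty$ diffeomorphism from $B_r(0)\subset T_xM$ onto $B(x,r)$, and it and its inverse $\exp_x^{-1}:B(x,r)\to B_r(0)$ are $2$-Lipschitz and have derivatives of norm at most $2$. Fix a countable cover $\mathcal D$ of $M$ by balls $D$ of radius less than $r$, each with a smooth map $\Theta_D:TD\to\mathbb R^d$ which is a linear isometry on every fibre. With $\nu_y=(\Theta_D|_{T_yM})^{-1}$, assume that $(y,u)\mapsto \exp_y(\nu_y u)$ is smooth on $D\times B_r(0)$ and Lipschitz for the metric $d(y,y')+|u-u'|$, with a Lipschitz constant independent of $D$. **Assumptions on $f$.** There are constants $a,K>1$ such that for each $x$ with $x,f(x)\notin\Gamma_\infty$ there are $\tau(x)$ with $\min\{d(x,\Gamma_\infty)^a,d(f(x),\Gamma_\infty)^a\}<\tau(x)<1$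 and $D,D'\in\mathcal D$ with $D_x:=B(x,2\tau(x))\subset D$ and $\mathfrak E_x:=B(f(x),2\tau(x))\subset D'$ such that: * (A1) $f|_{D_x}$ is a diffeomorphism onto its image, and there is an inverse branch $f_x^{-1}$ of $f$ on $\mathfrak E_x$ with $f_x^{-1}(f(x))=x$ which is a diffeomorphism onto its image; * (A2) $d(x,\Gamma_\infty)^a\le\|d_yf\|\le d(x,\Gamma_\infty)^{-a}$ for $y\in D_x$, and $d(x,\Gamma_\infty)^a\le\|d_zf_x^{-1}\|\le d(x,\Gamma_\infty)^{-a}$ for $z\in\mathfrak E_x$; * (A3) $\|\Theta_{D'} d_yf\,\nu_y-\Theta_{D'} d_zf\,\nu_z\|\le K d(y,z)^\beta$ for $y,z\in D_x$ with $f(y),f(z)\in D'$ ($\nu$ taken from $D$), and $\|\Theta_{D} d_{y}f_x^{-1}\nu_{y}-\Theta_{D} d_{z}f_x^{-1}\nu_{z}\|\le K d(y,z)^\beta$ for $y,z\in\mathfrak E_x$ with $f_x^{-1}(y),f_x^{-1}(z)\in D$ ($\nu$ taken from $D'$). **Summable points.** Let $M^f=\{\tilde x=(x_i)_{i\in\mathbb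 Z}\in M^{\mathbb Z}: f(x_i)=x_{i+1}\}$, let $\hat f$ be the shift on $M^f$, and let $d_{\tilde x}\hat f^{m}$ ($m\in\mathbb Z$) be the derivative cocycle on $E_{\tilde x}=T_{x_0}M$. A point $\tilde x\in M^f$ is *summable* if $x_n\notin\Gamma_\infty$ for all $n\in\mathbb Z$ and there is a unique splitting $E_{\tilde x}=E^s\oplus E^u$ with $$\sup_{\xi\in E^s,|\xi|=1}\sum_{m\ge0}|d_{\tilde x}\hat f^m\xi|^2<\infty,\qquad \sup_{\xi\in E^u,|\xi|=1}\sum_{m\ge0}|d_{\tilde x}\hat f^{-m}\xi|^2<\infty .$$ The Lyapunov inner product $\langle\cdot,\cdot\rangle'$ on $E_{\tilde x}$ is $2\sum_{m\ge0}\langle d\hat f^m\xi,d\hat f^m\eta\rangle$ on $E^s$ and $2\sum_{m\ge0}\langle d\hat f^{-m}\xi,d\hat f^{-m}\eta\rangle$ on $E^u$, with $E^s$ and $E^u$ orthogonal. For each summable $\tilde x$ let $C_0(\tilde x):(\mathbb R^d,\langle\cdot,\cdot\rangle)\to(E_{\tilde x},\langle\cdot,\cdot\rangle')$ be a linear isometry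 with $C_0(\tilde x)(\mathbb R^{\dim E^s}\times 0)=E^s$ and $C_0(\tilde x)(0\times\mathbb R^{\dim E^u})=E^u$. Put $D_0(\tilde x)=C_0(\hat f\tilde x)^{-1}\circ d_{\tilde x}\hat f\circ C_0(\tilde x)$. **Size of the charts.** Fix $\Gamma>0$ and $\gamma>20/\beta$. Let $I(t)=te^{\Gamma t^{1/\gamma}}$ on $(0,\infty)$, let $I^{1/4}:(0,\infty)\to(0,\infty)$ be a strictly increasing compositional fourth root of $I$, and let $\mathcal I=\{I^{-\ell/4}(1):\ell\in\mathbb N\}$. With $\rho(\tilde x)=d(\{x_{-1},x_0,x_1\},\Gamma_\infty)$, let $Q(\tilde x)=Q_\epsilon(\tilde x)$ be the largest $q\in\mathcal I$ with $q\le\epsilon^{20/\beta}\rho(\tilde x)^{8a/\beta}\|C_0(\tilde x)^{-1}\|^{-2\gamma}$. Put $\iota(\tilde x)=\min\{\tfrac12 r\,d(x_0,\Gamma_\infty)^a,\tau(x_0)\}$. **Charts.** Let $\psi_{\tilde x}=\exp_{x_0}\circ C_0(\tilde x)$, with inverse $\psi_{\tilde x}^{-1}=C_0(\tilde x)^{-1}\circ\exp_{x_0}^{-1}$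 on $B(x_0,r)$, and let $$F_{\tilde x}=\psi_{\hat f\tilde x}^{-1}\circ f\circ\psi_{\tilde x},\qquad F_{\tilde x}^{-1}=\psi_{\tilde x}^{-1}\circ f_{x_0}^{-1}\circ\psi_{\hat f\tilde x}.$$ **Theorem.** There is $\epsilon_0>0$ such that for all $0<\epsilon<\epsilon_0$, all choices of $C_0$ as above and all summable $\tilde x$: 0. $0<Q(\tilde x)\le\iota(\tilde x)$ and $0<Q(\hat f\tilde x)\le\iota(\tilde x)$, and both maps are well defined on $B_{\iota(\tilde x)}(0)\subset\mathbb R^d$: $f(\psi_{\tilde x}(B_{\iota(\tilde x)}(0)))\subset B(f(x_0),r)$, $\psi_{\hat f\tilde x}(B_{\iota(\tilde x)}(0))\subset\mathfrak E_{x_0}$ and $f_{x_0}^{-1}(\psi_{\hat f\tilde x}(B_{\iota(\tilde x)}(0)))\subset B(x_0,r)$. 1. $F_{\tilde x}^{-1}(B_{Q(\hat f\tilde x)}(0))\subset B_{\iota(\tilde x)}(0)$ and $F_{\tilde x}\circ F_{\tilde x}^{-1}=\mathrm{Id}$ on $B_{Q(\hat f\tilde x)}(0)$; $F_{\tilde x}(B_{Q(\tilde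 x)}(0))\subset B_{\iota(\tilde x)}(0)$ and $F_{\tilde x}^{-1}\circ F_{\tilde x}=\mathrm{Id}$ on $B_{Q(\tilde x)}(0)$. 2. $F_{\tilde x}^{\pm1}(0)=0$, $D_0(\tilde x)$ is invertible, and $d_0F_{\tilde x}^{\pm1}=D_0(\tilde x)^{\pm1}$. 3. $F_{\tilde x}=D_0(\tilde x)+H^+$ on $B_{Q(\tilde x)}(0)$ and $F_{\tilde x}^{-1}=D_0(\tilde x)^{-1}+H^-$ on $B_{Q(\hat f\tilde x)}(0)$, where $H^\pm$ are $C^1$, $H^\pm(0)=0$, $d_0H^\pm=0$ and $\|H^\pm\|_{C^{1+\beta/2}}<\epsilon$. Here $\|H\|_{C^{1+\beta/2}}=\sup|H|+\sup\|dH\|+\sup_{v\ne w}\|d_vH-d_wH\|/|v-w|^{\beta/2}$ on the respective ball. 4. $\|d_uF_{\tilde x}\|\le2\sqrt2\,d(x_0,\Gamma_\infty)^{-a}$ for $u\in B_{Q(\tilde x)}(0)$ and $\|d_vF_{\tilde x}^{-1}\|\le2\sqrt2\,d(x_0,\Gamma_\infty)^{-a}$ for $v\in B_{Q(\hat f\tilde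 x)}(0)$. -/

import Mathlib

open Manifold Bundle ContDiff Topology

namespace PesinCharts

noncomputable section

/-! ### Geodesics and the Riemannian exponential map -/

section Geometry

variable {d : ℕ} {M : Type*} [MetricSpace M] [ChartedSpace (EuclideanSpace ℝ (Fin d)) M]
  [RiemannianBundle (fun x : M => TangentSpace (𝓡 d) x)]

/-- The Riemannian metric read in the preferred chart at `p`: this is `g_u(a, b) = ∑ g_ij(u) a_i b_j`,
where `u` is a point of the range of the chart. -/
def metricInChart (p : M) (u a b : EuclideanSpace ℝ (Fin d)) : ℝ :=
  inner ℝ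
    (mfderiv (𝓡 d) (𝓡 d) (extChartAt (𝓡 d) p).symm u a :
      TangentSpace (𝓡 d) ((extChartAt (𝓡 d) p).symm u))
    (mfderiv (𝓡 d) (𝓡 d) (extChartAt (𝓡 d) p).symm u b)

variable (d) in
/-- A smooth curve is a geodesic if in every chart `u = φ ∘ γ` solves the geodesic equation
`∑ g_kj u''_j + ∑ Γ_{ij,k} u'_i u'_j = 0`, with `Γ_{ij,k} = (∂_i g_jk + ∂_j g_ik - ∂_k g_ij) / 2` the
Christoffel symbols of the first kind. The equation is paired with an arbitrary vector `w`. -/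
def IsGeodesic (γ : ℝ → M) : Prop :=
  ContMDiff 𝓘(ℝ, ℝ) (𝓡 d) ∞ γ ∧
  ∀ (p : M) (t : ℝ), γ t ∈ (extChartAt (𝓡 d) p).source →
    ∀ w : EuclideanSpace ℝ (Fin d),
      let u : ℝ → EuclideanSpace ℝ (Fin d) := fun s => extChartAt (𝓡 d) p (γ s)
      metricInChart p (u t) (deriv (deriv u) t) w
        + fderiv ℝ (fun z => metricInChart p z (deriv u t) w) (u t) (deriv u t)
        - (1 / 2) * fderiv ℝ (fun z => metricInChart p z (deriv u t) (deriv u t)) (u t) w = 0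

/-- `γ` is a geodesic which starts at `x` with velocity `v`. -/
def IsGeodesicFrom (x : M) (v : TangentSpace (𝓡 d) x) (γ : ℝ → M) : Prop :=
  IsGeodesic d γ ∧
  (⟨γ 0, mfderiv 𝓘(ℝ, ℝ) (𝓡 d) γ 0 (1 : ℝ)⟩ : TangentBundle (𝓡 d) M) = ⟨x, v⟩

open Classical in
/-- The exponential map: the time one point of the geodesic from `x` with initial velocity `v`
(on a compact manifold it always exists and is unique). -/
def expMap (x : M) (v : TangentSpace (𝓡 d) x) : M :=
  if h : ∃ γ : ℝ → M, IsGeodesicFrom x v γ then h.choose 1 else x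

/-- The inverse of `exp_x` restricted to the ball `B_r(0)`. -/
def expInv (r : ℝ) (x y : M) : TangentSpace (𝓡 d) x :=
  Function.invFunOn (expMap x) (Metric.ball (0 : TangentSpace (𝓡 d) x) r) y

variable (d M) in
/-- The admissible choices of the uniform radius `r = r(M)`: `exp_x` is a smooth diffeomorphism from
`B_r(0)` onto `B(x, r)` for every `x`, it and its inverse are `2`-Lipschitz there, and their
derivatives have norm at most `2`. -/
structure IsAdmissibleRadius (r : ℝ) : Prop where
  pos : 0 < r
  lt_one : r < 1
  bijOn : ∀ x : M, Set.BijOn (expMap x) (Metric.ball (0 : TangentSpace (𝓡 d) x) r) (Metric.ball x r)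
  smooth_exp : ∀ x : M, ContMDiffOn 𝓘(ℝ, TangentSpace (𝓡 d) x) (𝓡 d) ∞
    (expMap x) (Metric.ball (0 : TangentSpace (𝓡 d) x) r)
  smooth_inv : ∀ x : M, ContMDiffOn (𝓡 d) 𝓘(ℝ, TangentSpace (𝓡 d) x) ∞
    (expInv (d := d) r x) (Metric.ball x r)
  lipschitz_exp : ∀ x : M, LipschitzOnWith 2 (expMap x) (Metric.ball (0 : TangentSpace (𝓡 d) x) r)
  lipschitz_inv : ∀ x : M, LipschitzOnWith 2 (expInv (d := d) r x) (Metric.ball x r)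
  norm_deriv_exp : ∀ x : M, ∀ v ∈ Metric.ball (0 : TangentSpace (𝓡 d) x) r,
    ∀ ξ : TangentSpace (𝓡 d) x,
      ‖(mfderiv 𝓘(ℝ, TangentSpace (𝓡 d) x) (𝓡 d) (expMap x) v ξ :
        TangentSpace (𝓡 d) (expMap x v))‖ ≤ 2 * ‖ξ‖
  norm_deriv_inv : ∀ x : M, ∀ y ∈ Metric.ball x r, ∀ ξ : TangentSpace (𝓡 d) y,
    ‖(show TangentSpace (𝓡 d) x from
      mfderiv (𝓡 d) 𝓘(ℝ, TangentSpace (𝓡 d) x) (expInv (d := d) r x) y ξ)‖ ≤ 2 * ‖ξ‖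

variable [IsManifold (𝓡 d) ∞ M]

variable (d M) in
/-- A countable cover of `M` by balls `D` of radius `r' < r`, each with a smooth map
`Θ_D : TD → ℝ^d` that is a linear isometry on every fibre. With `ν_y = (Θ_D|T_yM)⁻¹`, the map
`(y, u) ↦ exp_y (ν_y u)` is smooth on `D × B_r(0)` and Lipschitz there, with a Lipschitz constant that
is the same for all `D`. (The values of `Θ_D` above points outside `D` play no role.) -/
structure FrameCover (r : ℝ) (ι : Type*) where
  center : ι → M
  radius : ι → ℝ
  radius_lt : ∀ i, radius i < r
  covers : ∀ x : M, ∃ i, x ∈ Metric.ball (center i) (radius i)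
  Θ : ι → ∀ y : M, TangentSpace (𝓡 d) y ≃ₗᵢ[ℝ] EuclideanSpace ℝ (Fin d)
  smooth_Θ : ∀ i, ContMDiffOn (𝓡 d).tangent 𝓘(ℝ, EuclideanSpace ℝ (Fin d)) ∞
    (fun v : TangentBundle (𝓡 d) M => Θ i v.proj v.2)
    {v | v.proj ∈ Metric.ball (center i) (radius i)}
  smooth_exp : ∀ i, ContMDiffOn ((𝓡 d).prod 𝓘(ℝ, EuclideanSpace ℝ (Fin d))) (𝓡 d) ∞
    (fun p : M × EuclideanSpace ℝ (Fin d) => expMap p.1 ((Θ i p.1).symm p.2))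
    (Metric.ball (center i) (radius i) ×ˢ Metric.ball 0 r)
  lipschitz_exp : ∃ L : ℝ, ∀ i, ∀ y ∈ Metric.ball (center i) (radius i),
    ∀ y' ∈ Metric.ball (center i) (radius i),
    ∀ u ∈ Metric.ball (0 : EuclideanSpace ℝ (Fin d)) r,
    ∀ u' ∈ Metric.ball (0 : EuclideanSpace ℝ (Fin d)) r,
      dist (expMap y ((Θ i y).symm u)) (expMap y' ((Θ i y').symm u')) ≤ L * (dist y y' + ‖u - u'‖)

/-- The open set `D` of the cover with index `i`. -/
def FrameCover.dom {r : ℝ} {ι : Type*} (𝒟 : FrameCover d M r ι) (i : ι) : Set M :=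
  Metric.ball (𝒟.center i) (𝒟.radius i)

/-- For a linear map `A : T_yM → T_zM` the map `Θ_{D'} ∘ A ∘ ν_y` of `ℝ^d`, where `ν_y` is taken from
`D` (index `i`) and `Θ_{D'}` from `D'` (index `j`). -/
def FrameCover.read {r : ℝ} {ι : Type*} (𝒟 : FrameCover d M r ι) (i j : ι) (y z : M)
    (A : TangentSpace (𝓡 d) y →L[ℝ] TangentSpace (𝓡 d) z) :
    EuclideanSpace ℝ (Fin d) →L[ℝ] EuclideanSpace ℝ (Fin d) :=
  ((𝒟.Θ j z).toContinuousLinearEquiv : TangentSpace (𝓡 d) z →L[ℝ] EuclideanSpace ℝ (Fin d)) ∘L A ∘L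
    ((𝒟.Θ i y).symm.toContinuousLinearEquiv :
      EuclideanSpace ℝ (Fin d) →L[ℝ] TangentSpace (𝓡 d) y)

end Geometry

/-! ### The class of maps -/

section Maps

variable {d : ℕ} {M : Type*} [MetricSpace M] [ChartedSpace (EuclideanSpace ℝ (Fin d)) M]

variable (d) in
/-- `f` is of class `C^{1+β}`: it is `C^1` and its derivative in charts is locally `β`-Hölder. -/
def IsC1Holder (β : ℝ) (f : M → M) : Prop :=
  ContMDiff (𝓡 d) (𝓡 d) 1 f ∧
  ∀ x : M, ∃ C : ℝ, ∃ U ∈ 𝓝 (extChartAt (𝓡 d) x x), ∀ u ∈ U, ∀ v ∈ U,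
    ‖fderiv ℝ (writtenInExtChartAt (𝓡 d) (𝓡 d) x f) u
      - fderiv ℝ (writtenInExtChartAt (𝓡 d) (𝓡 d) x f) v‖ ≤ C * ‖u - v‖ ^ β

variable (d) in
/-- The singular set `Γ_∞` of points at which the derivative of `f` is degenerate. -/
def singularSet (f : M → M) : Set M :=
  {x | ¬ (mfderiv (𝓡 d) (𝓡 d) f x).IsInvertible}

variable (d) in
/-- The distance from `x` to the singular set `Γ_∞`. -/
def distSing (f : M → M) (x : M) : ℝ := Metric.infDist x (singularSet d f)

variable [IsManifold (𝓡 d) ∞ M] [RiemannianBundle (fun x : M => TangentSpace (𝓡 d) x)]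

/-- The assumptions on a `C^{1+β}` map with singularities. Here `D_x = B(x, 2 τ(x))`,
`𝔈_x = B(f x, 2 τ(x))`, and `finv x` is the inverse branch `f_x⁻¹` of `f` on `𝔈_x` which sends `f x`
to `x`. -/
structure IsSingularSystem {r : ℝ} {ι : Type*} (𝒟 : FrameCover d M r ι) (f : M → M)
    (β a K : ℝ) (τ : M → ℝ) (finv : M → M → M) : Prop where
  c1Holder : IsC1Holder d β f
  nonempty_sing : (singularSet d f).Nonempty
  one_lt_a : 1 < a
  one_lt_K : 1 < K
  lt_τ : ∀ x, x ∉ singularSet d f → f x ∉ singularSet d f →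
    min (distSing d f x ^ a) (distSing d f (f x) ^ a) < τ x
  τ_lt : ∀ x, x ∉ singularSet d f → f x ∉ singularSet d f → τ x < 1
  -- `f` restricted to `D_x` is a diffeomorphism onto its image
  injOn : ∀ x, x ∉ singularSet d f → f x ∉ singularSet d f →
    Set.InjOn f (Metric.ball x (2 * τ x))
  regular : ∀ x, x ∉ singularSet d f → f x ∉ singularSet d f →
    ∀ y ∈ Metric.ball x (2 * τ x), y ∉ singularSet d f
  -- the inverse branch is well defined and a diffeomorphism on `𝔈_x`
  finv_base : ∀ x, x ∉ singularSet d f → f x ∉ singularSet d f → finv x (f x) = x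
  finv_right : ∀ x, x ∉ singularSet d f → f x ∉ singularSet d f →
    ∀ z ∈ Metric.ball (f x) (2 * τ x), f (finv x z) = z
  finv_smooth : ∀ x, x ∉ singularSet d f → f x ∉ singularSet d f →
    ContMDiffOn (𝓡 d) (𝓡 d) 1 (finv x) (Metric.ball (f x) (2 * τ x))
  -- bounds for the derivatives
  norm_df : ∀ x, x ∉ singularSet d f → f x ∉ singularSet d f →
    ∀ y ∈ Metric.ball x (2 * τ x),
      distSing d f x ^ a ≤ ‖mfderiv (𝓡 d) (𝓡 d) f y‖ ∧
      ‖mfderiv (𝓡 d) (𝓡 d) f y‖ ≤ distSing d f x ^ (-a)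
  norm_dfinv : ∀ x, x ∉ singularSet d f → f x ∉ singularSet d f →
    ∀ z ∈ Metric.ball (f x) (2 * τ x),
      distSing d f x ^ a ≤ ‖mfderiv (𝓡 d) (𝓡 d) (finv x) z‖ ∧
      ‖mfderiv (𝓡 d) (𝓡 d) (finv x) z‖ ≤ distSing d f x ^ (-a)
  -- Hölder continuity of the derivatives, read in frames over `D ⊇ D_x` and `D' ⊇ 𝔈_x`
  holder : ∀ x, x ∉ singularSet d f → f x ∉ singularSet d f →
    ∃ i j : ι, Metric.ball x (2 * τ x) ⊆ 𝒟.dom i ∧ Metric.ball (f x) (2 * τ x) ⊆ 𝒟.dom j ∧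
      (∀ y ∈ Metric.ball x (2 * τ x), ∀ z ∈ Metric.ball x (2 * τ x),
        f y ∈ 𝒟.dom j → f z ∈ 𝒟.dom j →
        ‖𝒟.read i j y (f y) (mfderiv (𝓡 d) (𝓡 d) f y)
          - 𝒟.read i j z (f z) (mfderiv (𝓡 d) (𝓡 d) f z)‖ ≤ K * dist y z ^ β) ∧
      (∀ y ∈ Metric.ball (f x) (2 * τ x), ∀ z ∈ Metric.ball (f x) (2 * τ x),
        finv x y ∈ 𝒟.dom i → finv x z ∈ 𝒟.dom i →
        ‖𝒟.read j i y (finv x y) (mfderiv (𝓡 d) (𝓡 d) (finv x) y)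
          - 𝒟.read j i z (finv x z) (mfderiv (𝓡 d) (𝓡 d) (finv x) z)‖ ≤ K * dist y z ^ β)

end Maps

/-! ### The natural extension and its derivative cocycle -/

section NaturalExtension

/-- The inverse limit space `M^f` of full orbits of `f`. -/
def OrbitSpace {M : Type*} (f : M → M) : Type _ := {x : ℤ → M // ∀ i, f (x i) = x (i + 1)}

variable {M : Type*} {f : M → M}

/-- The natural extension `f̂` of `f`, the shift on `M^f`. -/
def shift (x : OrbitSpace f) : OrbitSpace f :=
  ⟨fun i => x.1 (i + 1), fun i => x.2 (i + 1)⟩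

/-- The inverse of the natural extension. -/
def shiftInv (x : OrbitSpace f) : OrbitSpace f :=
  ⟨fun i => x.1 (i - 1), fun i => by rw [x.2 (i - 1)]; exact congrArg x.1 (by ring)⟩

/-- The projection `p : M^f → M`. -/
def proj (x : OrbitSpace f) : M := x.1 0

theorem f_proj (x : OrbitSpace f) : f (proj x) = proj (shift x) := x.2 0

theorem shift_shiftInv (x : OrbitSpace f) : shift (shiftInv x) = x := by
  apply Subtype.ext
  funext i
  exact congrArg x.1 (by ring)

variable {d : ℕ} [MetricSpace M] [ChartedSpace (EuclideanSpace ℝ (Fin d)) M]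

variable (d) in
/-- The identification of the tangent spaces at two equal points. -/
def tangentCast {p q : M} (h : p = q) : TangentSpace (𝓡 d) p →L[ℝ] TangentSpace (𝓡 d) q := by
  subst h
  exact ContinuousLinearMap.id ℝ _

variable (d) in
/-- `d_x̃ f̂ = d_{x₀} f`, as a map from the fibre over `x̃` to the fibre over `f̂ x̃`. -/
def dHat (x : OrbitSpace f) :
    TangentSpace (𝓡 d) (proj x) →L[ℝ] TangentSpace (𝓡 d) (proj (shift x)) :=
  (tangentCast d (f_proj x)).comp (mfderiv (𝓡 d) (𝓡 d) f (proj x))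

variable (d) in
/-- `d_x̃ f̂⁻¹ = (d_{x₋₁} f)⁻¹`. -/
def dHatInv (x : OrbitSpace f) :
    TangentSpace (𝓡 d) (proj x) →L[ℝ] TangentSpace (𝓡 d) (proj (shiftInv x)) :=
  ((tangentCast d (congrArg proj (shift_shiftInv x))).comp (dHat d (shiftInv x))).inverse

variable (d) in
/-- `d_x̃ f̂^m` for `m ≥ 0`. -/
def dHatPow : (m : ℕ) → (x : OrbitSpace f) →
    TangentSpace (𝓡 d) (proj x) →L[ℝ] TangentSpace (𝓡 d) (proj (shift^[m] x))
  | 0, _ => ContinuousLinearMap.id ℝ _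
  | m + 1, x => (dHatPow m (shift x)).comp (dHat d x)

variable (d) in
/-- `d_x̃ f̂^{-m}` for `m ≥ 0`. -/
def dHatNeg : (m : ℕ) → (x : OrbitSpace f) →
    TangentSpace (𝓡 d) (proj x) →L[ℝ] TangentSpace (𝓡 d) (proj (shiftInv^[m] x))
  | 0, _ => ContinuousLinearMap.id ℝ _
  | m + 1, x => (dHatNeg m (shiftInv x)).comp (dHatInv d x)

/-! ### Summable points and the Lyapunov inner product -/

variable [RiemannianBundle (fun x : M => TangentSpace (𝓡 d) x)]

/-- `E_x̃ = E^s ⊕ E^u`, with the two suprema over unit vectors finite. -/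
def IsSummableSplitting (x : OrbitSpace f)
    (V : Submodule ℝ (TangentSpace (𝓡 d) (proj x)) × Submodule ℝ (TangentSpace (𝓡 d) (proj x))) :
    Prop :=
  IsCompl V.1 V.2 ∧
  (⨆ ξ ∈ {ξ : TangentSpace (𝓡 d) (proj x) | ξ ∈ V.1 ∧ ‖ξ‖ = 1},
    ∑' m : ℕ, ‖dHatPow d m x ξ‖ₑ ^ 2) < ⊤ ∧
  (⨆ ξ ∈ {ξ : TangentSpace (𝓡 d) (proj x) | ξ ∈ V.2 ∧ ‖ξ‖ = 1},
    ∑' m : ℕ, ‖dHatNeg d m x ξ‖ₑ ^ 2) < ⊤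

variable (d) in
/-- The set `0-summ` of summable points: the orbit avoids the singular set and there is exactly one
splitting as above. -/
structure IsSummablePoint (x : OrbitSpace f) : Prop where
  regular : ∀ n : ℤ, x.1 n ∉ singularSet d f
  existsUnique : ∃! V : Submodule ℝ (TangentSpace (𝓡 d) (proj x)) ×
    Submodule ℝ (TangentSpace (𝓡 d) (proj x)), IsSummableSplitting x V

/-- The space `E^s(x̃)` of a summable point. -/
def stableSpace {x : OrbitSpace f} (hx : IsSummablePoint d x) :
    Submodule ℝ (TangentSpace (𝓡 d) (proj x)) := hx.existsUnique.choose.1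

/-- The space `E^u(x̃)` of a summable point. -/
def unstableSpace {x : OrbitSpace f} (hx : IsSummablePoint d x) :
    Submodule ℝ (TangentSpace (𝓡 d) (proj x)) := hx.existsUnique.choose.2

theorem isCompl_stable_unstable {x : OrbitSpace f} (hx : IsSummablePoint d x) :
    IsCompl (stableSpace hx) (unstableSpace hx) := hx.existsUnique.choose_spec.1.1

/-- The Lyapunov inner product: `2 ∑ ⟨d f̂^m ξ^s, d f̂^m η^s⟩` on `E^s`, `2 ∑ ⟨d f̂^{-m} ξ^u, d f̂^{-m} η^u⟩`
on `E^u`, and the two spaces are orthogonal to each other. -/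
def lyapunovInner {x : OrbitSpace f} (hx : IsSummablePoint d x)
    (ξ η : TangentSpace (𝓡 d) (proj x)) : ℝ :=
  let h := isCompl_stable_unstable hx
  let πs := (stableSpace hx).projection (unstableSpace hx) h
  let πu := (unstableSpace hx).projection (stableSpace hx) h.symm
  2 * ∑' m : ℕ, inner ℝ (dHatPow d m x (πs ξ)) (dHatPow d m x (πs η))
    + 2 * ∑' m : ℕ, inner ℝ (dHatNeg d m x (πu ξ)) (dHatNeg d m x (πu η))

/-- The conditions on `C₀(x̃)`: it sends `ℝ^{d_s} × 0` to `E^s`, `0 × ℝ^{d_u}` to `E^u`, and it is an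
isometry from the Euclidean to the Lyapunov inner product. -/
structure IsLyapunovChange {x : OrbitSpace f} (hx : IsSummablePoint d x)
    (C : EuclideanSpace ℝ (Fin d) ≃L[ℝ] TangentSpace (𝓡 d) (proj x)) : Prop where
  map_stable : C '' {v | ∀ i : Fin d, Module.finrank ℝ (stableSpace hx) ≤ i → v i = 0} =
    (stableSpace hx : Set (TangentSpace (𝓡 d) (proj x)))
  map_unstable : C '' {v | ∀ i : Fin d, (i : ℕ) < Module.finrank ℝ (stableSpace hx) → v i = 0} =
    (unstableSpace hx : Set (TangentSpace (𝓡 d) (proj x)))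
  isometry : ∀ v w, lyapunovInner hx (C v) (C w) = inner ℝ v w

/-! ### The size of the charts -/

/-- `J` is a compositional fourth root `I^{1/4}` of the ladder function `I(t) = t e^{Γ t^{1/γ}}`. -/
structure IsQuarterLadder (Γ γ : ℝ) (J : ℝ → ℝ) : Prop where
  mapsTo : Set.MapsTo J (Set.Ioi 0) (Set.Ioi 0)
  strictMonoOn : StrictMonoOn J (Set.Ioi 0)
  iterate_four : ∀ t, 0 < t → J^[4] t = t * Real.exp (Γ * t ^ (1 / γ))

/-- The set `𝓘 = {I^{-ℓ/4}(1) : ℓ ∈ ℕ}`, where `J = I^{1/4}`. -/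
def ladderSet (J : ℝ → ℝ) : Set ℝ := {q | 0 < q ∧ ∃ ℓ : ℕ, J^[ℓ] q = 1}

variable (d) in
/-- `ρ(x̃) = d({x₋₁, x₀, x₁}, Γ_∞)`. -/
def rho (x : OrbitSpace f) : ℝ :=
  min (distSing d f (x.1 (-1))) (min (distSing d f (x.1 0)) (distSing d f (x.1 1)))

/-- `Q̃_ε(x̃) = ε^{20/β} ρ(x̃)^{8a/β} ‖C₀(x̃)⁻¹‖^{-2γ}`, where `C = C₀(x̃)`. -/
def Qtilde (β a γ ε : ℝ) (x : OrbitSpace f)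
    (C : EuclideanSpace ℝ (Fin d) ≃L[ℝ] TangentSpace (𝓡 d) (proj x)) : ℝ :=
  ε ^ (20 / β) * rho d x ^ (8 * a / β) *
    ‖(C.symm : TangentSpace (𝓡 d) (proj x) →L[ℝ] EuclideanSpace ℝ (Fin d))‖ ^ (-2 * γ)

/-- `Q_ε(x̃)`, the largest element of `𝓘` which is at most `Q̃_ε(x̃)`. -/
def Qsize (β a γ ε : ℝ) (J : ℝ → ℝ) (x : OrbitSpace f)
    (C : EuclideanSpace ℝ (Fin d) ≃L[ℝ] TangentSpace (𝓡 d) (proj x)) : ℝ :=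
  sSup {q ∈ ladderSet J | q ≤ Qtilde β a γ ε x C}

/-- `ι(x̃) = min {r d(x₀, Γ_∞)^a / 2, τ(x₀)}`. -/
def iotaSize (d : ℕ) [ChartedSpace (EuclideanSpace ℝ (Fin d)) M] (r a : ℝ) (τ : M → ℝ)
    (x : OrbitSpace f) : ℝ :=
  min (1 / 2 * r * distSing d f (proj x) ^ a) (τ (proj x))

/-! ### Pesin charts -/

/-- The Pesin chart `ψ_x̃ = exp_{x₀} ∘ C₀(x̃)`. -/
def pesinChart (x : OrbitSpace f)
    (C : EuclideanSpace ℝ (Fin d) ≃L[ℝ] TangentSpace (𝓡 d) (proj x))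
    (u : EuclideanSpace ℝ (Fin d)) : M :=
  expMap (proj x) (C u)

/-- The inverse of the Pesin chart, `C₀(x̃)⁻¹ ∘ exp_{x₀}⁻¹` on `B(x₀, r)`. -/
def pesinChartInv (r : ℝ) (x : OrbitSpace f)
    (C : EuclideanSpace ℝ (Fin d) ≃L[ℝ] TangentSpace (𝓡 d) (proj x))
    (y : M) : EuclideanSpace ℝ (Fin d) :=
  C.symm (expInv r (proj x) y)

/-- `F_x̃ = ψ_{f̂ x̃}⁻¹ ∘ f ∘ ψ_x̃`. -/
def chartF (r : ℝ)
    (C₀ : ∀ x : OrbitSpace f, EuclideanSpace ℝ (Fin d) ≃L[ℝ] TangentSpace (𝓡 d) (proj x))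
    (x : OrbitSpace f) (u : EuclideanSpace ℝ (Fin d)) : EuclideanSpace ℝ (Fin d) :=
  pesinChartInv r (shift x) (C₀ (shift x)) (f (pesinChart x (C₀ x) u))

/-- `F_x̃⁻¹ = ψ_x̃⁻¹ ∘ f_{x₀}⁻¹ ∘ ψ_{f̂ x̃}`. -/
def chartFInv (r : ℝ) (finv : M → M → M)
    (C₀ : ∀ x : OrbitSpace f, EuclideanSpace ℝ (Fin d) ≃L[ℝ] TangentSpace (𝓡 d) (proj x))
    (x : OrbitSpace f) (v : EuclideanSpace ℝ (Fin d)) : EuclideanSpace ℝ (Fin d) :=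
  pesinChartInv r x (C₀ x) (finv (proj x) (pesinChart (shift x) (C₀ (shift x)) v))

/-- `D₀(x̃) = C₀(f̂ x̃)⁻¹ ∘ d_x̃ f̂ ∘ C₀(x̃)`. -/
def D₀ (C₀ : ∀ x : OrbitSpace f, EuclideanSpace ℝ (Fin d) ≃L[ℝ] TangentSpace (𝓡 d) (proj x))
    (x : OrbitSpace f) : EuclideanSpace ℝ (Fin d) →L[ℝ] EuclideanSpace ℝ (Fin d) :=
  ((C₀ (shift x)).symm :
      TangentSpace (𝓡 d) (proj (shift x)) →L[ℝ] EuclideanSpace ℝ (Fin d)) ∘L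
    dHat d x ∘L (C₀ x : EuclideanSpace ℝ (Fin d) →L[ℝ] TangentSpace (𝓡 d) (proj x))

end NaturalExtension

/-- The `C^{1+α}` norm on an open set `U`, in `[0, ∞]`:
`sup ‖H‖ + sup ‖dH‖ +` the `α`-Hölder seminorm of `dH`. -/
def c1HolderNorm {E F : Type*} [NormedAddCommGroup E] [NormedSpace ℝ E] [NormedAddCommGroup F]
    [NormedSpace ℝ F] (α : ℝ) (U : Set E) (H : E → F) : ENNReal :=
  (⨆ v ∈ U, ‖H v‖ₑ) + (⨆ v ∈ U, ‖fderiv ℝ H v‖ₑ) +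
    ⨆ v ∈ U, ⨆ w ∈ U, ⨆ _ : v ≠ w, ‖fderiv ℝ H v - fderiv ℝ H w‖ₑ / ‖v - w‖ₑ ^ α

end

end PesinCharts

/-! # Pesin charts of a non-uniformly hyperbolic system with singularities

The main theorem bounds a `C^{1+β}` map with a singular set in the Pesin charts along a summable
orbit.
-/

section

set_option maxSynthPendingDepth 3
set_option linter.unusedSectionVars false

namespace PesinCharts

noncomputable section

/-! In the charts, `F` is `C₀(f̂x)⁻¹ ∘ (exp⁻¹ ∘ f ∘ exp) ∘ C₀(x)`. Its derivative at the origin is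
`D₀`, because the derivative of `exp` at `0` is the identity; the rest is a bound on how fast `dF`
varies. Read in frames, `df` is `β`-Hölder by (A3), and the derivatives of `exp` and `exp⁻¹` are
Lipschitz near the origin with constants uniform over the manifold and the frames
(`FrameCover.exists_lipschitz_dexpFrame`). Let `Λ = d(x₀, Γ_∞)^(-a)`, which bounds `df` and the
derivative of the inverse branch. As `C₀(x)` is a contraction, the product rule gives `dF` a Hölder
constant `‖C₀(f̂x)⁻¹‖ A Λ²` with `A` uniform (`FrameCover.IsBranch.norm_fderiv_sub_le`).

The splitting is invariant because it is unique. Hence the sums defining the Lyapunov norms at `x`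
and `f̂x` differ by single terms, and `df̂` and its inverse have Lyapunov norm at most `√(1 + Λ²) ≤
√2 Λ`. So `‖C₀(x)⁻¹‖` and `‖C₀(f̂x)⁻¹‖` agree up to a factor `√2 Λ²`, and the Hölder constant is of
order `Λ⁴ N` with `N = ‖C₀(x)⁻¹‖`. The inverse branch is treated identically, with the roles of the
two points exchanged.

The size `Q` pays for this (`size_bounds`). Since `ρ ≤ d(x₀, Γ_∞)`, the power `Q^(β/2)` contains
`ρ^(4a)`, which cancels `Λ⁴`, and a power of `N` which cancels `N`. Trading half of the Hölder
exponent for `(2Q)^(β/2)` leaves a `β/2`-Hölder constant of order `ε²`. This controls the whole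
`C^{1+β/2}` norm of `F - D₀`, and `‖dF‖ ≤ ‖D₀‖ + ε`. The inclusions and the inverse relations use
only `Q N Λ⁴ ≤ ε ρ^a`, because `ρ^a` is at most `τ(x₀)` and at most `d(x₀, Γ_∞)^a`.

Since `expMap` is defined by choosing a geodesic, uniqueness of geodesics is needed first, to see
that `t ↦ exp (t v)` has initial velocity `v`. -/

theorem one_add_one_le_infty : (1 : WithTop ℕ∞) + 1 ≤ ∞ := by
  rw [one_add_one_eq_two]; exact ENat.LEInfty.out

/-! ### Local uniqueness for the geodesic equation in a chart -/

section GeodesicODE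

variable {E : Type*} [NormedAddCommGroup E] [NormedSpace ℝ E] [FiniteDimensional ℝ E]

/-- The Christoffel term of the geodesic equation for the metric `B`. -/
def christoffelTerm (B : E → E →L[ℝ] E →L[ℝ] ℝ) (q : E × E) : E →L[ℝ] ℝ :=
  (fderiv ℝ B q.1 q.2) q.2 - (1 / 2 : ℝ) • ((fderiv ℝ B q.1).flip q.2).flip q.2

theorem contDiffAt_christoffelTerm {B : E → E →L[ℝ] E →L[ℝ] ℝ} {q : E × E}
    (hB : ContDiffAt ℝ ∞ B q.1) : ContDiffAt ℝ 1 (christoffelTerm B) q := by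
  have h1 : ContDiffAt ℝ 1 (fderiv ℝ B) q.1 := hB.fderiv_right (m := 1) one_add_one_le_infty
  have h2 : ContDiffAt ℝ 1 (fun p : E × E => fderiv ℝ B p.1) q :=
    ContDiffAt.comp q h1 contDiffAt_fst
  have h3 : ContDiffAt ℝ 1 (fun p : E × E => p.2) q := contDiffAt_snd
  have h4 : ContDiffAt ℝ 1 (fun p : E × E => (fderiv ℝ B p.1).flip) q :=
    (ContinuousLinearMap.flipₗᵢ ℝ E E (E →L[ℝ] ℝ)).contDiff.contDiffAt.comp q h2
  have h5 : ContDiffAt ℝ 1 (fun p : E × E => ((fderiv ℝ B p.1).flip p.2).flip) q :=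
    (ContinuousLinearMap.flipₗᵢ ℝ E E ℝ).contDiff.contDiffAt.comp q (h4.clm_apply h3)
  exact ((h2.clm_apply h3).clm_apply h3).sub ((h5.clm_apply h3).const_smul _)

/-- The geodesic vector field on `E × E`. -/
def geodesicField (B : E → E →L[ℝ] E →L[ℝ] ℝ) (q : E × E) : E × E :=
  (q.2, -((B q.1).inverse (christoffelTerm B q)))

/-- A nondegenerate form injects `E` into its dual, which has the same dimension. -/
theorem isInvertible_of_nondegenerate {b : E →L[ℝ] E →L[ℝ] ℝ}
    (hb : ∀ a, (∀ w, b a w = 0) → a = 0) : b.IsInvertible := by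
  have hinj : Function.Injective (b : E →ₗ[ℝ] (E →L[ℝ] ℝ)) := by
    rw [← LinearMap.ker_eq_bot, LinearMap.ker_eq_bot']
    intro a ha
    exact hb a fun w => by
      have := congrArg (fun l : E →L[ℝ] ℝ => l w) ha
      simpa using this
  have hrank : Module.finrank ℝ E = Module.finrank ℝ (E →L[ℝ] ℝ) := by
    rw [← (LinearMap.toContinuousLinearMap (𝕜 := ℝ) (E := E) (F' := ℝ)).finrank_eq]
    exact (Subspace.dual_finrank_eq (K := ℝ) (V := E)).symm
  exact ⟨(LinearEquiv.ofInjectiveOfFinrankEq (b : E →ₗ[ℝ] (E →L[ℝ] ℝ)) hinj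
    hrank).toContinuousLinearEquiv, by ext; rfl⟩

theorem contDiffAt_geodesicField {B : E → E →L[ℝ] E →L[ℝ] ℝ} {q : E × E}
    (hB : ContDiffAt ℝ ∞ B q.1) (hinv : (B q.1).IsInvertible) :
    ContDiffAt ℝ 1 (geodesicField B) q := by
  obtain ⟨e, he⟩ := hinv
  have h1 : ContDiffAt ℝ 1 (fun p : E × E => B p.1) q :=
    ContDiffAt.comp q (hB.of_le ENat.LEInfty.out) contDiffAt_fst
  have h2 : ContDiffAt ℝ 1 (fun p : E × E => (B p.1).inverse) q := by
    have := contDiffAt_map_inverse (n := 1) e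
    rw [he] at this
    exact this.comp q h1
  exact contDiffAt_snd.prodMk (h2.clm_apply (contDiffAt_christoffelTerm hB)).neg

/-- The geodesic equation at time `t`, for the metric `B` and the curve `u`. -/
def GeodesicEq (B : E → E →L[ℝ] E →L[ℝ] ℝ) (u : ℝ → E) (t : ℝ) : Prop :=
  ∀ w, B (u t) (deriv (deriv u) t) w + (fderiv ℝ B (u t) (deriv u t)) (deriv u t) w
    - (1 / 2) * (fderiv ℝ B (u t) w) (deriv u t) (deriv u t) = 0

/-- The equation holds against every `w`, so it is an identity in the dual space; applying the
inverse of `B` solves it for the second derivative. -/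
theorem GeodesicEq.hasDerivAt {B : E → E →L[ℝ] E →L[ℝ] ℝ} {u : ℝ → E} {t : ℝ}
    (h : GeodesicEq B u t) (hu : ContDiffAt ℝ ∞ u t) (hinv : (B (u t)).IsInvertible) :
    HasDerivAt (fun s => (u s, deriv u s)) (geodesicField B (u t, deriv u t)) t := by
  have h1 : HasDerivAt u (deriv u t) t := (hu.differentiableAt (by simp)).hasDerivAt
  have h2 : HasDerivAt (deriv u) (deriv (deriv u) t) t := by
    have : ContDiffAt ℝ 1 (deriv u) t := by
      have := hu.fderiv_right (m := 1) one_add_one_le_infty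
      exact this.clm_apply contDiffAt_const
    exact (this.differentiableAt one_ne_zero).hasDerivAt
  have h3 : B (u t) (deriv (deriv u) t) = - christoffelTerm B (u t, deriv u t) := by
    ext w
    have := h w
    simp only [christoffelTerm, neg_apply, sub_apply, smul_apply, ContinuousLinearMap.flip_apply, smul_eq_mul]
    linarith
  have h4 : deriv (deriv u) t = -((B (u t)).inverse (christoffelTerm B (u t, deriv u t))) := by
    obtain ⟨e, he⟩ := hinv
    rw [← he] at h3 ⊢
    rw [ContinuousLinearMap.inverse_equiv]
    have : deriv (deriv u) t = e.symm (e (deriv (deriv u) t)) := by simp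
    rw [this]
    change e (deriv (deriv u) t) = _ at h3
    rw [h3]
    simp
  have := h1.prodMk h2
  rw [h4] at this
  exact this

/-- Position and velocity together solve a first-order equation whose field is `C^1`, hence
Lipschitz near the initial point, and such equations have unique solutions. -/
theorem eventuallyEq_of_geodesicEq {B : E → E →L[ℝ] E →L[ℝ] ℝ} {u₁ u₂ : ℝ → E} {t₀ : ℝ}
    (hB : ContDiffAt ℝ ∞ B (u₁ t₀)) (hinv : ∀ᶠ z in 𝓝 (u₁ t₀), (B z).IsInvertible)
    (hu₁ : ∀ᶠ t in 𝓝 t₀, ContDiffAt ℝ ∞ u₁ t) (hu₂ : ∀ᶠ t in 𝓝 t₀, ContDiffAt ℝ ∞ u₂ t)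
    (h₁ : ∀ᶠ t in 𝓝 t₀, GeodesicEq B u₁ t) (h₂ : ∀ᶠ t in 𝓝 t₀, GeodesicEq B u₂ t)
    (heq : u₁ t₀ = u₂ t₀) (hderiv : deriv u₁ t₀ = deriv u₂ t₀) : u₁ =ᶠ[𝓝 t₀] u₂ := by
  obtain ⟨K, s, hs, hK⟩ := (contDiffAt_geodesicField (q := (u₁ t₀, deriv u₁ t₀)) hB
    hinv.self_of_nhds).exists_lipschitzOnWith
  have key : ∀ u : ℝ → E, u t₀ = u₁ t₀ → deriv u t₀ = deriv u₁ t₀ →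
      (∀ᶠ t in 𝓝 t₀, ContDiffAt ℝ ∞ u t) → (∀ᶠ t in 𝓝 t₀, GeodesicEq B u t) →
      ∀ᶠ t in 𝓝 t₀, HasDerivAt (fun s => (u s, deriv u s)) (geodesicField B (u t, deriv u t)) t
        ∧ (u t, deriv u t) ∈ s := by
    intro u e1 e2 hu h
    have hc : ContinuousAt u t₀ := hu.self_of_nhds.continuousAt
    have hd : ContinuousAt (deriv u) t₀ := by
      have : ContDiffAt ℝ 1 (deriv u) t₀ := by
        have := hu.self_of_nhds.fderiv_right (m := 1) one_add_one_le_infty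
        exact this.clm_apply contDiffAt_const
      exact this.continuousAt
    have hs' : s ∈ 𝓝 (u t₀, deriv u t₀) := by rw [e1, e2]; exact hs
    have h3 := (hc.prodMk hd).eventually_mem hs'
    have h4 := hc.eventually (by rw [e1]; exact hinv)
    filter_upwards [hu, h, h3, h4] with t a1 a2 a3 a4
    exact ⟨a2.hasDerivAt a1 a4, a3⟩
  have := ODE_solution_unique_of_eventually (v := fun _ => geodesicField B) (s := fun _ => s)
    (K := K) (f := fun t => (u₁ t, deriv u₁ t)) (g := fun t => (u₂ t, deriv u₂ t)) (t₀ := t₀)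
    (Filter.Eventually.of_forall fun _ => hK) (key u₁ rfl rfl hu₁ h₁)
    (key u₂ heq.symm hderiv.symm hu₂ h₂) (by simp [heq, hderiv])
  filter_upwards [this] with t ht
  exact congrArg Prod.fst ht

end GeodesicODE

/-! ### Geodesics on the manifold, read in charts -/

section
variable {d : ℕ} {M : Type*} [MetricSpace M] [ChartedSpace (EuclideanSpace ℝ (Fin d)) M]
  [RiemannianBundle (fun x : M => TangentSpace (𝓡 d) x)]

/-- The metric in the chart at `p`, as a bilinear form depending on the point. -/
def metricForm (p : M) (z : EuclideanSpace ℝ (Fin d)) :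
    EuclideanSpace ℝ (Fin d) →L[ℝ] EuclideanSpace ℝ (Fin d) →L[ℝ] ℝ :=
  let A : EuclideanSpace ℝ (Fin d) →L[ℝ] TangentSpace (𝓡 d) ((extChartAt (𝓡 d) p).symm z) :=
    mfderiv (𝓡 d) (𝓡 d) (extChartAt (𝓡 d) p).symm z
  (innerSL ℝ).bilinearComp A A

theorem metricForm_apply (p : M) (z a b : EuclideanSpace ℝ (Fin d)) :
    metricForm p z a b = metricInChart p z a b := rfl

variable [IsManifold (𝓡 d) ∞ M] [IsContMDiffRiemannianBundle (𝓡 d) ∞ (EuclideanSpace ℝ (Fin d))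
      (fun x : M => TangentSpace (𝓡 d) x)]

/-- This is the tangent map of the inverse chart along a constant field; smoothness of the metric
coefficients reduces to it. -/
theorem contMDiffOn_mfderiv_extChartAt_symm (p : M) (a : EuclideanSpace ℝ (Fin d)) :
    ContMDiffOn (𝓡 d) (𝓡 d).tangent ∞
      (fun z => (⟨(extChartAt (𝓡 d) p).symm z,
        mfderiv (𝓡 d) (𝓡 d) (extChartAt (𝓡 d) p).symm z a⟩ : TangentBundle (𝓡 d) M))
      (extChartAt (𝓡 d) p).target := by
  have h1 := (contMDiffOn_extChartAt_symm (I := 𝓡 d) (n := ∞) p).contMDiffOn_tangentMapWithin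
    (m := ∞) (by simp) (isOpen_extChartAt_target p).uniqueMDiffOn
  have h2 : ContMDiffOn (𝓡 d) (𝓡 d).tangent ∞
      (fun z => (⟨z, a⟩ : TangentBundle (𝓡 d) (EuclideanSpace ℝ (Fin d))))
      (extChartAt (𝓡 d) p).target := by
    exact contMDiffOn_vectorSpace_iff_contDiffOn.2 contDiffOn_const
  have h3 := h1.comp h2 (fun z hz => hz)
  refine h3.congr fun z hz => ?_
  simp only [Function.comp, tangentMapWithin]
  rw [mfderivWithin_of_isOpen (isOpen_extChartAt_target p) hz]

theorem contDiffOn_metricForm (p : M) :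
    ContDiffOn ℝ ∞ (metricForm (d := d) p) (extChartAt (𝓡 d) p).target := by
  rw [contDiffOn_clm_apply]
  intro a
  rw [contDiffOn_clm_apply]
  intro b
  rw [← contMDiffOn_iff_contDiffOn]
  exact ContMDiffOn.inner_bundle (E := fun x : M => TangentSpace (𝓡 d) x) (IB := 𝓡 d)
    (contMDiffOn_mfderiv_extChartAt_symm p a) (contMDiffOn_mfderiv_extChartAt_symm p b)

/-- A degenerate vector paired with itself has a pushforward of length zero, and the derivative of
the inverse chart is injective. -/
theorem isInvertible_metricForm {p : M} {z : EuclideanSpace ℝ (Fin d)}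
    (hz : z ∈ (extChartAt (𝓡 d) p).target) : (metricForm (d := d) p z).IsInvertible := by
  apply isInvertible_of_nondegenerate
  intro a ha
  have h1 := ha a
  rw [metricForm_apply, metricInChart, inner_self_eq_zero] at h1
  have h2 := isInvertible_mfderivWithin_extChartAt_symm (I := 𝓡 d) hz
  rw [ModelWithCorners.range_eq_univ, mfderivWithin_univ] at h2
  obtain ⟨e, he⟩ := h2
  rw [← he] at h1
  exact e.map_eq_zero_iff.1 h1

variable (d) in
/-- The velocity vector of a curve, as a point of the tangent bundle. -/
def velocity (γ : ℝ → M) (t : ℝ) : TangentBundle (𝓡 d) M :=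
  ⟨γ t, mfderiv 𝓘(ℝ, ℝ) (𝓡 d) γ t (1 : ℝ)⟩

theorem deriv_extChartAt_comp {γ : ℝ → M} {p : M} {t : ℝ}
    (hγ : MDifferentiableAt 𝓘(ℝ, ℝ) (𝓡 d) γ t) (ht : γ t ∈ (extChartAt (𝓡 d) p).source) :
    deriv (fun s => extChartAt (𝓡 d) p (γ s)) t =
      mfderiv (𝓡 d) 𝓘(ℝ, EuclideanSpace ℝ (Fin d)) (extChartAt (𝓡 d) p) (γ t)
        (mfderiv 𝓘(ℝ, ℝ) (𝓡 d) γ t (1 : ℝ)) := by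
  have h1 := mfderiv_comp t (mdifferentiableAt_extChartAt (I := 𝓡 d)
    (by rwa [extChartAt_source] at ht)) hγ
  have h2 := congrArg (fun l => l (1 : ℝ)) h1
  rw [mfderiv_eq_fderiv] at h2
  exact h2

theorem deriv_extChartAt_comp_eq {γ₁ γ₂ : ℝ → M} {p : M} {t : ℝ}
    (hγ₁ : MDifferentiableAt 𝓘(ℝ, ℝ) (𝓡 d) γ₁ t) (hγ₂ : MDifferentiableAt 𝓘(ℝ, ℝ) (𝓡 d) γ₂ t)
    (ht : γ₁ t ∈ (extChartAt (𝓡 d) p).source) (h : velocity d γ₁ t = velocity d γ₂ t) :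
    deriv (fun s => extChartAt (𝓡 d) p (γ₁ s)) t = deriv (fun s => extChartAt (𝓡 d) p (γ₂ s)) t := by
  have hp : γ₁ t = γ₂ t := congrArg TotalSpace.proj h
  -- The two velocities lie in different fibres until the base points are identified, so the
  -- equality is eliminated in the tangent bundle.
  have key : ∀ v w : TangentBundle (𝓡 d) M, v = w →
      (mfderiv (𝓡 d) 𝓘(ℝ, EuclideanSpace ℝ (Fin d)) (extChartAt (𝓡 d) p) v.1 v.2 :
        EuclideanSpace ℝ (Fin d)) =
      (mfderiv (𝓡 d) 𝓘(ℝ, EuclideanSpace ℝ (Fin d)) (extChartAt (𝓡 d) p) w.1 w.2 :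
        EuclideanSpace ℝ (Fin d)) := by
    rintro v _ rfl; rfl
  rw [deriv_extChartAt_comp hγ₁ ht, deriv_extChartAt_comp hγ₂ (hp ▸ ht)]
  exact key _ _ h

theorem contDiffAt_extChartAt_comp {γ : ℝ → M} {p : M} {t : ℝ}
    (hγ : ContMDiffAt 𝓘(ℝ, ℝ) (𝓡 d) ∞ γ t) (ht : γ t ∈ (extChartAt (𝓡 d) p).source) :
    ContDiffAt ℝ ∞ (fun s => extChartAt (𝓡 d) p (γ s)) t := by
  rw [← contMDiffAt_iff_contDiffAt]
  exact (contMDiffAt_extChartAt' (by rwa [extChartAt_source] at ht)).comp t hγ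

/-- The definition differentiates scalar coefficients with the vectors frozen. As the metric form is
differentiable, these derivatives are its derivative applied to those vectors. -/
theorem isGeodesic_iff {γ : ℝ → M} : IsGeodesic d γ ↔
    ContMDiff 𝓘(ℝ, ℝ) (𝓡 d) ∞ γ ∧ ∀ (p : M) (t : ℝ), γ t ∈ (extChartAt (𝓡 d) p).source →
      GeodesicEq (metricForm (d := d) p) (fun s => extChartAt (𝓡 d) p (γ s)) t := by
  refine and_congr_right fun _ => forall_congr' fun p => forall_congr' fun t =>
    forall_congr' fun ht => forall_congr' fun w => ?_
  have hz := (extChartAt (𝓡 d) p).map_source ht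
  have hB : DifferentiableAt ℝ (metricForm (d := d) p) (extChartAt (𝓡 d) p (γ t)) :=
    ((contDiffOn_metricForm (d := d) p).contDiffAt
      ((isOpen_extChartAt_target p).mem_nhds hz)).differentiableAt (by simp)
  have h2 : ∀ a b : EuclideanSpace ℝ (Fin d), ∀ c,
      fderiv ℝ (fun z => metricInChart p z a b) (extChartAt (𝓡 d) p (γ t)) c =
        fderiv ℝ (metricForm (d := d) p) (extChartAt (𝓡 d) p (γ t)) c a b := by
    intro a b c
    have h3 := ((hB.hasFDerivAt.clm_apply (hasFDerivAt_const a _)).clm_apply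
      (hasFDerivAt_const b _)).fderiv
    have h4 := congrArg (fun l => l c) h3
    simp only [metricForm_apply] at h4
    rw [h4]
    simp
  simp only [h2]
  exact Iff.rfl

theorem IsGeodesic.geodesicEq {γ : ℝ → M} (hγ : IsGeodesic d γ) {p : M} {t : ℝ}
    (ht : γ t ∈ (extChartAt (𝓡 d) p).source) :
    GeodesicEq (metricForm (d := d) p) (fun s => extChartAt (𝓡 d) p (γ s)) t :=
  (isGeodesic_iff.1 hγ).2 p t ht

theorem isGeodesic_const (x : M) : IsGeodesic d fun _ : ℝ => x := by
  refine isGeodesic_iff.2 ⟨contMDiff_const, fun p t _ w => ?_⟩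
  simp

/-- Every term of the equation is of degree two in the time derivatives, so it is multiplied by
`c²`. -/
theorem IsGeodesic.comp_mul {γ : ℝ → M} (hγ : IsGeodesic d γ) (c : ℝ) :
    IsGeodesic d fun t => γ (c * t) := by
  refine isGeodesic_iff.2 ⟨hγ.1.comp (contDiff_const.mul contDiff_id).contMDiff,
    fun p t ht w => ?_⟩
  have h := hγ.geodesicEq ht w
  have h1 : deriv (fun s => extChartAt (𝓡 d) p (γ (c * s))) =
      fun s => c • deriv (fun s => extChartAt (𝓡 d) p (γ s)) (c * s) :=
    funext fun s => deriv_comp_mul_left c (fun s => extChartAt (𝓡 d) p (γ s)) s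
  have h2 : deriv (deriv (fun s => extChartAt (𝓡 d) p (γ (c * s)))) t =
      c • c • deriv (deriv (fun s => extChartAt (𝓡 d) p (γ s))) (c * t) := by
    rw [h1, deriv_fun_const_smul_field]
    congr 1
    exact deriv_comp_mul_left c (deriv fun s => extChartAt (𝓡 d) p (γ s)) t
  rw [h2, h1]
  simp only [map_smul, smul_apply, smul_eq_mul]
  linear_combination c * c * h

/-- Two geodesics with the same velocity at one time agree near that time. -/
theorem IsGeodesic.eventuallyEq {γ₁ γ₂ : ℝ → M} (h₁ : IsGeodesic d γ₁) (h₂ : IsGeodesic d γ₂)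
    {p : M} {t : ℝ} (ht : γ₁ t ∈ (extChartAt (𝓡 d) p).source) (heq : γ₁ t = γ₂ t)
    (hd : deriv (fun s => extChartAt (𝓡 d) p (γ₁ s)) t =
      deriv (fun s => extChartAt (𝓡 d) p (γ₂ s)) t) : γ₁ =ᶠ[𝓝 t] γ₂ := by
  have e : ∀ γ : ℝ → M, IsGeodesic d γ → γ t ∈ (extChartAt (𝓡 d) p).source →
      ∀ᶠ s in 𝓝 t, γ s ∈ (extChartAt (𝓡 d) p).source := fun γ hγ h =>
    hγ.1.continuous.continuousAt.eventually_mem ((isOpen_extChartAt_source p).mem_nhds h)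
  have e₁ := e γ₁ h₁ ht
  have e₂ := e γ₂ h₂ (heq ▸ ht)
  have hz := (extChartAt (𝓡 d) p).map_source ht
  have key := eventuallyEq_of_geodesicEq (B := metricForm (d := d) p)
    (u₁ := fun s => extChartAt (𝓡 d) p (γ₁ s)) (u₂ := fun s => extChartAt (𝓡 d) p (γ₂ s)) (t₀ := t)
    ((contDiffOn_metricForm (d := d) p).contDiffAt ((isOpen_extChartAt_target p).mem_nhds hz))
    (by
      filter_upwards [(isOpen_extChartAt_target p).mem_nhds hz] with z hz
      exact isInvertible_metricForm hz)
    (e₁.mono fun s hs => contDiffAt_extChartAt_comp h₁.1.contMDiffAt hs)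
    (e₂.mono fun s hs => contDiffAt_extChartAt_comp h₂.1.contMDiffAt hs)
    (e₁.mono fun s hs => h₁.geodesicEq hs) (e₂.mono fun s hs => h₂.geodesicEq hs)
    (by simp only [heq]) hd
  filter_upwards [key, e₁, e₂] with s a a₁ a₂
  exact (extChartAt (𝓡 d) p).injOn a₁ a₂ a

/-- Two geodesics with the same velocity at one time are equal. -/
theorem IsGeodesic.eq_of_velocity_eq {γ₁ γ₂ : ℝ → M} (h₁ : IsGeodesic d γ₁)
    (h₂ : IsGeodesic d γ₂) {t₀ : ℝ} (h : velocity d γ₁ t₀ = velocity d γ₂ t₀) : γ₁ = γ₂ := by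
  have hd : ∀ γ : ℝ → M, IsGeodesic d γ → ∀ t, MDifferentiableAt 𝓘(ℝ, ℝ) (𝓡 d) γ t := fun γ hγ t =>
    hγ.1.contMDiffAt.mdifferentiableAt (by simp)
  -- The times near which the curves agree form an open set by definition. It is closed because
  -- velocities are continuous and local uniqueness applies at a limit point. Connectedness of the
  -- line finishes the argument.
  set S : Set ℝ := {t | γ₁ =ᶠ[𝓝 t] γ₂} with hS
  have hopen : IsOpen S := by
    rw [isOpen_iff_mem_nhds]
    intro t ht
    exact Filter.Eventually.eventually_nhds ht
  have hclosed : IsClosed S := by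
    rw [← closure_subset_iff_isClosed]
    intro t ht
    have heq : γ₁ t = γ₂ t := by
      have hc : IsClosed {s | γ₁ s = γ₂ s} :=
        isClosed_eq h₁.1.continuous h₂.1.continuous
      exact closure_minimal (fun s hs => Filter.Eventually.self_of_nhds hs) hc ht
    have hsrc := mem_extChartAt_source (I := 𝓡 d) (γ₁ t)
    refine h₁.eventuallyEq h₂ hsrc heq ?_
    have cd : ∀ γ : ℝ → M, IsGeodesic d γ → γ t = γ₁ t →
        ContinuousAt (deriv (fun s => extChartAt (𝓡 d) (γ₁ t) (γ s))) t := by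
      intro γ hγ hγt
      have h1 : ContDiffAt ℝ ∞ (fun s => extChartAt (𝓡 d) (γ₁ t) (γ s)) t :=
        contDiffAt_extChartAt_comp hγ.1.contMDiffAt (by rw [hγt]; exact hsrc)
      have h2 := h1.fderiv_right (m := 1) one_add_one_le_infty
      have h3 : ContDiffAt ℝ 1 (deriv (fun s => extChartAt (𝓡 d) (γ₁ t) (γ s))) t :=
        h2.clm_apply contDiffAt_const
      exact h3.continuousAt
    have c₁ := cd γ₁ h₁ rfl
    have c₂ := cd γ₂ h₂ heq.symm
    have : (𝓝[S] t).NeBot := mem_closure_iff_nhdsWithin_neBot.1 ht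
    refine tendsto_nhds_unique (f := deriv (fun s => extChartAt (𝓡 d) (γ₁ t) (γ₁ s))) (l := 𝓝[S] t)
      (c₁.tendsto.mono_left nhdsWithin_le_nhds) ?_
    refine (c₂.tendsto.mono_left nhdsWithin_le_nhds).congr' ?_
    filter_upwards [self_mem_nhdsWithin] with s hs
    apply Filter.EventuallyEq.deriv_eq
    filter_upwards [show γ₁ =ᶠ[𝓝 s] γ₂ from hs] with r hr
    rw [hr]
  have h0 : t₀ ∈ S := by
    have hsrc := mem_extChartAt_source (I := 𝓡 d) (γ₁ t₀)
    exact h₁.eventuallyEq h₂ hsrc (congrArg TotalSpace.proj h)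
      (deriv_extChartAt_comp_eq (hd _ h₁ _) (hd _ h₂ _) hsrc h)
  have huniv : S = Set.univ := IsClopen.eq_univ ⟨hclosed, hopen⟩ ⟨t₀, h0⟩
  funext t
  have : t ∈ S := huniv ▸ Set.mem_univ t
  exact (show γ₁ =ᶠ[𝓝 t] γ₂ from this).self_of_nhds

/-! ### The exponential map -/

theorem IsGeodesicFrom.comp_mul {γ : ℝ → M} {x : M} {v : TangentSpace (𝓡 d) x}
    (hγ : IsGeodesicFrom x v γ) (c : ℝ) : IsGeodesicFrom x (c • v) fun t => γ (c * t) := by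
  refine ⟨hγ.1.comp_mul c, ?_⟩
  have hv := hγ.2
  have h1 : HasMFDerivAt 𝓘(ℝ, ℝ) (𝓡 d) γ (c * 0) (mfderiv 𝓘(ℝ, ℝ) (𝓡 d) γ (c * 0)) :=
    (hγ.1.1.contMDiffAt.mdifferentiableAt (by simp)).hasMFDerivAt
  have h2 : HasMFDerivAt 𝓘(ℝ, ℝ) 𝓘(ℝ, ℝ) (fun t : ℝ => c * t) 0
      (ContinuousLinearMap.toSpanSingleton ℝ c) :=
    (((hasDerivAt_id (0 : ℝ)).const_mul c).congr_deriv (mul_one c)).hasFDerivAt.hasMFDerivAt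
  have h3 := (HasMFDerivAt.comp (0 : ℝ) h1 h2).mfderiv
  have key : ∀ w : TangentBundle (𝓡 d) M, w = ⟨x, v⟩ →
      (⟨w.1, c • w.2⟩ : TangentBundle (𝓡 d) M) = ⟨x, c • v⟩ := by
    rintro _ rfl; rfl
  rw [← key _ hv]
  have h4 : mfderiv 𝓘(ℝ, ℝ) (𝓡 d) (fun t => γ (c * t)) 0 (1 : ℝ) =
      c • mfderiv 𝓘(ℝ, ℝ) (𝓡 d) γ (c * 0) (1 : ℝ) := by
    refine (congrArg (fun l => l (1 : ℝ)) h3).trans ?_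
    refine Eq.trans (b := mfderiv 𝓘(ℝ, ℝ) (𝓡 d) γ (c * 0) (c : ℝ)) ?_ ?_
    · refine congrArg (mfderiv 𝓘(ℝ, ℝ) (𝓡 d) γ (c * 0)) ?_
      exact (one_smul ℝ c)
    · have := (mfderiv 𝓘(ℝ, ℝ) (𝓡 d) γ (c * 0)).map_smul c (1 : ℝ)
      rw [← this]
      exact congrArg (mfderiv 𝓘(ℝ, ℝ) (𝓡 d) γ (c * 0)) (mul_one c).symm
  rw [h4]
  change (⟨γ (c * 0), c • mfderiv 𝓘(ℝ, ℝ) (𝓡 d) γ (c * 0) (1 : ℝ)⟩ : TangentBundle (𝓡 d) M) =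
    ⟨γ 0, c • mfderiv 𝓘(ℝ, ℝ) (𝓡 d) γ 0 (1 : ℝ)⟩
  rw [mul_zero]

theorem IsGeodesicFrom.unique {γ₁ γ₂ : ℝ → M} {x : M} {v : TangentSpace (𝓡 d) x}
    (h₁ : IsGeodesicFrom x v γ₁) (h₂ : IsGeodesicFrom x v γ₂) : γ₁ = γ₂ :=
  h₁.1.eq_of_velocity_eq h₂.1 (h₁.2.trans h₂.2.symm)

/-- Uniqueness makes the choice in the definition of `expMap` irrelevant. -/
theorem IsGeodesicFrom.expMap_eq {γ : ℝ → M} {x : M} {v : TangentSpace (𝓡 d) x}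
    (h : IsGeodesicFrom x v γ) : expMap x v = γ 1 := by
  have hex : ∃ γ : ℝ → M, IsGeodesicFrom x v γ := ⟨γ, h⟩
  rw [expMap, dif_pos hex, hex.choose_spec.unique h]

theorem IsGeodesicFrom.expMap_smul {γ : ℝ → M} {x : M} {v : TangentSpace (𝓡 d) x}
    (h : IsGeodesicFrom x v γ) (t : ℝ) : expMap x (t • v) = γ t := by
  rw [(h.comp_mul t).expMap_eq, mul_one]

theorem isGeodesicFrom_const (x : M) :
    IsGeodesicFrom x (0 : TangentSpace (𝓡 d) x) fun _ : ℝ => x := by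
  refine ⟨isGeodesic_const x, ?_⟩
  rw [mfderiv_const]
  rfl

variable (d) in
theorem expMap_zero (x : M) : expMap x (0 : TangentSpace (𝓡 d) x) = x :=
  (isGeodesicFrom_const x).expMap_eq

/-- If there were no geodesic, `expMap` would take its default value `x`, which is also its value at
`0`. Injectivity on the ball then forces `v = 0`, and there the constant curve is a geodesic. -/
theorem IsAdmissibleRadius.exists_geodesic {r : ℝ} (hr : IsAdmissibleRadius d M r) {x : M}
    {v : TangentSpace (𝓡 d) x} (hv : v ∈ Metric.ball (0 : TangentSpace (𝓡 d) x) r) :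
    ∃ γ : ℝ → M, IsGeodesicFrom x v γ := by
  by_contra h
  have h1 : expMap x v = expMap x (0 : TangentSpace (𝓡 d) x) := by
    rw [expMap_zero, expMap, dif_neg h]
  have h2 := (hr.bijOn x).injOn hv (Metric.mem_ball_self hr.pos) h1
  subst h2
  exact h ⟨_, isGeodesicFrom_const x⟩

/-- The derivative of the exponential map at the origin is the identity. -/
theorem IsAdmissibleRadius.tangentMap_expMap_zero {r : ℝ} (hr : IsAdmissibleRadius d M r) (x : M)
    (v : TangentSpace (𝓡 d) x) :
    (⟨expMap x (0 : TangentSpace (𝓡 d) x),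
      mfderiv 𝓘(ℝ, TangentSpace (𝓡 d) x) (𝓡 d) (expMap x) (0 : TangentSpace (𝓡 d) x) v⟩ :
      TangentBundle (𝓡 d) M) = ⟨x, v⟩ := by
  -- Geodesics are so far available only for vectors in the ball; `v` is shrunk into it and the
  -- resulting geodesic is rescaled in time.
  obtain ⟨c, hc, hcv⟩ : ∃ c : ℝ, 0 < c ∧ c • v ∈ Metric.ball (0 : TangentSpace (𝓡 d) x) r := by
    refine ⟨r / (2 * (‖v‖ + 1)), by have := hr.pos; positivity, ?_⟩
    have := hr.pos
    rw [mem_ball_zero_iff, norm_smul, Real.norm_of_nonneg (by positivity), div_mul_eq_mul_div,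
      div_lt_iff₀ (by positivity)]
    nlinarith [norm_nonneg v]
  obtain ⟨γ', hγ'⟩ := hr.exists_geodesic hcv
  obtain ⟨γ, hγ⟩ : ∃ γ : ℝ → M, IsGeodesicFrom x v γ := by
    have := hγ'.comp_mul c⁻¹
    rw [smul_smul, inv_mul_cancel₀ hc.ne', one_smul] at this
    exact ⟨_, this⟩
  have hγe : γ = fun t => expMap x (t • v) := funext fun t => (hγ.expMap_smul t).symm
  have h0 : (0 : ℝ) • v = 0 := zero_smul ℝ v
  have h1 : HasMFDerivAt 𝓘(ℝ, TangentSpace (𝓡 d) x) (𝓡 d) (expMap x) ((0 : ℝ) • v)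
      (mfderiv 𝓘(ℝ, TangentSpace (𝓡 d) x) (𝓡 d) (expMap x) ((0 : ℝ) • v)) := by
    refine MDifferentiableAt.hasMFDerivAt ?_
    rw [h0]
    exact ((hr.smooth_exp x).contMDiffAt (Metric.ball_mem_nhds _ hr.pos)).mdifferentiableAt
      (by simp)
  have h2 : HasMFDerivAt 𝓘(ℝ, ℝ) 𝓘(ℝ, TangentSpace (𝓡 d) x) (fun t : ℝ => t • v) 0
      (ContinuousLinearMap.toSpanSingleton ℝ v) :=
    (((hasDerivAt_id (0 : ℝ)).smul_const v).congr_deriv (one_smul ℝ v)).hasFDerivAt.hasMFDerivAt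
  have h3 := (HasMFDerivAt.comp (0 : ℝ) h1 h2).mfderiv
  have h4 := hγ.2
  rw [hγe] at h4
  rw [← h4]
  have h5 : mfderiv 𝓘(ℝ, ℝ) (𝓡 d) (fun t : ℝ => expMap x (t • v)) 0 (1 : ℝ) =
      mfderiv 𝓘(ℝ, TangentSpace (𝓡 d) x) (𝓡 d) (expMap x) ((0 : ℝ) • v) v := by
    refine (congrArg (fun l => l (1 : ℝ)) h3).trans ?_
    refine congrArg (mfderiv 𝓘(ℝ, TangentSpace (𝓡 d) x) (𝓡 d) (expMap x) ((0 : ℝ) • v)) ?_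
    exact (one_smul ℝ v)
  rw [h5]
  change _ = (⟨expMap x ((0 : ℝ) • v), mfderiv 𝓘(ℝ, TangentSpace (𝓡 d) x) (𝓡 d) (expMap x)
    ((0 : ℝ) • v) v⟩ : TangentBundle (𝓡 d) M)
  rw [h0]

end

/-! ### Distances along paths -/

section Paths

variable {d : ℕ} {M : Type*} [MetricSpace M] [ChartedSpace (EuclideanSpace ℝ (Fin d)) M]
  [RiemannianBundle (fun x : M => TangentSpace (𝓡 d) x)]

/-- The distance is the infimum of the lengths of paths, and this path has length at most `c`. -/
theorem dist_le_of_norm_mfderiv_le [IsRiemannianManifold (𝓡 d) M] {γ : ℝ → M} {c : ℝ}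
    (hγ : ∀ t ∈ Set.Icc (0 : ℝ) 1, ContMDiffAt 𝓘(ℝ, ℝ) (𝓡 d) 1 γ t)
    (hc : ∀ t ∈ Set.Icc (0 : ℝ) 1,
      ‖(mfderiv 𝓘(ℝ, ℝ) (𝓡 d) γ t (1 : ℝ) : TangentSpace (𝓡 d) (γ t))‖ ≤ c) :
    dist (γ 0) (γ 1) ≤ c := by
  have hc0 : 0 ≤ c := (norm_nonneg _).trans (hc 0 (by simp))
  have h1 : edist (γ 0) (γ 1) ≤ Manifold.pathELength (𝓡 d) γ 0 1 := by
    rw [IsRiemannianManifold.out (I := 𝓡 d) (γ 0) (γ 1)]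
    exact Manifold.riemannianEDist_le_pathELength
      (fun t ht => (hγ t ht).contMDiffWithinAt) rfl rfl zero_le_one
  have h2 : Manifold.pathELength (𝓡 d) γ 0 1 ≤ ENNReal.ofReal c := by
    rw [Manifold.pathELength_eq_lintegral_mfderiv_Icc]
    calc _ ≤ ∫⁻ _ in Set.Icc (0 : ℝ) 1, ENNReal.ofReal c := by
          refine MeasureTheory.setLIntegral_mono' measurableSet_Icc fun t ht => ?_
          rw [← ofReal_norm]
          exact ENNReal.ofReal_le_ofReal (hc t ht)
      _ = ENNReal.ofReal c := by simp
  rw [edist_dist] at h1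
  exact (ENNReal.ofReal_le_ofReal_iff hc0).1 (h1.trans h2)

variable [IsManifold (𝓡 d) ∞ M] [IsContMDiffRiemannianBundle (𝓡 d) ∞ (EuclideanSpace ℝ (Fin d))
      (fun x : M => TangentSpace (𝓡 d) x)] {r : ℝ}

theorem IsAdmissibleRadius.dist_expMap_le (hr : IsAdmissibleRadius d M r) {x : M}
    {v : TangentSpace (𝓡 d) x} (hv : ‖v‖ < r) : dist (expMap x v) x ≤ 2 * ‖v‖ := by
  have h := (hr.lipschitz_exp x).dist_le_mul v (by simpa using hv) 0
    (Metric.mem_ball_self hr.pos)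
  rw [expMap_zero, dist_zero_right] at h
  exact_mod_cast h

theorem IsAdmissibleRadius.expMap_mem_ball (hr : IsAdmissibleRadius d M r) {x : M}
    {v : TangentSpace (𝓡 d) x} {s : ℝ} (hv : ‖v‖ < r) (hs : 2 * ‖v‖ < s) :
    expMap x v ∈ Metric.ball x s :=
  (hr.dist_expMap_le hv).trans_lt hs

theorem IsAdmissibleRadius.expInv_expMap (hr : IsAdmissibleRadius d M r) {x : M}
    {v : TangentSpace (𝓡 d) x} (hv : ‖v‖ < r) : expInv (d := d) r x (expMap x v) = v :=
  (hr.bijOn x).injOn.leftInvOn_invFunOn (by simpa using hv)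

theorem IsAdmissibleRadius.expMap_expInv (hr : IsAdmissibleRadius d M r) {x y : M}
    (hy : y ∈ Metric.ball x r) : expMap x (expInv (d := d) r x y) = y :=
  (hr.bijOn x).surjOn.rightInvOn_invFunOn hy

theorem IsAdmissibleRadius.expInv_mem (hr : IsAdmissibleRadius d M r) {x y : M}
    (hy : y ∈ Metric.ball x r) : ‖expInv (d := d) r x y‖ < r := by
  have := (hr.bijOn x).surjOn.mapsTo_invFunOn hy
  rw [mem_ball_zero_iff] at this
  exact this

theorem IsAdmissibleRadius.expInv_self (hr : IsAdmissibleRadius d M r) (x : M) :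
    expInv (d := d) r x x = 0 := by
  have := hr.expInv_expMap (x := x) (v := 0) (by simpa using hr.pos)
  rwa [expMap_zero] at this

theorem IsAdmissibleRadius.norm_expInv_sub_le (hr : IsAdmissibleRadius d M r) {x y z : M}
    (hy : y ∈ Metric.ball x r) (hz : z ∈ Metric.ball x r) :
    ‖expInv (d := d) r x y - expInv (d := d) r x z‖ ≤ 2 * dist y z := by
  have h := (hr.lipschitz_inv x).dist_le_mul y hy z hz
  rw [dist_eq_norm] at h
  exact_mod_cast h

theorem IsAdmissibleRadius.norm_expInv_le (hr : IsAdmissibleRadius d M r) {x y : M}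
    (hy : y ∈ Metric.ball x r) : ‖expInv (d := d) r x y‖ ≤ 2 * dist y x := by
  have h := hr.norm_expInv_sub_le hy (Metric.mem_ball_self hr.pos)
  rwa [hr.expInv_self, sub_zero] at h

theorem IsAdmissibleRadius.contMDiffAt_expMap (hr : IsAdmissibleRadius d M r) {x : M}
    {v : TangentSpace (𝓡 d) x} (hv : ‖v‖ < r) :
    ContMDiffAt 𝓘(ℝ, TangentSpace (𝓡 d) x) (𝓡 d) ∞ (expMap x) v :=
  (hr.smooth_exp x).contMDiffAt (Metric.isOpen_ball.mem_nhds (by simpa using hv))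

theorem IsAdmissibleRadius.contMDiffAt_expInv (hr : IsAdmissibleRadius d M r) {x y : M}
    (hy : y ∈ Metric.ball x r) :
    ContMDiffAt (𝓡 d) 𝓘(ℝ, TangentSpace (𝓡 d) x) ∞ (expInv (d := d) r x) y :=
  (hr.smooth_inv x).contMDiffAt (Metric.isOpen_ball.mem_nhds hy)

/-- A map whose derivative is bounded by `Λ` near `x` is `2Λ`-Lipschitz in normal coordinates. -/
theorem IsAdmissibleRadius.dist_map_expMap_le [IsRiemannianManifold (𝓡 d) M]
    (hr : IsAdmissibleRadius d M r) {g : M → M} {x : M} {ρ s Λ : ℝ} (hρr : ρ ≤ r)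
    (hρs : 2 * ρ ≤ s) (hg : ContMDiffOn (𝓡 d) (𝓡 d) 1 g (Metric.ball x s))
    (hΛ : ∀ y ∈ Metric.ball x s, ‖mfderiv (𝓡 d) (𝓡 d) g y‖ ≤ Λ)
    {v w : TangentSpace (𝓡 d) x} (hv : ‖v‖ < ρ) (hw : ‖w‖ < ρ) :
    dist (g (expMap x v)) (g (expMap x w)) ≤ 2 * Λ * ‖w - v‖ := by
  have hseg : ∀ t ∈ Set.Icc (0 : ℝ) 1, ‖v + t • (w - v)‖ < ρ := by
    intro t ht
    have := (convex_ball (0 : TangentSpace (𝓡 d) x) ρ).add_smul_sub_mem (by simpa using hv)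
      (by simpa using hw) ht
    simpa using this
  have hmem : ∀ t ∈ Set.Icc (0 : ℝ) 1, expMap x (v + t • (w - v)) ∈ Metric.ball x s :=
    fun t ht => hr.expMap_mem_ball ((hseg t ht).trans_le hρr) (by linarith [hseg t ht])
  have hg' : ∀ t ∈ Set.Icc (0 : ℝ) 1, ContMDiffAt (𝓡 d) (𝓡 d) 1 g (expMap x (v + t • (w - v))) :=
    fun t ht => hg.contMDiffAt (Metric.isOpen_ball.mem_nhds (hmem t ht))
  have he : ∀ t ∈ Set.Icc (0 : ℝ) 1, ContMDiffAt 𝓘(ℝ, TangentSpace (𝓡 d) x) (𝓡 d) 1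
      (expMap x) (v + t • (w - v)) :=
    fun t ht => (hr.contMDiffAt_expMap ((hseg t ht).trans_le hρr)).of_le (by simp)
  have hl : ∀ t : ℝ, HasDerivAt (fun t : ℝ => v + t • (w - v)) (w - v) t := fun t => by
    simpa using ((hasDerivAt_id t).smul_const (w - v)).const_add v
  have hl' : ContDiff ℝ 1 (fun t : ℝ => v + t • (w - v)) :=
    contDiff_const.add (contDiff_id.smul contDiff_const)
  have key := dist_le_of_norm_mfderiv_le (γ := fun t : ℝ => g (expMap x (v + t • (w - v))))
    (c := 2 * Λ * ‖w - v‖) (fun t ht => (hg' t ht).comp t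
      ((he t ht).comp t hl'.contMDiff.contMDiffAt)) ?_
  · simpa using key
  · intro t ht
    have h1 := ((hg' t ht).mdifferentiableAt one_ne_zero).hasMFDerivAt
    have h2 := ((he t ht).mdifferentiableAt one_ne_zero).hasMFDerivAt
    have h3 : HasMFDerivAt 𝓘(ℝ, ℝ) 𝓘(ℝ, TangentSpace (𝓡 d) x)
      (fun t : ℝ => v + t • (w - v)) t _ := (hl t).hasFDerivAt.hasMFDerivAt
    have h4 := (HasMFDerivAt.comp t h1 (HasMFDerivAt.comp t h2 h3)).mfderiv
    have h5 : mfderiv 𝓘(ℝ, ℝ) (𝓡 d) (fun t : ℝ => g (expMap x (v + t • (w - v)))) t (1 : ℝ) =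
        mfderiv (𝓡 d) (𝓡 d) g (expMap x (v + t • (w - v)))
          (mfderiv 𝓘(ℝ, TangentSpace (𝓡 d) x) (𝓡 d) (expMap x) (v + t • (w - v)) (w - v)) := by
      refine (congrArg (fun l => l (1 : ℝ)) h4).trans ?_
      refine congrArg (fun u => mfderiv (𝓡 d) (𝓡 d) g (expMap x (v + t • (w - v)))
        (mfderiv 𝓘(ℝ, TangentSpace (𝓡 d) x) (𝓡 d) (expMap x) (v + t • (w - v)) u)) ?_
      exact (one_smul ℝ (w - v))
    rw [h5]
    have h6 := hr.norm_deriv_exp x (v + t • (w - v))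
      (by simpa using (hseg t ht).trans_le hρr) (w - v)
    have h7 := hΛ _ (hmem t ht)
    calc _ ≤ ‖mfderiv (𝓡 d) (𝓡 d) g (expMap x (v + t • (w - v)))‖ * _ :=
          ContinuousLinearMap.le_opNorm _ _
      _ ≤ Λ * (2 * ‖w - v‖) := mul_le_mul h7 h6 (norm_nonneg _) ((norm_nonneg _).trans h7)
      _ = _ := by ring

end Paths

/-! ### The exponential map in frames -/

section Frames

variable {d : ℕ} {M : Type*} [MetricSpace M] [ChartedSpace (EuclideanSpace ℝ (Fin d)) M]
  [RiemannianBundle (fun x : M => TangentSpace (𝓡 d) x)]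
  [IsManifold (𝓡 d) ∞ M] [IsContMDiffRiemannianBundle (𝓡 d) ∞ (EuclideanSpace ℝ (Fin d))
      (fun x : M => TangentSpace (𝓡 d) x)] {r : ℝ} {ι : Type*}

/-- The transition between two frames of the cover is Lipschitz, uniformly over all pairs. -/
theorem FrameCover.exists_lipschitz_transition (𝒟 : FrameCover d M r ι)
    (hr : IsAdmissibleRadius d M r) : ∃ C : ℝ, 0 ≤ C ∧ ∀ i j, ∀ q ∈ 𝒟.dom i ∩ 𝒟.dom j,
      ∀ q' ∈ 𝒟.dom i ∩ 𝒟.dom j, ∀ u : EuclideanSpace ℝ (Fin d),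
      ‖𝒟.Θ j q ((𝒟.Θ i q).symm u) - 𝒟.Θ j q' ((𝒟.Θ i q').symm u)‖ ≤ C * dist q q' * ‖u‖ := by
  obtain ⟨L, hL⟩ := 𝒟.lipschitz_exp
  have hr0 := hr.pos
  refine ⟨8 * max L 0 / r, by positivity, fun i j q hq q' hq' u => ?_⟩
  -- Let `u'` be the reading in frame `j` of the vector at `q'` that reads `u` in frame `i`. The
  -- exponentials at `q` of `u` in frame `i` and of `u'` in frame `j` both lie within `max L 0 *
  -- dist q q'` of one point, the exponential of that vector at `q'`. As `exp_q⁻¹` is `2`-Lipschitz,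
  -- this yields the factor `4`.
  have small : ∀ u : EuclideanSpace ℝ (Fin d), ‖u‖ < r →
      ‖𝒟.Θ j q ((𝒟.Θ i q).symm u) - 𝒟.Θ j q' ((𝒟.Θ i q').symm u)‖ ≤
        4 * (max L 0 * dist q q') := by
    intro u hu
    have h1 := hL i q hq.1 q' hq'.1 u (by simpa using hu) u (by simpa using hu)
    have h2 := hL j q' hq'.2 q hq.2 (𝒟.Θ j q' ((𝒟.Θ i q').symm u)) (by simpa using hu)
      (𝒟.Θ j q' ((𝒟.Θ i q').symm u)) (by simpa using hu)
    rw [LinearIsometryEquiv.symm_apply_apply, sub_self, norm_zero, add_zero] at h2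
    rw [sub_self, norm_zero, add_zero] at h1
    have h3 : L * dist q q' ≤ max L 0 * dist q q' :=
      mul_le_mul_of_nonneg_right (le_max_left _ _) dist_nonneg
    rw [dist_comm q' q] at h2
    have h4 := (dist_triangle _ _ _).trans (add_le_add (h1.trans h3) (h2.trans h3))
    have b1 : ‖(𝒟.Θ i q).symm u‖ < r := by simpa using hu
    have b2 : ‖(𝒟.Θ j q).symm (𝒟.Θ j q' ((𝒟.Θ i q').symm u))‖ < r := by simpa using hu
    have h5 := hr.norm_expInv_sub_le
      ((hr.bijOn q).mapsTo (mem_ball_zero_iff.2 b1)) ((hr.bijOn q).mapsTo (mem_ball_zero_iff.2 b2))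
    rw [hr.expInv_expMap b1, hr.expInv_expMap b2] at h5
    have h6 : ‖𝒟.Θ j q ((𝒟.Θ i q).symm u) - 𝒟.Θ j q' ((𝒟.Θ i q').symm u)‖ =
        ‖(𝒟.Θ i q).symm u - (𝒟.Θ j q).symm (𝒟.Θ j q' ((𝒟.Θ i q').symm u))‖ := by
      rw [← (𝒟.Θ j q).norm_map ((𝒟.Θ i q).symm u - _), map_sub,
        LinearIsometryEquiv.apply_symm_apply]
    rw [h6]
    linarith
  rcases eq_or_ne u 0 with rfl | hu
  · simp
  have hu0 : 0 < ‖u‖ := norm_pos_iff.2 hu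
  -- Rescaling to length `r / 2` extends the bound to all `u`; hence the constant `8 * max L 0 / r`.
  have h1 := small ((r / (2 * ‖u‖)) • u) (by
    rw [norm_smul, Real.norm_of_nonneg (by positivity)]
    field_simp
    linarith)
  simp only [map_smul, ← smul_sub] at h1
  rw [norm_smul, Real.norm_of_nonneg (by positivity), div_mul_eq_mul_div,
    div_le_iff₀ (by positivity)] at h1
  rw [div_mul_eq_mul_div, div_mul_eq_mul_div, le_div_iff₀ hr0]
  linarith

/-- The exponential map in the frame of index `i` and the preferred chart at `p`. -/
def FrameCover.expInChart (𝒟 : FrameCover d M r ι) (i : ι) (p : M)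
    (q : EuclideanSpace ℝ (Fin d) × EuclideanSpace ℝ (Fin d)) : M :=
  expMap ((extChartAt (𝓡 d) p).symm q.1) ((𝒟.Θ i ((extChartAt (𝓡 d) p).symm q.1)).symm q.2)

theorem FrameCover.isOpen_dom (𝒟 : FrameCover d M r ι) (i : ι) : IsOpen (𝒟.dom i) :=
  Metric.isOpen_ball

/-- The domain of the exponential map in a frame and a chart. -/
def FrameCover.chartDom (𝒟 : FrameCover d M r ι) (i : ι) (p : M) :
    Set (EuclideanSpace ℝ (Fin d) × EuclideanSpace ℝ (Fin d)) :=
  ((extChartAt (𝓡 d) p).target ∩ (extChartAt (𝓡 d) p).symm ⁻¹' 𝒟.dom i) ×ˢ Metric.ball 0 r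

theorem FrameCover.isOpen_chartDom (𝒟 : FrameCover d M r ι) (i : ι) (p : M) :
    IsOpen (𝒟.chartDom i p) :=
  ((continuousOn_extChartAt_symm p).isOpen_inter_preimage (isOpen_extChartAt_target p)
    (𝒟.isOpen_dom i)).prod Metric.isOpen_ball

theorem FrameCover.contMDiffOn_expInChart (𝒟 : FrameCover d M r ι) (i : ι) (p : M) :
    ContMDiffOn 𝓘(ℝ, EuclideanSpace ℝ (Fin d) × EuclideanSpace ℝ (Fin d)) (𝓡 d) ∞
      (𝒟.expInChart i p) (𝒟.chartDom i p) := by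
  have h1 : ContMDiffOn 𝓘(ℝ, EuclideanSpace ℝ (Fin d) × EuclideanSpace ℝ (Fin d)) (𝓡 d) ∞
      (fun q : EuclideanSpace ℝ (Fin d) × EuclideanSpace ℝ (Fin d) =>
        (extChartAt (𝓡 d) p).symm q.1) (𝒟.chartDom i p) :=
    (contMDiffOn_extChartAt_symm p).comp contDiff_fst.contMDiff.contMDiffOn fun q hq => hq.1.1
  have h2 : ContMDiffOn 𝓘(ℝ, EuclideanSpace ℝ (Fin d) × EuclideanSpace ℝ (Fin d))
      𝓘(ℝ, EuclideanSpace ℝ (Fin d)) ∞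
      (fun q : EuclideanSpace ℝ (Fin d) × EuclideanSpace ℝ (Fin d) => q.2) (𝒟.chartDom i p) :=
    contDiff_snd.contMDiff.contMDiffOn
  exact (𝒟.smooth_exp i).comp (h1.prodMk h2) fun q hq => ⟨hq.1.2, hq.2⟩

/-- The derivative of the exponential map in a frame, as a function on the chart domain. -/
def FrameCover.dexpInChart (𝒟 : FrameCover d M r ι) (i : ι) (p : M)
    (q : EuclideanSpace ℝ (Fin d) × EuclideanSpace ℝ (Fin d)) :
    EuclideanSpace ℝ (Fin d) →L[ℝ] EuclideanSpace ℝ (Fin d) :=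
  let A : EuclideanSpace ℝ (Fin d) × EuclideanSpace ℝ (Fin d) →L[ℝ]
      TangentSpace (𝓡 d) (𝒟.expInChart i p q) :=
    mfderiv 𝓘(ℝ, EuclideanSpace ℝ (Fin d) × EuclideanSpace ℝ (Fin d)) (𝓡 d) (𝒟.expInChart i p) q
  ((𝒟.Θ i (𝒟.expInChart i p q)).toContinuousLinearEquiv :
      TangentSpace (𝓡 d) (𝒟.expInChart i p q) →L[ℝ] EuclideanSpace ℝ (Fin d)) ∘L A ∘L
    ContinuousLinearMap.inr ℝ _ _

/-- This is the tangent map of the exponential map along the constant field `(0, w)`, followed by `Θ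
i`. The domain is cut down because `Θ i` is smooth only above `𝒟.dom i`. -/
theorem FrameCover.contDiffOn_dexpInChart (𝒟 : FrameCover d M r ι) (i : ι) (p : M) :
    ContDiffOn ℝ ∞ (𝒟.dexpInChart i p)
      (𝒟.chartDom i p ∩ 𝒟.expInChart i p ⁻¹' 𝒟.dom i) := by
  rw [contDiffOn_clm_apply]
  intro w
  rw [← contMDiffOn_iff_contDiffOn]
  have hE := 𝒟.contMDiffOn_expInChart i p
  have hopen := 𝒟.isOpen_chartDom i p
  have h1 := hE.contMDiffOn_tangentMapWithin (m := ∞) (by simp) hopen.uniqueMDiffOn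
  have h2 : ContMDiffOn 𝓘(ℝ, EuclideanSpace ℝ (Fin d) × EuclideanSpace ℝ (Fin d))
      𝓘(ℝ, EuclideanSpace ℝ (Fin d) × EuclideanSpace ℝ (Fin d)).tangent ∞
      (fun q => (⟨q, ((0 : EuclideanSpace ℝ (Fin d)), w)⟩ :
        TangentBundle 𝓘(ℝ, EuclideanSpace ℝ (Fin d) × EuclideanSpace ℝ (Fin d))
          (EuclideanSpace ℝ (Fin d) × EuclideanSpace ℝ (Fin d))))
      (𝒟.chartDom i p ∩ 𝒟.expInChart i p ⁻¹' 𝒟.dom i) :=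
    contMDiffOn_vectorSpace_iff_contDiffOn.2 contDiffOn_const
  have h3 := h1.comp h2 (fun q hq => hq.1)
  have h4 := (𝒟.smooth_Θ i).comp h3 (fun q hq => hq.2)
  refine h4.congr fun q hq => ?_
  simp only [Function.comp, tangentMapWithin]
  rw [mfderivWithin_of_isOpen hopen hq.1]
  rfl

/-- The derivative of `exp_x` at `v`, followed by the frame of index `i`. -/
def FrameCover.dexpFrame (𝒟 : FrameCover d M r ι) (i : ι) (x : M) (v : TangentSpace (𝓡 d) x) :
    TangentSpace (𝓡 d) x →L[ℝ] EuclideanSpace ℝ (Fin d) :=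
  let A : TangentSpace (𝓡 d) x →L[ℝ] TangentSpace (𝓡 d) (expMap x v) :=
    mfderiv 𝓘(ℝ, TangentSpace (𝓡 d) x) (𝓡 d) (expMap x) v
  ((𝒟.Θ i (expMap x v)).toContinuousLinearEquiv :
      TangentSpace (𝓡 d) (expMap x v) →L[ℝ] EuclideanSpace ℝ (Fin d)) ∘L A

theorem FrameCover.dexpInChart_apply (𝒟 : FrameCover d M r ι) (hr : IsAdmissibleRadius d M r)
    (i : ι) (p : M) {q : EuclideanSpace ℝ (Fin d) × EuclideanSpace ℝ (Fin d)}
    (hq : q ∈ 𝒟.chartDom i p) (w : EuclideanSpace ℝ (Fin d)) :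
    𝒟.dexpInChart i p q w = 𝒟.dexpFrame i ((extChartAt (𝓡 d) p).symm q.1)
      ((𝒟.Θ i ((extChartAt (𝓡 d) p).symm q.1)).symm q.2)
      ((𝒟.Θ i ((extChartAt (𝓡 d) p).symm q.1)).symm w) := by
  obtain ⟨z, u⟩ := q
  set x := (extChartAt (𝓡 d) p).symm z with hx
  have hu : ‖(𝒟.Θ i x).symm u‖ < r := by simpa using hq.2
  have h1 := (((𝒟.contMDiffOn_expInChart i p).contMDiffAt
    ((𝒟.isOpen_chartDom i p).mem_nhds hq)).mdifferentiableAt (by simp)).hasMFDerivAt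
  have h2 : HasMFDerivAt 𝓘(ℝ, EuclideanSpace ℝ (Fin d))
      𝓘(ℝ, EuclideanSpace ℝ (Fin d) × EuclideanSpace ℝ (Fin d))
      (fun u : EuclideanSpace ℝ (Fin d) => (z, u)) u (ContinuousLinearMap.inr ℝ _ _) :=
    (hasFDerivAt_prodMk_right z u).hasMFDerivAt
  have h3 := (HasMFDerivAt.comp u h1 h2).mfderiv
  have h4 := ((hr.contMDiffAt_expMap hu).mdifferentiableAt (by simp)).hasMFDerivAt
  have h5 : HasMFDerivAt 𝓘(ℝ, EuclideanSpace ℝ (Fin d)) 𝓘(ℝ, TangentSpace (𝓡 d) x)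
      (fun u : EuclideanSpace ℝ (Fin d) => (𝒟.Θ i x).symm u) u
      ((𝒟.Θ i x).symm.toContinuousLinearEquiv :
        EuclideanSpace ℝ (Fin d) →L[ℝ] TangentSpace (𝓡 d) x) :=
    ((𝒟.Θ i x).symm.toContinuousLinearEquiv.hasFDerivAt).hasMFDerivAt
  have h6 := (HasMFDerivAt.comp u h4 h5).mfderiv
  have h7 := congrArg (fun l => l w) (h3.symm.trans h6)
  exact congrArg (𝒟.Θ i (expMap x ((𝒟.Θ i x).symm u))) h7

/-- The exponential map sends `(p, 0)` to `p`, so nearby it lands in the domain of a frame around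
`p`. There its derivative is `C^1`, hence Lipschitz jointly in base point and vector; only the
dependence on the vector is kept. -/
theorem FrameCover.exists_local_lipschitz_dexpFrame (𝒟 : FrameCover d M r ι)
    (hr : IsAdmissibleRadius d M r) (p : M) : ∃ i, ∃ U ∈ 𝓝 p, ∃ δ > 0, ∃ K : ℝ, 0 ≤ K ∧
      ∀ x ∈ U, ∀ v w : TangentSpace (𝓡 d) x, ‖v‖ < δ → ‖w‖ < δ →
        expMap x v ∈ 𝒟.dom i ∧ ∀ ξ,
        ‖𝒟.dexpFrame i x v ξ - 𝒟.dexpFrame i x w ξ‖ ≤ K * ‖v - w‖ * ‖ξ‖ := by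
  obtain ⟨i, hi⟩ := 𝒟.covers p
  set z := extChartAt (𝓡 d) p p with hz
  have hzp : (extChartAt (𝓡 d) p).symm z = p := extChartAt_to_inv p
  have hdom : (z, (0 : EuclideanSpace ℝ (Fin d))) ∈ 𝒟.chartDom i p := by
    refine ⟨⟨mem_extChartAt_target p, ?_⟩, Metric.mem_ball_self hr.pos⟩
    rw [Set.mem_preimage, hzp]
    exact hi
  have hE : 𝒟.expInChart i p (z, 0) = p := by
    simp only [expInChart, hzp, map_zero, expMap_zero]
  have hopen : IsOpen (𝒟.chartDom i p ∩ 𝒟.expInChart i p ⁻¹' 𝒟.dom i) :=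
    (𝒟.contMDiffOn_expInChart i p).continuousOn.isOpen_inter_preimage
      (𝒟.isOpen_chartDom i p) (𝒟.isOpen_dom i)
  have hmem : (z, (0 : EuclideanSpace ℝ (Fin d))) ∈
      𝒟.chartDom i p ∩ 𝒟.expInChart i p ⁻¹' 𝒟.dom i := ⟨hdom, by
    rw [Set.mem_preimage, hE]; exact hi⟩
  obtain ⟨K, t, ht, hK⟩ := (((𝒟.contDiffOn_dexpInChart i p).contDiffAt
    (hopen.mem_nhds hmem)).of_le (n := ∞) (m := 1) ENat.LEInfty.out).exists_lipschitzOnWith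
  have ht' := Filter.inter_mem ht (hopen.mem_nhds hmem)
  rw [nhds_prod_eq] at ht'
  obtain ⟨V, hV, W, hW, hVW⟩ := Filter.mem_prod_iff.1 ht'
  obtain ⟨δ, hδ, hδW⟩ := Metric.mem_nhds_iff.1 hW
  refine ⟨i, (extChartAt (𝓡 d) p).source ∩ extChartAt (𝓡 d) p ⁻¹' V,
    Filter.inter_mem (extChartAt_source_mem_nhds p)
      ((continuousAt_extChartAt p).preimage_mem_nhds hV), δ, hδ, K, K.2,
    fun x hx v w hv hw => ?_⟩
  have hxs : (extChartAt (𝓡 d) p).symm (extChartAt (𝓡 d) p x) = x :=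
    (extChartAt (𝓡 d) p).left_inv hx.1
  have mem : ∀ v : TangentSpace (𝓡 d) x, ‖v‖ < δ →
      (extChartAt (𝓡 d) p x, 𝒟.Θ i x v) ∈ t ∩ (𝒟.chartDom i p ∩ 𝒟.expInChart i p ⁻¹' 𝒟.dom i) :=
    fun v hv => hVW ⟨hx.2, hδW (by simpa using hv)⟩
  have happ : ∀ v : TangentSpace (𝓡 d) x, ‖v‖ < δ → ∀ ξ,
      𝒟.dexpInChart i p (extChartAt (𝓡 d) p x, 𝒟.Θ i x v) (𝒟.Θ i x ξ) = 𝒟.dexpFrame i x v ξ := by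
    intro v hv ξ
    rw [𝒟.dexpInChart_apply hr i p (mem v hv).2.1]
    have aux : ∀ y, y = x → 𝒟.dexpFrame i y ((𝒟.Θ i y).symm (𝒟.Θ i x v))
        ((𝒟.Θ i y).symm (𝒟.Θ i x ξ)) = 𝒟.dexpFrame i x v ξ := by
      rintro _ rfl
      rw [LinearIsometryEquiv.symm_apply_apply, LinearIsometryEquiv.symm_apply_apply]
    exact aux _ hxs
  constructor
  · have := (mem v hv).2.2
    have aux : ∀ y, y = x → expMap y ((𝒟.Θ i y).symm (𝒟.Θ i x v)) = expMap x v := by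
      rintro _ rfl
      rw [LinearIsometryEquiv.symm_apply_apply]
    rw [← aux _ hxs]
    exact this
  · intro ξ
    rw [← happ v hv, ← happ w hw, ← sub_apply]
    refine (ContinuousLinearMap.le_opNorm _ _).trans ?_
    rw [LinearIsometryEquiv.norm_map]
    refine mul_le_mul_of_nonneg_right ?_ (norm_nonneg _)
    have := hK.norm_sub_le (mem v hv).1 (mem w hw).1
    refine this.trans (le_of_eq ?_)
    congr 1
    rw [Prod.mk_sub_mk, sub_self, Prod.norm_mk, norm_zero, max_eq_right (norm_nonneg _),
      ← map_sub, LinearIsometryEquiv.norm_map]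

/-- The derivative of the exponential map, read in the frames of the cover, is Lipschitz near the
origin, with constants which depend neither on the base point nor on the frame. -/
theorem FrameCover.exists_lipschitz_dexpFrame [CompactSpace M] (𝒟 : FrameCover d M r ι)
    (hr : IsAdmissibleRadius d M r) : ∃ δ > 0, δ ≤ r ∧ ∃ K : ℝ, 0 ≤ K ∧
      ∀ (i : ι) (x : M), ∀ v w : TangentSpace (𝓡 d) x, ‖v‖ < δ → ‖w‖ < δ →
        expMap x v ∈ 𝒟.dom i → expMap x w ∈ 𝒟.dom i → ∀ ξ,
        ‖𝒟.dexpFrame i x v ξ - 𝒟.dexpFrame i x w ξ‖ ≤ K * ‖v - w‖ * ‖ξ‖ := by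
  obtain ⟨C, hC, hCt⟩ := 𝒟.exists_lipschitz_transition hr
  choose i U hU δ hδ K hK h using 𝒟.exists_local_lipschitz_dexpFrame hr
  obtain ⟨s, -, hs⟩ := isCompact_univ.elim_nhds_subcover U fun x _ => hU x
  obtain ⟨δ₀, hδ₀, hδs⟩ : ∃ δ₀ > 0, ∀ p ∈ s, δ₀ ≤ δ p := by
    classical
    clear hs
    induction s using Finset.induction_on with
    | empty => exact ⟨1, one_pos, by simp⟩
    | insert a s ha ih =>
      obtain ⟨e, he, hes⟩ := ih
      refine ⟨min e (δ a), lt_min he (hδ a), fun p hp => ?_⟩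
      rcases Finset.mem_insert.1 hp with rfl | hp
      · exact min_le_right _ _
      · exact (min_le_left _ _).trans (hes p hp)
  -- The term `4 * C` is the cost of passing from the local frame to frame `j`: the transition
  -- varies by `C * (2 * ‖v - w‖)` and acts on a vector of norm at most `2 * ‖ξ‖`.
  refine ⟨min δ₀ r, lt_min hδ₀ hr.pos, min_le_right _ _, ∑ p ∈ s, K p + 4 * C,
    by have := Finset.sum_nonneg (s := s) fun p _ => hK p; positivity, ?_⟩
  intro j x v w hv hw hvj hwj ξ
  obtain ⟨p, hp, hxp⟩ : ∃ p ∈ s, x ∈ U p := by simpa using hs (Set.mem_univ x)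
  have hvp := (hv.trans_le (min_le_left _ _)).trans_le (hδs p hp)
  have hwp := (hw.trans_le (min_le_left _ _)).trans_le (hδs p hp)
  have hvr := hv.trans_le (min_le_right _ _)
  have hwr := hw.trans_le (min_le_right _ _)
  obtain ⟨hvi, hL⟩ := h p x hxp v w hvp hwp
  have hwi := (h p x hxp w v hwp hvp).1
  have hT := hCt (i p) j (expMap x v) ⟨hvi, hvj⟩ (expMap x w) ⟨hwi, hwj⟩
  have hform : ∀ v : TangentSpace (𝓡 d) x, 𝒟.dexpFrame j x v ξ =
      𝒟.Θ j (expMap x v) ((𝒟.Θ (i p) (expMap x v)).symm (𝒟.dexpFrame (i p) x v ξ)) := by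
    intro v
    change _ = 𝒟.Θ j (expMap x v) ((𝒟.Θ (i p) (expMap x v)).symm (𝒟.Θ (i p) (expMap x v) _))
    rw [LinearIsometryEquiv.symm_apply_apply]
    rfl
  have hn : ‖𝒟.dexpFrame (i p) x v ξ‖ ≤ 2 * ‖ξ‖ := by
    refine le_trans (le_of_eq ?_) (hr.norm_deriv_exp x v (by simpa using hvr) ξ)
    exact (𝒟.Θ (i p) (expMap x v)).norm_map _
  have hdist : dist (expMap x v) (expMap x w) ≤ 2 * ‖v - w‖ := by
    have := (hr.lipschitz_exp x).dist_le_mul v (by simpa using hvr) w (by simpa using hwr)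
    rw [dist_eq_norm] at this
    exact_mod_cast this
  rw [hform v, hform w]
  set a := 𝒟.dexpFrame (i p) x v ξ
  set b := 𝒟.dexpFrame (i p) x w ξ
  have h1 : ‖𝒟.Θ j (expMap x w) ((𝒟.Θ (i p) (expMap x w)).symm a) -
      𝒟.Θ j (expMap x w) ((𝒟.Θ (i p) (expMap x w)).symm b)‖ = ‖a - b‖ := by
    rw [← map_sub, ← map_sub, LinearIsometryEquiv.norm_map, LinearIsometryEquiv.norm_map]
  have h2 := norm_sub_le_norm_sub_add_norm_sub
    (𝒟.Θ j (expMap x v) ((𝒟.Θ (i p) (expMap x v)).symm a))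
    (𝒟.Θ j (expMap x w) ((𝒟.Θ (i p) (expMap x w)).symm a))
    (𝒟.Θ j (expMap x w) ((𝒟.Θ (i p) (expMap x w)).symm b))
  rw [h1] at h2
  have h3 : C * dist (expMap x v) (expMap x w) * ‖a‖ ≤ C * (2 * ‖v - w‖) * (2 * ‖ξ‖) := by
    gcongr
  have h4 : K p ≤ ∑ p ∈ s, K p := Finset.single_le_sum (fun p _ => hK p) hp
  have h5 : K p * ‖v - w‖ * ‖ξ‖ ≤ (∑ p ∈ s, K p) * ‖v - w‖ * ‖ξ‖ := by gcongr
  have h6 := hL ξ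
  have h7 := hT a
  linarith

end Frames

/-! ### Maps read in exponential charts -/

section Branches

variable {d : ℕ} {M : Type*} [MetricSpace M] [ChartedSpace (EuclideanSpace ℝ (Fin d)) M]
  [RiemannianBundle (fun x : M => TangentSpace (𝓡 d) x)]
  [IsManifold (𝓡 d) ∞ M] [IsContMDiffRiemannianBundle (𝓡 d) ∞ (EuclideanSpace ℝ (Fin d))
      (fun x : M => TangentSpace (𝓡 d) x)] {r : ℝ} {ι : Type*}

/-- The derivative of `exp_y⁻¹` at `q`, preceded by the inverse of the frame of index `j`. -/
def FrameCover.dlogFrame (𝒟 : FrameCover d M r ι) (j : ι) (y q : M) :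
    EuclideanSpace ℝ (Fin d) →L[ℝ] TangentSpace (𝓡 d) y :=
  let A : TangentSpace (𝓡 d) q →L[ℝ] TangentSpace (𝓡 d) y :=
    mfderiv (𝓡 d) 𝓘(ℝ, TangentSpace (𝓡 d) y) (expInv (d := d) r y) q
  A ∘L ((𝒟.Θ j q).symm.toContinuousLinearEquiv :
    EuclideanSpace ℝ (Fin d) →L[ℝ] TangentSpace (𝓡 d) q)

theorem FrameCover.norm_dlogFrame_le (𝒟 : FrameCover d M r ι) (hr : IsAdmissibleRadius d M r)
    (j : ι) {y q : M} (hq : q ∈ Metric.ball y r) (ζ : EuclideanSpace ℝ (Fin d)) :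
    ‖𝒟.dlogFrame j y q ζ‖ ≤ 2 * ‖ζ‖ := by
  have := hr.norm_deriv_inv y q hq ((𝒟.Θ j q).symm ζ)
  rw [LinearIsometryEquiv.norm_map] at this
  exact this

theorem FrameCover.norm_dexpFrame_le (𝒟 : FrameCover d M r ι) (hr : IsAdmissibleRadius d M r)
    (i : ι) {x : M} {v : TangentSpace (𝓡 d) x} (hv : ‖v‖ < r) (ξ : TangentSpace (𝓡 d) x) :
    ‖𝒟.dexpFrame i x v ξ‖ ≤ 2 * ‖ξ‖ := by
  refine le_trans (le_of_eq ?_) (hr.norm_deriv_exp x v (mem_ball_zero_iff.2 hv) ξ)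
  exact (𝒟.Θ i (expMap x v)).norm_map _

theorem IsAdmissibleRadius.mfderiv_expInv_mfderiv_expMap (hr : IsAdmissibleRadius d M r) {y : M}
    {v : TangentSpace (𝓡 d) y} (hv : ‖v‖ < r) (ξ : TangentSpace (𝓡 d) y) :
    mfderiv (𝓡 d) 𝓘(ℝ, TangentSpace (𝓡 d) y) (expInv (d := d) r y) (expMap y v)
      (mfderiv 𝓘(ℝ, TangentSpace (𝓡 d) y) (𝓡 d) (expMap y) v ξ) = ξ := by
  have hq : expMap y v ∈ Metric.ball y r := (hr.bijOn y).mapsTo (mem_ball_zero_iff.2 hv)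
  have h1 := ((hr.contMDiffAt_expInv hq).mdifferentiableAt (by simp)).hasMFDerivAt
  have h2 := ((hr.contMDiffAt_expMap hv).mdifferentiableAt (by simp)).hasMFDerivAt
  have h3 := HasMFDerivAt.comp v h1 h2
  have h4 : HasMFDerivAt 𝓘(ℝ, TangentSpace (𝓡 d) y) 𝓘(ℝ, TangentSpace (𝓡 d) y)
      (expInv (d := d) r y ∘ expMap y) v
      (ContinuousLinearMap.id ℝ (TangentSpace (𝓡 d) y)) := by
    refine (hasMFDerivAt_id v).congr_of_eventuallyEq ?_
    filter_upwards [Metric.isOpen_ball.mem_nhds (mem_ball_zero_iff.2 hv)] with w hw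
    exact hr.expInv_expMap (mem_ball_zero_iff.1 hw)
  exact congrArg (fun l => l ξ) (hasMFDerivAt_unique h3 h4)

theorem IsAdmissibleRadius.mfderiv_expMap_mfderiv_expInv (hr : IsAdmissibleRadius d M r) {y : M}
    {v : TangentSpace (𝓡 d) y} (hv : ‖v‖ < r) (ξ : TangentSpace (𝓡 d) (expMap y v)) :
    mfderiv 𝓘(ℝ, TangentSpace (𝓡 d) y) (𝓡 d) (expMap y) v
      (mfderiv (𝓡 d) 𝓘(ℝ, TangentSpace (𝓡 d) y) (expInv (d := d) r y) (expMap y v) ξ) = ξ := by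
  have hq : expMap y v ∈ Metric.ball y r := (hr.bijOn y).mapsTo (mem_ball_zero_iff.2 hv)
  have h1 := ((hr.contMDiffAt_expInv hq).mdifferentiableAt (by simp)).hasMFDerivAt
  have h2 : HasMFDerivAt 𝓘(ℝ, TangentSpace (𝓡 d) y) (𝓡 d) (expMap y)
      (expInv (d := d) r y (expMap y v))
      (mfderiv 𝓘(ℝ, TangentSpace (𝓡 d) y) (𝓡 d) (expMap y) v) := by
    rw [hr.expInv_expMap hv]
    exact ((hr.contMDiffAt_expMap hv).mdifferentiableAt (by simp)).hasMFDerivAt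
  have h3 := HasMFDerivAt.comp (expMap y v) h2 h1
  have h4 : HasMFDerivAt (𝓡 d) (𝓡 d)
      (expMap y ∘ expInv (d := d) r y) (expMap y v)
      (ContinuousLinearMap.id ℝ (TangentSpace (𝓡 d) (expMap y v))) := by
    refine (hasMFDerivAt_id (expMap y v)).congr_of_eventuallyEq ?_
    filter_upwards [Metric.isOpen_ball.mem_nhds hq] with w hw
    exact hr.expMap_expInv hw
  exact congrArg (fun l => l ξ) (hasMFDerivAt_unique h3 h4)

theorem FrameCover.dlogFrame_dexpFrame (𝒟 : FrameCover d M r ι) (hr : IsAdmissibleRadius d M r)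
    (j : ι) {y : M} {v : TangentSpace (𝓡 d) y} (hv : ‖v‖ < r) (ξ : TangentSpace (𝓡 d) y) :
    𝒟.dlogFrame j y (expMap y v) (𝒟.dexpFrame j y v ξ) = ξ := by
  refine Eq.trans ?_ (hr.mfderiv_expInv_mfderiv_expMap hv ξ)
  exact congrArg (mfderiv (𝓡 d) 𝓘(ℝ, TangentSpace (𝓡 d) y) (expInv (d := d) r y) (expMap y v))
    ((𝒟.Θ j (expMap y v)).symm_apply_apply _)

theorem FrameCover.dexpFrame_dlogFrame (𝒟 : FrameCover d M r ι) (hr : IsAdmissibleRadius d M r)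
    (j : ι) {y : M} {v : TangentSpace (𝓡 d) y} (hv : ‖v‖ < r) (ζ : EuclideanSpace ℝ (Fin d)) :
    𝒟.dexpFrame j y v (𝒟.dlogFrame j y (expMap y v) ζ) = ζ := by
  refine Eq.trans ?_ ((𝒟.Θ j (expMap y v)).apply_symm_apply ζ)
  exact congrArg (𝒟.Θ j (expMap y v)) (hr.mfderiv_expMap_mfderiv_expInv hv _)

/-- From `X⁻¹ - Y⁻¹ = X⁻¹ (Y - X) Y⁻¹` with `X`, `Y` the derivatives of `exp_y`; both inverses have
norm at most `2`, whence the factor `4`. -/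
theorem FrameCover.norm_dlogFrame_sub_le (𝒟 : FrameCover d M r ι) (hr : IsAdmissibleRadius d M r)
    {j : ι} {y : M} {δ L : ℝ} (hδr : δ ≤ r) (hL : 0 ≤ L)
    (hlip : ∀ v w : TangentSpace (𝓡 d) y, ‖v‖ < δ → ‖w‖ < δ →
        expMap y v ∈ 𝒟.dom j → expMap y w ∈ 𝒟.dom j → ∀ ξ,
        ‖𝒟.dexpFrame j y v ξ - 𝒟.dexpFrame j y w ξ‖ ≤ L * ‖v - w‖ * ‖ξ‖)
    {p q : M} (hp : p ∈ Metric.ball y r) (hq : q ∈ Metric.ball y r) (hpj : p ∈ 𝒟.dom j)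
    (hqj : q ∈ 𝒟.dom j) (hpδ : ‖expInv (d := d) r y p‖ < δ) (hqδ : ‖expInv (d := d) r y q‖ < δ)
    (z : EuclideanSpace ℝ (Fin d)) :
    ‖𝒟.dlogFrame j y p z - 𝒟.dlogFrame j y q z‖ ≤
      4 * L * ‖expInv (d := d) r y p - expInv (d := d) r y q‖ * ‖z‖ := by
  set v := expInv (d := d) r y p with hvdef
  set w := expInv (d := d) r y q with hwdef
  have hpe : expMap y v = p := hr.expMap_expInv hp
  have hqe : expMap y w = q := hr.expMap_expInv hq
  set y' := 𝒟.dlogFrame j y q z with hy'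
  have e1 : 𝒟.dlogFrame j y p (𝒟.dexpFrame j y v y') = y' := by
    rw [← hpe]; exact 𝒟.dlogFrame_dexpFrame hr j (hpδ.trans_le hδr) y'
  have e2 : 𝒟.dexpFrame j y w y' = z := by
    rw [hy', ← hqe]; exact 𝒟.dexpFrame_dlogFrame hr j (hqδ.trans_le hδr) z
  have e3 : 𝒟.dlogFrame j y p z - y' =
      𝒟.dlogFrame j y p (𝒟.dexpFrame j y w y' - 𝒟.dexpFrame j y v y') := by
    rw [map_sub, e1, e2]
  have e4 : ‖y'‖ ≤ 2 * ‖z‖ := 𝒟.norm_dlogFrame_le hr j hq z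
  have e5 := hlip w v hqδ hpδ (by rwa [hqe]) (by rwa [hpe]) y'
  rw [norm_sub_rev w v] at e5
  have e6 : L * ‖v - w‖ * ‖y'‖ ≤ L * ‖v - w‖ * (2 * ‖z‖) := by gcongr
  rw [e3]
  refine (𝒟.norm_dlogFrame_le hr j hp _).trans ?_
  linarith

/-- `g` maps `x` to `y`, is `C^{1+β}` on the ball of radius `s` about `x`, with derivative at most
`Λ` and Hölder constant `K` in the frames of index `i` and `j`. -/
structure FrameCover.IsBranch (𝒟 : FrameCover d M r ι) (g : M → M) (x y : M) (s Λ K β : ℝ)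
    (i j : ι) : Prop where
  map_eq : g x = y
  one_le : 1 ≤ Λ
  smooth : ContMDiffOn (𝓡 d) (𝓡 d) 1 g (Metric.ball x s)
  norm_le : ∀ p ∈ Metric.ball x s, ‖mfderiv (𝓡 d) (𝓡 d) g p‖ ≤ Λ
  dom_left : Metric.ball x s ⊆ 𝒟.dom i
  dom_right : Metric.ball y s ⊆ 𝒟.dom j
  holder : ∀ p ∈ Metric.ball x s, ∀ q ∈ Metric.ball x s, g p ∈ 𝒟.dom j → g q ∈ 𝒟.dom j →
    ‖𝒟.read i j p (g p) (mfderiv (𝓡 d) (𝓡 d) g p)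
      - 𝒟.read i j q (g q) (mfderiv (𝓡 d) (𝓡 d) g q)‖ ≤ K * dist p q ^ β

variable (r) in
/-- The map `g` in the charts `exp_x ∘ C` and `exp_y ∘ C'`. -/
def branchMap (g : M → M) (x y : M) (C : EuclideanSpace ℝ (Fin d) ≃L[ℝ] TangentSpace (𝓡 d) x)
    (C' : EuclideanSpace ℝ (Fin d) ≃L[ℝ] TangentSpace (𝓡 d) y)
    (u : EuclideanSpace ℝ (Fin d)) : EuclideanSpace ℝ (Fin d) :=
  C'.symm (expInv (d := d) r y (g (expMap x (C u))))

namespace FrameCover.IsBranch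

variable {𝒟 : FrameCover d M r ι} {g : M → M} {x y : M} {s Λ K β ρ : ℝ} {i j : ι}
  {C : EuclideanSpace ℝ (Fin d) ≃L[ℝ] TangentSpace (𝓡 d) x}
  {C' : EuclideanSpace ℝ (Fin d) ≃L[ℝ] TangentSpace (𝓡 d) y}

theorem dist_le [IsRiemannianManifold (𝓡 d) M] (h : 𝒟.IsBranch g x y s Λ K β i j)
    (hr : IsAdmissibleRadius d M r) {v : TangentSpace (𝓡 d) x} (hvr : ‖v‖ < r)
    (hvs : 2 * ‖v‖ < s) : dist (g (expMap x v)) y ≤ 2 * Λ * ‖v‖ := by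
  have hlt : ‖v‖ < min r (s / 2) := lt_min hvr (by linarith)
  have h1 := hr.dist_map_expMap_le (ρ := min r (s / 2)) (min_le_left _ _)
    (by linarith [min_le_right r (s / 2)]) h.smooth h.norm_le hlt
    (w := 0) (by rw [norm_zero]; exact (norm_nonneg v).trans_lt hlt)
  rwa [expMap_zero, h.map_eq, zero_sub, norm_neg] at h1

theorem dist_sub_le [IsRiemannianManifold (𝓡 d) M] (h : 𝒟.IsBranch g x y s Λ K β i j)
    (hr : IsAdmissibleRadius d M r) {v w : TangentSpace (𝓡 d) x} (hvr : ‖v‖ < r)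
    (hvs : 2 * ‖v‖ < s) (hwr : ‖w‖ < r) (hws : 2 * ‖w‖ < s) :
    dist (g (expMap x v)) (g (expMap x w)) ≤ 2 * Λ * ‖v - w‖ := by
  rw [norm_sub_rev]
  exact hr.dist_map_expMap_le (ρ := min r (s / 2)) (min_le_left _ _)
    (by linarith [min_le_right r (s / 2)]) h.smooth h.norm_le (lt_min hvr (by linarith))
    (lt_min hwr (by linarith))

theorem contDiffAt_branchMap (h : 𝒟.IsBranch g x y s Λ K β i j) (hr : IsAdmissibleRadius d M r)
    {u : EuclideanSpace ℝ (Fin d)} (hur : ‖C u‖ < r) (hus : 2 * ‖C u‖ < s)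
    (hg : g (expMap x (C u)) ∈ Metric.ball y r) :
    ContDiffAt ℝ 1 (branchMap r g x y C C') u ∧ ∀ ξ, fderiv ℝ (branchMap r g x y C C') u ξ =
      C'.symm (mfderiv (𝓡 d) 𝓘(ℝ, TangentSpace (𝓡 d) y) (expInv (d := d) r y)
        (g (expMap x (C u))) (mfderiv (𝓡 d) (𝓡 d) g (expMap x (C u))
          (mfderiv 𝓘(ℝ, TangentSpace (𝓡 d) x) (𝓡 d) (expMap x) (C u) (C ξ)))) := by
  have hp : expMap x (C u) ∈ Metric.ball x s := hr.expMap_mem_ball hur hus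
  have c1 : ContMDiffAt 𝓘(ℝ, EuclideanSpace ℝ (Fin d)) 𝓘(ℝ, TangentSpace (𝓡 d) x) 1
      (fun u => C u) u := C.contDiff.contMDiff.contMDiffAt
  have c2 : ContMDiffAt 𝓘(ℝ, TangentSpace (𝓡 d) x) (𝓡 d) 1 (expMap x) (C u) :=
    (hr.contMDiffAt_expMap hur).of_le (by simp)
  have c3 : ContMDiffAt (𝓡 d) (𝓡 d) 1 g (expMap x (C u)) :=
    h.smooth.contMDiffAt (Metric.isOpen_ball.mem_nhds hp)
  have c4 : ContMDiffAt (𝓡 d) 𝓘(ℝ, TangentSpace (𝓡 d) y) 1 (expInv (d := d) r y)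
      (g (expMap x (C u))) := (hr.contMDiffAt_expInv hg).of_le (by simp)
  have c5 : ContMDiffAt 𝓘(ℝ, TangentSpace (𝓡 d) y) 𝓘(ℝ, EuclideanSpace ℝ (Fin d)) 1
      (fun v => C'.symm v) (expInv (d := d) r y (g (expMap x (C u)))) :=
    C'.symm.contDiff.contMDiff.contMDiffAt
  constructor
  · rw [← contMDiffAt_iff_contDiffAt]
    exact c5.comp u (c4.comp u (c3.comp u (c2.comp u c1)))
  · intro ξ
    have d1 : HasMFDerivAt 𝓘(ℝ, EuclideanSpace ℝ (Fin d)) 𝓘(ℝ, TangentSpace (𝓡 d) x)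
      (fun u => C u) u (C : EuclideanSpace ℝ (Fin d) →L[ℝ] TangentSpace (𝓡 d) x) :=
      C.hasFDerivAt.hasMFDerivAt
    have d2 := (c2.mdifferentiableAt one_ne_zero).hasMFDerivAt
    have d3 := (c3.mdifferentiableAt one_ne_zero).hasMFDerivAt
    have d4 := (c4.mdifferentiableAt one_ne_zero).hasMFDerivAt
    have d5 : HasMFDerivAt 𝓘(ℝ, TangentSpace (𝓡 d) y) 𝓘(ℝ, EuclideanSpace ℝ (Fin d))
      (fun v => C'.symm v) (expInv (d := d) r y (g (expMap x (C u))))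
      (C'.symm : TangentSpace (𝓡 d) y →L[ℝ] EuclideanSpace ℝ (Fin d)) :=
      C'.symm.hasFDerivAt.hasMFDerivAt
    have key := (HasMFDerivAt.comp u d5 (HasMFDerivAt.comp u d4 (HasMFDerivAt.comp u d3
      (HasMFDerivAt.comp u d2 d1)))).mfderiv
    rw [mfderiv_eq_fderiv] at key
    exact congrArg (fun l => l ξ) key

/-- Inserting a frame and its inverse at `p` and at `g p` makes the derivative a product of
operators between fixed spaces, so that factors at different points can be subtracted. -/
theorem fderiv_branchMap_eq (h : 𝒟.IsBranch g x y s Λ K β i j) (hr : IsAdmissibleRadius d M r)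
    {u : EuclideanSpace ℝ (Fin d)} (hur : ‖C u‖ < r) (hus : 2 * ‖C u‖ < s)
    (hg : g (expMap x (C u)) ∈ Metric.ball y r) (ξ : EuclideanSpace ℝ (Fin d)) :
    fderiv ℝ (branchMap r g x y C C') u ξ =
      C'.symm (𝒟.dlogFrame j y (g (expMap x (C u)))
        (𝒟.read i j (expMap x (C u)) (g (expMap x (C u)))
          (mfderiv (𝓡 d) (𝓡 d) g (expMap x (C u))) (𝒟.dexpFrame i x (C u) (C ξ)))) := by
  rw [(h.contDiffAt_branchMap hr hur hus hg).2 ξ]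
  have e1 := (𝒟.Θ i (expMap x (C u))).symm_apply_apply
    (mfderiv 𝓘(ℝ, TangentSpace (𝓡 d) x) (𝓡 d) (expMap x) (C u) (C ξ))
  have e2 := (𝒟.Θ j (g (expMap x (C u)))).symm_apply_apply
    (mfderiv (𝓡 d) (𝓡 d) g (expMap x (C u)) ((𝒟.Θ i (expMap x (C u))).symm
      (𝒟.Θ i (expMap x (C u)) (mfderiv 𝓘(ℝ, TangentSpace (𝓡 d) x) (𝓡 d) (expMap x) (C u) (C ξ)))))
  symm
  refine congrArg C'.symm (congrArg (mfderiv (𝓡 d) 𝓘(ℝ, TangentSpace (𝓡 d) y)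
    (expInv (d := d) r y) (g (expMap x (C u)))) ?_)
  exact e2.trans (congrArg (mfderiv (𝓡 d) (𝓡 d) g (expMap x (C u))) e1)

/-- The derivative of the chart map at the origin. -/
theorem hasFDerivAt_branchMap_zero (h : 𝒟.IsBranch g x y s Λ K β i j) (hr : IsAdmissibleRadius d M r)
    (hs : 0 < s) : HasFDerivAt (branchMap r g x y C C')
      ((C'.symm : TangentSpace (𝓡 d) y →L[ℝ] EuclideanSpace ℝ (Fin d)) ∘L
        (tangentCast d h.map_eq).comp (mfderiv (𝓡 d) (𝓡 d) g x) ∘L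
        (C : EuclideanSpace ℝ (Fin d) →L[ℝ] TangentSpace (𝓡 d) x)) 0 := by
  have hC : C 0 = 0 := map_zero C
  have hx : expMap x (C 0) = x := by rw [hC, expMap_zero]
  have h1 := h.contDiffAt_branchMap (C := C) (C' := C') hr (u := 0)
    (by rw [hC, norm_zero]; exact hr.pos) (by rw [hC, norm_zero]; linarith)
    (by rw [hx, h.map_eq]; exact Metric.mem_ball_self hr.pos)
  have h2 := (h1.1.differentiableAt one_ne_zero).hasFDerivAt
  refine h2.congr_fderiv ?_
  refine ContinuousLinearMap.ext fun ξ => ?_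
  rw [h1.2 ξ]
  -- All tangent spaces are the same space `ℝ^d`, but the base points below are only propositionally
  -- equal. Each identity is therefore stated for a variable point or vector and then specialised.
  have dexp : ∀ (z : M) (w : TangentSpace (𝓡 d) z),
      mfderiv 𝓘(ℝ, TangentSpace (𝓡 d) z) (𝓡 d) (expMap z) (0 : TangentSpace (𝓡 d) z) w = w :=
    fun z w => eq_of_heq (TotalSpace.mk.inj (hr.tangentMap_expMap_zero z w)).2
  have cast : ∀ {p q : M} (hpq : p = q) (w : TangentSpace (𝓡 d) p), tangentCast d hpq w = w := by
    rintro p _ rfl w; rfl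
  have dlog : ∀ (q : M), q = y → ∀ w : EuclideanSpace ℝ (Fin d),
      mfderiv (𝓡 d) 𝓘(ℝ, TangentSpace (𝓡 d) y) (expInv (d := d) r y) q w = w := by
    rintro q hq w
    have h3 := hr.mfderiv_expInv_mfderiv_expMap (y := y) (v := 0)
      (by rw [norm_zero]; exact hr.pos) w
    have h4 : q = expMap y (0 : TangentSpace (𝓡 d) y) := by rw [expMap_zero, hq]
    rw [h4]
    exact (congrArg (mfderiv (𝓡 d) 𝓘(ℝ, TangentSpace (𝓡 d) y) (expInv (d := d) r y)
      (expMap y (0 : TangentSpace (𝓡 d) y))) (dexp y w)).symm.trans h3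
  have dg : ∀ (p : M), p = x → ∀ w : EuclideanSpace ℝ (Fin d),
      (mfderiv (𝓡 d) (𝓡 d) g p w : EuclideanSpace ℝ (Fin d)) = mfderiv (𝓡 d) (𝓡 d) g x w := by
    rintro p rfl w; rfl
  have dexp' : ∀ v : TangentSpace (𝓡 d) x, v = 0 → ∀ w : TangentSpace (𝓡 d) x,
      mfderiv 𝓘(ℝ, TangentSpace (𝓡 d) x) (𝓡 d) (expMap x) v w = w := by
    rintro v rfl w; exact dexp x w
  refine congrArg C'.symm ?_
  symm
  refine (cast h.map_eq (mfderiv (𝓡 d) (𝓡 d) g x (C ξ))).trans ?_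
  symm
  refine (dlog _ (by rw [hx, h.map_eq]) _).trans ?_
  refine (dg _ hx _).trans ?_
  exact congrArg (mfderiv (𝓡 d) (𝓡 d) g x) (dexp' _ hC _)

set_option maxHeartbeats 1000000 in
/-- The derivative of the chart map is Hölder continuous near the origin. -/
theorem norm_fderiv_sub_le [IsRiemannianManifold (𝓡 d) M] (h : 𝒟.IsBranch g x y s Λ K β i j)
    (hr : IsAdmissibleRadius d M r) (hK : 0 ≤ K) (hβ : 0 < β) (hβ1 : β ≤ 1) {δ L : ℝ} (hL : 0 ≤ L)
    (hδr : δ ≤ r) (hlip : ∀ (i : ι) (x : M), ∀ v w : TangentSpace (𝓡 d) x, ‖v‖ < δ → ‖w‖ < δ →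
        expMap x v ∈ 𝒟.dom i → expMap x w ∈ 𝒟.dom i → ∀ ξ,
        ‖𝒟.dexpFrame i x v ξ - 𝒟.dexpFrame i x w ξ‖ ≤ L * ‖v - w‖ * ‖ξ‖)
    (hC : ∀ u, ‖C u‖ ≤ ‖u‖) (hρδ : 4 * Λ * ρ ≤ δ) (hρs : 2 * Λ * ρ ≤ s)
    {u w : EuclideanSpace ℝ (Fin d)} (hu : ‖u‖ < ρ) (hw : ‖w‖ < ρ) :
    ‖fderiv ℝ (branchMap r g x y C C') u - fderiv ℝ (branchMap r g x y C C') w‖ ≤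
      ‖(C'.symm : TangentSpace (𝓡 d) y →L[ℝ] EuclideanSpace ℝ (Fin d))‖ *
        ((34 * L + 8 * K) * Λ ^ 2 * ‖u - w‖ ^ β) := by
  have hΛ := h.one_le
  have hΛ0 : 0 < Λ := by linarith
  have hr1 := hr.lt_one
  have hρ : 0 < ρ := (norm_nonneg u).trans_lt hu
  have hρΛ : ρ ≤ Λ * ρ := by nlinarith
  -- The bound `4 * Λ * ρ ≤ δ` leaves room for two doublings: the image is within `2 * Λ * ρ` of
  -- `y`, and `exp_y⁻¹` at most doubles that distance.
  have pt : ∀ u : EuclideanSpace ℝ (Fin d), ‖u‖ < ρ → ‖C u‖ < δ ∧ ‖C u‖ < r ∧ 2 * ‖C u‖ < s ∧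
      expMap x (C u) ∈ Metric.ball x s ∧ dist (g (expMap x (C u))) y < δ / 2 ∧
      g (expMap x (C u)) ∈ Metric.ball y r ∧ g (expMap x (C u)) ∈ Metric.ball y s ∧
      ‖expInv (d := d) r y (g (expMap x (C u)))‖ < δ := by
    intro u hu
    have a0 : ‖C u‖ < ρ := (hC u).trans_lt hu
    have a1 : ‖C u‖ < δ := by nlinarith
    have a2 : ‖C u‖ < r := a1.trans_le hδr
    have a3 : 2 * ‖C u‖ < s := by nlinarith
    have a4 := h.dist_le hr a2 a3
    have a5 : 2 * Λ * ‖C u‖ < 2 * Λ * ρ := by gcongr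
    have a6 : dist (g (expMap x (C u))) y < δ / 2 := by linarith
    have a7 : g (expMap x (C u)) ∈ Metric.ball y r := by
      rw [Metric.mem_ball]; linarith [dist_nonneg (x := g (expMap x (C u))) (y := y)]
    have a8 := hr.norm_expInv_le (d := d) a7
    exact ⟨a1, a2, a3, hr.expMap_mem_ball a2 a3, a6, a7, by rw [Metric.mem_ball]; linarith,
      by linarith⟩
  obtain ⟨u1, u2, u3, u4, u5, u6, u7, u8⟩ := pt u hu
  obtain ⟨w1, w2, w3, w4, w5, w6, w7, w8⟩ := pt w hw
  have huw : ‖u - w‖ ≤ 1 := by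
    have := norm_sub_le u w
    nlinarith
  have hCuw : ‖C u - C w‖ ≤ ‖u - w‖ := by rw [← map_sub]; exact hC _
  set t := ‖u - w‖ ^ β with ht
  have ht0 : 0 ≤ t := by positivity
  -- Since `‖u - w‖ ≤ 1` and `β ≤ 1`, the Lipschitz bounds for the exponential maps become
  -- `β`-Hölder bounds.
  have hut : ‖u - w‖ ≤ t := by
    have := Real.rpow_le_rpow_of_exponent_ge_of_imp (norm_nonneg (u - w)) huw hβ1
      (fun _ h => absurd h one_ne_zero)
    rwa [Real.rpow_one] at this
  set p := expMap x (C u) with hp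
  set q := expMap x (C w) with hq
  have hpq : dist p q ≤ 2 * ‖u - w‖ := by
    have := (hr.lipschitz_exp x).dist_le_mul _ (mem_ball_zero_iff.2 u2) _ (mem_ball_zero_iff.2 w2)
    rw [dist_eq_norm] at this
    have h2 : dist p q ≤ 2 * ‖C u - C w‖ := by exact_mod_cast this
    linarith
  have hpqβ : dist p q ^ β ≤ 2 * t := by
    calc dist p q ^ β ≤ (2 * ‖u - w‖) ^ β := by gcongr
      _ = 2 ^ β * t := Real.mul_rpow (by norm_num) (norm_nonneg _)
      _ ≤ 2 ^ (1 : ℝ) * t := by gcongr; norm_num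
      _ = 2 * t := by rw [Real.rpow_one]
  have hgpq : dist (g p) (g q) ≤ 2 * Λ * ‖u - w‖ := by
    have := h.dist_sub_le hr u2 u3 w2 w3
    have h2 : 2 * Λ * ‖C u - C w‖ ≤ 2 * Λ * ‖u - w‖ := by gcongr
    exact this.trans h2
  have hv : ‖expInv (d := d) r y (g p) - expInv (d := d) r y (g q)‖ ≤ 4 * Λ * t := by
    have := hr.norm_expInv_sub_le (d := d) u6 w6
    have h2 : Λ * ‖u - w‖ ≤ Λ * t := by gcongr
    linarith
  refine ContinuousLinearMap.opNorm_le_bound _ (by positivity) fun ξ => ?_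
  rw [sub_apply, h.fderiv_branchMap_eq hr u2 u3 u6, h.fderiv_branchMap_eq hr w2 w3 w6, ← map_sub,
    mul_assoc]
  refine (C'.symm.toContinuousLinearMap.le_opNorm _).trans ?_
  refine mul_le_mul_of_nonneg_left ?_ (norm_nonneg _)
  have hnC := hC ξ
  set A := 𝒟.read i j p (g p) (mfderiv (𝓡 d) (𝓡 d) g p) with hA
  set A' := 𝒟.read i j q (g q) (mfderiv (𝓡 d) (𝓡 d) g q) with hA'
  have hAA : ‖A - A'‖ ≤ 2 * K * t := by
    have := h.holder p u4 q w4 (h.dom_right u7) (h.dom_right w7)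
    have h2 : K * dist p q ^ β ≤ K * (2 * t) := by gcongr
    linarith
  have hA'n : ∀ z, ‖A' z‖ ≤ Λ * ‖z‖ := by
    intro z
    have e : ‖A' z‖ = ‖mfderiv (𝓡 d) (𝓡 d) g q ((𝒟.Θ i q).symm z)‖ := (𝒟.Θ j (g q)).norm_map _
    rw [e]
    refine (ContinuousLinearMap.le_opNorm _ _).trans ?_
    rw [LinearIsometryEquiv.norm_map]
    exact mul_le_mul_of_nonneg_right (h.norm_le q w4) (norm_nonneg _)
  have hAn : ∀ z, ‖A z‖ ≤ Λ * ‖z‖ := by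
    intro z
    have e : ‖A z‖ = ‖mfderiv (𝓡 d) (𝓡 d) g p ((𝒟.Θ i p).symm z)‖ := (𝒟.Θ j (g p)).norm_map _
    rw [e]
    refine (ContinuousLinearMap.le_opNorm _ _).trans ?_
    rw [LinearIsometryEquiv.norm_map]
    exact mul_le_mul_of_nonneg_right (h.norm_le p u4) (norm_nonneg _)
  set a := 𝒟.dexpFrame i x (C u) (C ξ) with ha
  set a' := 𝒟.dexpFrame i x (C w) (C ξ) with ha'
  have han : ‖a‖ ≤ 2 * ‖ξ‖ := (𝒟.norm_dexpFrame_le hr i u2 _).trans (by linarith)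
  have haa : ‖a - a'‖ ≤ L * t * ‖ξ‖ := by
    refine (hlip i x _ _ u1 w1 (h.dom_left u4) (h.dom_left w4) (C ξ)).trans ?_
    have := hCuw.trans hut
    gcongr
  have hbb : ‖A a - A' a'‖ ≤ 4 * K * t * ‖ξ‖ + Λ * (L * t * ‖ξ‖) := by
    have e : A a - A' a' = (A - A') a + A' (a - a') := by rw [sub_apply, map_sub]; abel
    rw [e]
    refine (norm_add_le _ _).trans (add_le_add ?_ ?_)
    · calc ‖(A - A') a‖ ≤ ‖A - A'‖ * ‖a‖ := ContinuousLinearMap.le_opNorm _ _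
        _ ≤ 2 * K * t * (2 * ‖ξ‖) := by gcongr
        _ = 4 * K * t * ‖ξ‖ := by ring
    · exact (hA'n _).trans (by gcongr)
  have hbn : ‖A a‖ ≤ 2 * Λ * ‖ξ‖ := by
    calc ‖A a‖ ≤ Λ * ‖a‖ := hAn a
      _ ≤ Λ * (2 * ‖ξ‖) := by gcongr
      _ = 2 * Λ * ‖ξ‖ := by ring
  -- the inverse of the derivative of the exponential map
  set v := expInv (d := d) r y (g p) with hvdef
  set v' := expInv (d := d) r y (g q) with hvdef'
  -- The constant is a sum of three costs: varying the derivative of `exp_y⁻¹` costs `4L · 4Λt · 2Λ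
  -- = 32LΛ²t`, varying `dg` costs `2 · 4Kt`, and varying the derivative of `exp_x` costs `2 · ΛLt`.
  -- As `Λ ≥ 1`, the total is at most `(34L + 8K)Λ²t`.
  have hYY := 𝒟.norm_dlogFrame_sub_le hr hδr hL (hlip j y) u6 w6 (h.dom_right u7) (h.dom_right w7)
    u8 w8 (A a)
  have e : 𝒟.dlogFrame j y (g p) (A a) - 𝒟.dlogFrame j y (g q) (A' a') =
      (𝒟.dlogFrame j y (g p) (A a) - 𝒟.dlogFrame j y (g q) (A a)) +
        𝒟.dlogFrame j y (g q) (A a - A' a') := by rw [map_sub]; abel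
  rw [e]
  have f2 := 𝒟.norm_dlogFrame_le hr j w6 (A a - A' a')
  have f3 : 4 * L * ‖v - v'‖ * ‖A a‖ ≤ 4 * L * (4 * Λ * t) * (2 * Λ * ‖ξ‖) := by gcongr
  have f4 : K * t * ‖ξ‖ ≤ Λ ^ 2 * (K * t * ‖ξ‖) :=
    le_mul_of_one_le_left (by positivity) (by nlinarith)
  have f5 : Λ * (L * t * ‖ξ‖) ≤ Λ ^ 2 * (L * t * ‖ξ‖) :=
    mul_le_mul_of_nonneg_right (by nlinarith) (by positivity)
  refine (norm_add_le _ _).trans ?_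
  linarith

end FrameCover.IsBranch

end Branches

/-! ### Invariance of the splitting and the Lyapunov norm -/

section Lyapunov

/-- Both the sum and `‖ξ‖²` are homogeneous of degree two. Unlike the supremum over unit vectors,
the bound by `c‖ξ‖²` passes easily through an isomorphism. -/
theorem iSup_unit_lt_top_iff {V : Type*} [NormedAddCommGroup V] [NormedSpace ℝ V]
    {W : ℕ → Type*} [∀ m, NormedAddCommGroup (W m)] [∀ m, NormedSpace ℝ (W m)]
    (B : ∀ m, V →L[ℝ] W m) (S : Submodule ℝ V) :
    (⨆ ξ ∈ {ξ : V | ξ ∈ S ∧ ‖ξ‖ = 1}, ∑' m : ℕ, ‖B m ξ‖ₑ ^ 2) < ⊤ ↔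
      ∃ c : ENNReal, c ≠ ⊤ ∧ ∀ ξ ∈ S, ∑' m : ℕ, ‖B m ξ‖ₑ ^ 2 ≤ c * ‖ξ‖ₑ ^ 2 := by
  constructor
  · intro h
    refine ⟨_, h.ne, fun ξ hξ => ?_⟩
    rcases eq_or_ne ξ 0 with rfl | h0
    · simp
    have hn : ‖ξ‖ ≠ 0 := norm_ne_zero_iff.2 h0
    have h1 : ‖ξ‖⁻¹ • ξ ∈ {ξ : V | ξ ∈ S ∧ ‖ξ‖ = 1} :=
      ⟨S.smul_mem _ hξ, by rw [norm_smul, norm_inv, norm_norm, inv_mul_cancel₀ hn]⟩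
    have h2 : ∑' m : ℕ, ‖B m ξ‖ₑ ^ 2 = (∑' m : ℕ, ‖B m (‖ξ‖⁻¹ • ξ)‖ₑ ^ 2) * ‖ξ‖ₑ ^ 2 := by
      rw [← ENNReal.tsum_mul_right]
      refine tsum_congr fun m => ?_
      rw [← mul_pow, mul_comm, ← enorm_norm ξ, ← enorm_smul, ← map_smul, smul_smul,
        mul_inv_cancel₀ hn, one_smul]
    rw [h2]
    gcongr
    exact le_iSup₂ (f := fun ξ (_ : ξ ∈ {ξ : V | ξ ∈ S ∧ ‖ξ‖ = 1}) => ∑' m : ℕ, ‖B m ξ‖ₑ ^ 2) _ h1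
  · rintro ⟨c, hc, h⟩
    refine lt_of_le_of_lt (iSup₂_le fun ξ hξ => ?_) hc.lt_top
    have := h ξ hξ.1
    have h1 : ‖ξ‖ₑ = 1 := by rw [← ofReal_norm, hξ.2, ENNReal.ofReal_one]
    simpa [h1] using this

variable {d : ℕ} {M : Type*} {f : M → M} [MetricSpace M]
  [ChartedSpace (EuclideanSpace ℝ (Fin d)) M]

theorem isInvertible_tangentCast {p q : M} (h : p = q) : (tangentCast d h).IsInvertible := by
  subst h
  exact ⟨ContinuousLinearEquiv.refl ℝ _, rfl⟩

theorem isInvertible_dHat {x : OrbitSpace f} (hx : proj x ∉ singularSet d f) :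
    (dHat d x).IsInvertible :=
  (isInvertible_tangentCast _).comp (not_not.1 hx)

variable [RiemannianBundle (fun x : M => TangentSpace (𝓡 d) x)]

/-- The point `z` stands for `shiftInv (shift x)`, which equals `x` but not definitionally; for a
variable `z` the equality can be eliminated. -/
theorem inner_dHatNeg_of_eq {x z : OrbitSpace f} (hz : z = x) (h : proj (shift z) = proj (shift x))
    (hx : (dHat d x).IsInvertible) (m : ℕ) (ξ η : TangentSpace (𝓡 d) (proj x)) :
    inner ℝ (dHatNeg d m z (((tangentCast d h).comp (dHat d z)).inverse (dHat d x ξ)))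
      (dHatNeg d m z (((tangentCast d h).comp (dHat d z)).inverse (dHat d x η))) =
    inner ℝ (dHatNeg d m x ξ) (dHatNeg d m x η) := by
  subst hz
  obtain ⟨e, he⟩ := hx
  have h1 : (tangentCast d h).comp (dHat d z) = e := by rw [he]; rfl
  rw [h1, ContinuousLinearMap.inverse_equiv, ← he]
  simp

theorem shiftInv_shift (x : OrbitSpace f) : shiftInv (shift x) = x := by
  apply Subtype.ext
  funext i
  exact congrArg x.1 (by ring)

theorem inner_dHatNeg_succ_shift {x : OrbitSpace f} (hx : (dHat d x).IsInvertible) (m : ℕ)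
    (ξ η : TangentSpace (𝓡 d) (proj x)) :
    inner ℝ (dHatNeg d (m + 1) (shift x) (dHat d x ξ)) (dHatNeg d (m + 1) (shift x) (dHat d x η)) =
      inner ℝ (dHatNeg d m x ξ) (dHatNeg d m x η) :=
  inner_dHatNeg_of_eq (shiftInv_shift x) _ hx m ξ η

theorem norm_dHatNeg_succ_shift {x : OrbitSpace f} (hx : (dHat d x).IsInvertible) (m : ℕ)
    (ξ : TangentSpace (𝓡 d) (proj x)) :
    ‖dHatNeg d (m + 1) (shift x) (dHat d x ξ)‖ = ‖dHatNeg d m x ξ‖ := by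
  rw [norm_eq_sqrt_real_inner, norm_eq_sqrt_real_inner, inner_dHatNeg_succ_shift hx]

theorem enorm_dHatNeg_succ_shift {x : OrbitSpace f} (hx : (dHat d x).IsInvertible) (m : ℕ)
    (ξ : TangentSpace (𝓡 d) (proj x)) :
    ‖dHatNeg d (m + 1) (shift x) (dHat d x ξ)‖ₑ = ‖dHatNeg d m x ξ‖ₑ := by
  rw [← ofReal_norm, ← ofReal_norm, norm_dHatNeg_succ_shift hx]

/-- A step forward removes the zeroth term of the forward sum; in `tsum_dHatNeg_shift` it adds one
to the backward sum. In `[0, ∞]` no summability is needed. -/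
theorem tsum_dHatPow_shift (x : OrbitSpace f) (ξ : TangentSpace (𝓡 d) (proj x)) :
    ∑' m : ℕ, ‖dHatPow d m x ξ‖ₑ ^ 2 =
      ‖ξ‖ₑ ^ 2 + ∑' m : ℕ, ‖dHatPow d m (shift x) (dHat d x ξ)‖ₑ ^ 2 :=
  tsum_eq_zero_add' ENNReal.summable

theorem tsum_dHatNeg_shift {x : OrbitSpace f} (hx : (dHat d x).IsInvertible)
    (ξ : TangentSpace (𝓡 d) (proj x)) :
    ∑' m : ℕ, ‖dHatNeg d m (shift x) (dHat d x ξ)‖ₑ ^ 2 =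
      ‖dHat d x ξ‖ₑ ^ 2 + ∑' m : ℕ, ‖dHatNeg d m x ξ‖ₑ ^ 2 := by
  rw [tsum_eq_zero_add' ENNReal.summable]
  congr 1
  exact tsum_congr fun m => by rw [enorm_dHatNeg_succ_shift hx]

/-- Summable splittings correspond to each other under the derivative. -/
theorem isSummableSplitting_shift_iff {x : OrbitSpace f}
    (e : TangentSpace (𝓡 d) (proj x) ≃L[ℝ] TangentSpace (𝓡 d) (proj (shift x)))
    (he : (e : TangentSpace (𝓡 d) (proj x) →L[ℝ] TangentSpace (𝓡 d) (proj (shift x))) = dHat d x)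
    (V : Submodule ℝ (TangentSpace (𝓡 d) (proj x)) × Submodule ℝ (TangentSpace (𝓡 d) (proj x))) :
    IsSummableSplitting (shift x) (V.1.map e.toLinearEquiv.toLinearMap,
      V.2.map e.toLinearEquiv.toLinearMap) ↔ IsSummableSplitting x V := by
  have hx : (dHat d x).IsInvertible := ⟨e, he⟩
  have hea : ∀ ξ, e ξ = dHat d x ξ := fun ξ => by rw [← he]; rfl
  have b1 : ∀ ξ, ‖dHat d x ξ‖ₑ ≤ ‖dHat d x‖ₑ * ‖ξ‖ₑ := fun ξ => (dHat d x).le_opENorm ξ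
  have b2 : ∀ ξ, ‖ξ‖ₑ ≤
      ‖(e.symm : TangentSpace (𝓡 d) (proj (shift x)) →L[ℝ] TangentSpace (𝓡 d) (proj x))‖ₑ *
        ‖dHat d x ξ‖ₑ := fun ξ => by
    have := (e.symm : TangentSpace (𝓡 d) (proj (shift x)) →L[ℝ]
      TangentSpace (𝓡 d) (proj x)).le_opENorm (e ξ)
    rw [hea] at this
    refine le_trans (le_of_eq ?_) this
    rw [← hea]
    simp
  set Λ := ‖dHat d x‖ₑ with hΛ
  set Λ' := ‖(e.symm : TangentSpace (𝓡 d) (proj (shift x)) →L[ℝ] TangentSpace (𝓡 d) (proj x))‖ₑ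
    with hΛ'
  have hΛt : Λ ≠ ⊤ := enorm_ne_top
  have hΛt' : Λ' ≠ ⊤ := enorm_ne_top
  unfold IsSummableSplitting
  refine and_congr ?_ (and_congr ?_ ?_)
  · exact (Submodule.orderIsoMapComap e.toLinearEquiv).isCompl_iff.symm
  · rw [iSup_unit_lt_top_iff (fun m => dHatPow d m (shift x)),
      iSup_unit_lt_top_iff (fun m => dHatPow d m x)]
    constructor
    · rintro ⟨c, hc, h⟩
      refine ⟨1 + c * Λ ^ 2, by finiteness, fun ξ hξ => ?_⟩
      have h1 := h (dHat d x ξ) ⟨ξ, hξ, hea ξ⟩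
      rw [tsum_dHatPow_shift, add_mul, one_mul]
      gcongr
      refine h1.trans ?_
      rw [mul_assoc, ← mul_pow]
      gcongr
      exact b1 ξ
    · rintro ⟨c, hc, h⟩
      refine ⟨c * Λ' ^ 2, by finiteness, ?_⟩
      rintro _ ⟨ξ, hξ, rfl⟩
      have h1 := h ξ hξ
      rw [tsum_dHatPow_shift] at h1
      change ∑' m, ‖dHatPow d m (shift x) (e ξ)‖ₑ ^ 2 ≤ c * Λ' ^ 2 * ‖e ξ‖ₑ ^ 2
      rw [hea]
      refine (le_add_self.trans h1).trans ?_
      rw [mul_assoc, ← mul_pow]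
      gcongr
      exact b2 ξ
  · rw [iSup_unit_lt_top_iff (fun m => dHatNeg d m (shift x)),
      iSup_unit_lt_top_iff (fun m => dHatNeg d m x)]
    constructor
    · rintro ⟨c, hc, h⟩
      refine ⟨c * Λ ^ 2, by finiteness, fun ξ hξ => ?_⟩
      have h1 := h (dHat d x ξ) ⟨ξ, hξ, hea ξ⟩
      rw [tsum_dHatNeg_shift hx] at h1
      refine (le_add_self.trans h1).trans ?_
      rw [mul_assoc, ← mul_pow]
      gcongr
      exact b1 ξ
    · rintro ⟨c, hc, h⟩
      refine ⟨1 + c * Λ' ^ 2, by finiteness, ?_⟩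
      rintro _ ⟨ξ, hξ, rfl⟩
      have h1 := h ξ hξ
      change ∑' m, ‖dHatNeg d m (shift x) (e ξ)‖ₑ ^ 2 ≤ (1 + c * Λ' ^ 2) * ‖e ξ‖ₑ ^ 2
      rw [hea, tsum_dHatNeg_shift hx, add_mul, one_mul]
      gcongr
      refine h1.trans ?_
      rw [mul_assoc, ← mul_pow]
      gcongr
      exact b2 ξ

/-- The preimage of a summable splitting at `shift x` is one at `x`, hence the only one. This yields
both that `shift x` is summable and that the two spaces are invariant. -/
theorem IsSummablePoint.existsUnique_shift {x : OrbitSpace f} (hx : IsSummablePoint d x)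
    (e : TangentSpace (𝓡 d) (proj x) ≃L[ℝ] TangentSpace (𝓡 d) (proj (shift x)))
    (he : (e : TangentSpace (𝓡 d) (proj x) →L[ℝ] TangentSpace (𝓡 d) (proj (shift x))) = dHat d x)
    (V : Submodule ℝ (TangentSpace (𝓡 d) (proj (shift x))) ×
      Submodule ℝ (TangentSpace (𝓡 d) (proj (shift x)))) :
    IsSummableSplitting (shift x) V ↔ V = ((stableSpace hx).map e.toLinearEquiv.toLinearMap,
      (unstableSpace hx).map e.toLinearEquiv.toLinearMap) := by
  constructor
  · intro hV
    set W : Submodule ℝ (TangentSpace (𝓡 d) (proj x)) ×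
      Submodule ℝ (TangentSpace (𝓡 d) (proj x)) :=
      (V.1.comap e.toLinearEquiv.toLinearMap, V.2.comap e.toLinearEquiv.toLinearMap) with hW
    have hVW : (W.1.map e.toLinearEquiv.toLinearMap, W.2.map e.toLinearEquiv.toLinearMap) = V :=
      Prod.ext (Submodule.map_comap_eq_of_surjective e.surjective _)
        (Submodule.map_comap_eq_of_surjective e.surjective _)
    have h1 : IsSummableSplitting x W := by
      rw [← isSummableSplitting_shift_iff e he, hVW]
      exact hV
    have h2 : W = hx.existsUnique.choose :=
      hx.existsUnique.unique h1 hx.existsUnique.choose_spec.1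
    rw [← hVW, h2]
    rfl
  · rintro rfl
    exact (isSummableSplitting_shift_iff e he hx.existsUnique.choose).2
      hx.existsUnique.choose_spec.1

theorem IsSummablePoint.isInvertible_dHat {x : OrbitSpace f} (hx : IsSummablePoint d x) :
    (dHat d x).IsInvertible := PesinCharts.isInvertible_dHat (hx.regular 0)

theorem IsSummablePoint.shift {x : OrbitSpace f} (hx : IsSummablePoint d x) :
    IsSummablePoint d (shift x) := by
  obtain ⟨e, he⟩ := hx.isInvertible_dHat
  refine ⟨fun n => hx.regular (n + 1), ⟨_, (hx.existsUnique_shift e he _).2 rfl, fun V hV => ?_⟩⟩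
  exact (hx.existsUnique_shift e he V).1 hV

theorem IsSummablePoint.spaces_shift {x : OrbitSpace f} (hx : IsSummablePoint d x)
    (hx' : IsSummablePoint d (PesinCharts.shift x)) :
    (∀ a ∈ stableSpace hx, dHat d x a ∈ stableSpace hx') ∧
      ∀ b ∈ unstableSpace hx, dHat d x b ∈ unstableSpace hx' := by
  obtain ⟨e, he⟩ := hx.isInvertible_dHat
  have h := (hx.existsUnique_shift e he _).1 hx'.existsUnique.choose_spec.1
  have h1 : stableSpace hx' = (stableSpace hx).map e.toLinearEquiv.toLinearMap :=
    congrArg Prod.fst h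
  have h2 : unstableSpace hx' = (unstableSpace hx).map e.toLinearEquiv.toLinearMap :=
    congrArg Prod.snd h
  rw [h1, h2, ← he]
  exact ⟨fun a ha => ⟨a, ha, rfl⟩, fun b hb => ⟨b, hb, rfl⟩⟩

/-! ### One-step growth of the Lyapunov norm -/

theorem summable_of_tsum_enorm_sq {W : ℕ → Type*} [∀ m, NormedAddCommGroup (W m)]
    (w : ∀ m, W m) (h : ∑' m, ‖w m‖ₑ ^ 2 ≠ ⊤) : Summable fun m => ‖w m‖ ^ 2 := by
  have := ENNReal.summable_toReal h
  simpa using this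

theorem IsSummablePoint.summable_dHatPow {x : OrbitSpace f} (hx : IsSummablePoint d x)
    {a : TangentSpace (𝓡 d) (proj x)} (ha : a ∈ stableSpace hx) :
    Summable fun m => ‖dHatPow d m x a‖ ^ 2 := by
  obtain ⟨c, hc, h⟩ := (iSup_unit_lt_top_iff (fun m => dHatPow d m x) _).1
    hx.existsUnique.choose_spec.1.2.1
  exact summable_of_tsum_enorm_sq _ ((h a ha).trans_lt (by finiteness)).ne

theorem IsSummablePoint.summable_dHatNeg {x : OrbitSpace f} (hx : IsSummablePoint d x)
    {b : TangentSpace (𝓡 d) (proj x)} (hb : b ∈ unstableSpace hx) :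
    Summable fun m => ‖dHatNeg d m x b‖ ^ 2 := by
  obtain ⟨c, hc, h⟩ := (iSup_unit_lt_top_iff (fun m => dHatNeg d m x) _).1
    hx.existsUnique.choose_spec.1.2.2
  exact summable_of_tsum_enorm_sq _ ((h b hb).trans_lt (by finiteness)).ne

theorem lyapunovInner_self {x : OrbitSpace f} (hx : IsSummablePoint d x)
    {a b : TangentSpace (𝓡 d) (proj x)} (ha : a ∈ stableSpace hx) (hb : b ∈ unstableSpace hx) :
    lyapunovInner hx (a + b) (a + b) =
      2 * ∑' m : ℕ, ‖dHatPow d m x a‖ ^ 2 + 2 * ∑' m : ℕ, ‖dHatNeg d m x b‖ ^ 2 := by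
  have h := isCompl_stable_unstable hx
  have h1 : (stableSpace hx).projection (unstableSpace hx) h (a + b) = a := by
    rw [map_add, Submodule.projection_apply_of_mem_left h ha,
      (Submodule.projection_apply_eq_zero_iff h).2 hb, add_zero]
  have h2 : (unstableSpace hx).projection (stableSpace hx) h.symm (a + b) = b := by
    rw [map_add, Submodule.projection_apply_of_mem_left h.symm hb,
      (Submodule.projection_apply_eq_zero_iff h.symm).2 ha, zero_add]
  simp only [lyapunovInner, h1, h2, real_inner_self_eq_norm_sq]

theorem exists_stable_unstable {x : OrbitSpace f} (hx : IsSummablePoint d x)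
    (ξ : TangentSpace (𝓡 d) (proj x)) :
    ∃ a ∈ stableSpace hx, ∃ b ∈ unstableSpace hx, a + b = ξ :=
  Submodule.mem_sup.1 ((isCompl_stable_unstable hx).sup_eq_top ▸ Submodule.mem_top)

theorem norm_sq_le_tsum {W : ℕ → Type*} [∀ m, NormedAddCommGroup (W m)]
    (w : ∀ m, W m) (h : Summable fun m => ‖w m‖ ^ 2) : ‖w 0‖ ^ 2 ≤ ∑' m, ‖w m‖ ^ 2 :=
  h.le_tsum 0 fun _ _ => by positivity

/-- The factor `2` in the Lyapunov product pays for the angle between the two spaces: `‖a + b‖² ≤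
2‖a‖² + 2‖b‖²`, and each square is the zeroth term of its sum. -/
theorem norm_sq_le_lyapunovInner {x : OrbitSpace f} (hx : IsSummablePoint d x)
    (ξ : TangentSpace (𝓡 d) (proj x)) : ‖ξ‖ ^ 2 ≤ lyapunovInner hx ξ ξ := by
  obtain ⟨a, ha, b, hb, rfl⟩ := exists_stable_unstable hx ξ
  rw [lyapunovInner_self hx ha hb]
  have h1 : ‖a‖ ^ 2 ≤ ∑' m, ‖dHatPow d m x a‖ ^ 2 := norm_sq_le_tsum _ (hx.summable_dHatPow ha)
  have h2 : ‖b‖ ^ 2 ≤ ∑' m, ‖dHatNeg d m x b‖ ^ 2 := norm_sq_le_tsum _ (hx.summable_dHatNeg hb)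
  have h3 := norm_add_le a b
  nlinarith [norm_nonneg (a + b), sq_nonneg (‖a‖ - ‖b‖), norm_nonneg a, norm_nonneg b]

/-- The sums telescope: the stable one loses its zeroth term, and the unstable one gains a new one.
-/
theorem lyapunovInner_dHat_self {x : OrbitSpace f} (hx : IsSummablePoint d x)
    (hx' : IsSummablePoint d (shift x))
    {a b : TangentSpace (𝓡 d) (proj x)} (ha : a ∈ stableSpace hx) (hb : b ∈ unstableSpace hx) :
    lyapunovInner hx' (dHat d x (a + b)) (dHat d x (a + b)) =
      lyapunovInner hx (a + b) (a + b) - 2 * ‖a‖ ^ 2 + 2 * ‖dHat d x b‖ ^ 2 := by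
  obtain ⟨hs, hu⟩ := hx.spaces_shift hx'
  rw [map_add, lyapunovInner_self hx' (hs a ha) (hu b hb), lyapunovInner_self hx ha hb]
  have h1 : ∑' m, ‖dHatPow d m x a‖ ^ 2 =
      ‖a‖ ^ 2 + ∑' m, ‖dHatPow d m (shift x) (dHat d x a)‖ ^ 2 :=
    (hx.summable_dHatPow ha).tsum_eq_zero_add
  have h2 : ∑' m, ‖dHatNeg d m (shift x) (dHat d x b)‖ ^ 2 =
      ‖dHat d x b‖ ^ 2 + ∑' m, ‖dHatNeg d m x b‖ ^ 2 := by
    rw [(hx'.summable_dHatNeg (hu b hb)).tsum_eq_zero_add]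
    congr 1
    exact tsum_congr fun m => by rw [norm_dHatNeg_succ_shift hx.isInvertible_dHat]
  rw [h1, h2]
  ring

/-- Only the unstable part can grow. The new term is at most `Λ²‖b‖²`, and `‖b‖²` is itself a term
of the old sum. -/
theorem lyapunovInner_dHat_le {x : OrbitSpace f} (hx : IsSummablePoint d x)
    (hx' : IsSummablePoint d (shift x)) {Λ : ℝ} (hΛ : ∀ η, ‖dHat d x η‖ ≤ Λ * ‖η‖)
    (ξ : TangentSpace (𝓡 d) (proj x)) :
    lyapunovInner hx' (dHat d x ξ) (dHat d x ξ) ≤ (1 + Λ ^ 2) * lyapunovInner hx ξ ξ := by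
  obtain ⟨a, ha, b, hb, rfl⟩ := exists_stable_unstable hx ξ
  rw [lyapunovInner_dHat_self hx hx' ha hb, lyapunovInner_self hx ha hb]
  have h1 : 0 ≤ ∑' m, ‖dHatPow d m x a‖ ^ 2 := tsum_nonneg fun _ => by positivity
  have h2 : ‖b‖ ^ 2 ≤ ∑' m, ‖dHatNeg d m x b‖ ^ 2 := norm_sq_le_tsum _ (hx.summable_dHatNeg hb)
  have h3 : ‖dHat d x b‖ ^ 2 ≤ Λ ^ 2 * ‖b‖ ^ 2 := by
    rw [← mul_pow]; exact pow_le_pow_left₀ (norm_nonneg _) (hΛ b) 2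
  have h4 : Λ ^ 2 * ‖b‖ ^ 2 ≤ Λ ^ 2 * ∑' m, ‖dHatNeg d m x b‖ ^ 2 := by gcongr
  nlinarith [mul_nonneg (sq_nonneg Λ) h1, sq_nonneg ‖a‖]

/-- The mirror image: a step backward can increase only the stable part. -/
theorem lyapunovInner_le_dHat {x : OrbitSpace f} (hx : IsSummablePoint d x)
    (hx' : IsSummablePoint d (shift x)) {Λ : ℝ} (hΛ : ∀ η, ‖η‖ ≤ Λ * ‖dHat d x η‖)
    (ξ : TangentSpace (𝓡 d) (proj x)) :
    lyapunovInner hx ξ ξ ≤ (1 + Λ ^ 2) * lyapunovInner hx' (dHat d x ξ) (dHat d x ξ) := by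
  obtain ⟨a, ha, b, hb, rfl⟩ := exists_stable_unstable hx ξ
  have h0 := lyapunovInner_dHat_self hx hx' ha hb
  obtain ⟨hs, hu⟩ := hx.spaces_shift hx'
  have h5 := lyapunovInner_self hx' (hs a ha) (hu b hb)
  rw [← map_add] at h5
  have h1 : 0 ≤ ∑' m, ‖dHatNeg d m (shift x) (dHat d x b)‖ ^ 2 := tsum_nonneg fun _ => by positivity
  have h2 : ‖dHat d x a‖ ^ 2 ≤ ∑' m, ‖dHatPow d m (shift x) (dHat d x a)‖ ^ 2 :=
    norm_sq_le_tsum _ (hx'.summable_dHatPow (hs a ha))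
  have h3 : ‖a‖ ^ 2 ≤ Λ ^ 2 * ‖dHat d x a‖ ^ 2 := by
    rw [← mul_pow]; exact pow_le_pow_left₀ (norm_nonneg _) (hΛ a) 2
  have h4 : Λ ^ 2 * ‖dHat d x a‖ ^ 2 ≤
      Λ ^ 2 * ∑' m, ‖dHatPow d m (shift x) (dHat d x a)‖ ^ 2 := by gcongr
  nlinarith [mul_nonneg (sq_nonneg Λ) h1, sq_nonneg ‖dHat d x b‖]

variable {x : OrbitSpace f} {hx : IsSummablePoint d x}
  {C : EuclideanSpace ℝ (Fin d) ≃L[ℝ] TangentSpace (𝓡 d) (proj x)}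

theorem IsLyapunovChange.norm_sq_eq (hC : IsLyapunovChange hx C) (v : EuclideanSpace ℝ (Fin d)) :
    lyapunovInner hx (C v) (C v) = ‖v‖ ^ 2 := by
  rw [hC.isometry, real_inner_self_eq_norm_sq]

theorem IsLyapunovChange.norm_symm_sq_eq (hC : IsLyapunovChange hx C)
    (ξ : TangentSpace (𝓡 d) (proj x)) : lyapunovInner hx ξ ξ = ‖C.symm ξ‖ ^ 2 := by
  rw [← hC.norm_sq_eq, C.apply_symm_apply]

theorem IsLyapunovChange.norm_apply_le (hC : IsLyapunovChange hx C)
    (v : EuclideanSpace ℝ (Fin d)) : ‖C v‖ ≤ ‖v‖ := by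
  have := norm_sq_le_lyapunovInner hx (C v)
  rw [hC.norm_sq_eq] at this
  exact (sq_le_sq₀ (norm_nonneg _) (norm_nonneg _)).1 this

theorem IsLyapunovChange.one_le_norm_symm (hC : IsLyapunovChange hx C) (hd : 2 ≤ d) :
    1 ≤ ‖(C.symm : TangentSpace (𝓡 d) (proj x) →L[ℝ] EuclideanSpace ℝ (Fin d))‖ := by
  have : Nonempty (Fin d) := ⟨⟨0, by omega⟩⟩
  obtain ⟨v, hv⟩ := exists_ne (0 : EuclideanSpace ℝ (Fin d))
  have hv0 : 0 < ‖v‖ := norm_pos_iff.2 hv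
  have h1 := (C.symm : TangentSpace (𝓡 d) (proj x) →L[ℝ] EuclideanSpace ℝ (Fin d)).le_opNorm (C v)
  have h2 : ‖v‖ ≤
      ‖(C.symm : TangentSpace (𝓡 d) (proj x) →L[ℝ] EuclideanSpace ℝ (Fin d))‖ * ‖C v‖ := by
    refine le_trans (le_of_eq ?_) h1
    simp
  have h3 := hC.norm_apply_le v
  have h4 : ‖v‖ ≤
      ‖(C.symm : TangentSpace (𝓡 d) (proj x) →L[ℝ] EuclideanSpace ℝ (Fin d))‖ * ‖v‖ :=
    h2.trans (by gcongr)
  by_contra hlt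
  push Not at hlt
  nlinarith

variable {hx' : IsSummablePoint d (shift x)}
  {C' : EuclideanSpace ℝ (Fin d) ≃L[ℝ] TangentSpace (𝓡 d) (proj (shift x))} {Λ : ℝ}

/-- As `Λ ≥ 1`, the growth factor `1 + Λ²` of the squares is at most `2Λ²`. -/
theorem IsLyapunovChange.norm_symm_dHat_le (hC : IsLyapunovChange hx C)
    (hC' : IsLyapunovChange hx' C') (h1 : 1 ≤ Λ) (hΛ : ∀ η, ‖dHat d x η‖ ≤ Λ * ‖η‖)
    (ξ : TangentSpace (𝓡 d) (proj x)) :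
    ‖C'.symm (dHat d x ξ)‖ ≤ √2 * Λ * ‖C.symm ξ‖ := by
  have h := lyapunovInner_dHat_le hx hx' hΛ ξ
  rw [hC.norm_symm_sq_eq, hC'.norm_symm_sq_eq] at h
  refine (sq_le_sq₀ (norm_nonneg _) (by positivity)).1 ?_
  rw [mul_pow, mul_pow, Real.sq_sqrt (by norm_num)]
  exact h.trans (mul_le_mul_of_nonneg_right (by nlinarith) (sq_nonneg _))

theorem IsLyapunovChange.norm_symm_le_dHat (hC : IsLyapunovChange hx C)
    (hC' : IsLyapunovChange hx' C') (h1 : 1 ≤ Λ) (hΛ : ∀ η, ‖η‖ ≤ Λ * ‖dHat d x η‖)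
    (ξ : TangentSpace (𝓡 d) (proj x)) :
    ‖C.symm ξ‖ ≤ √2 * Λ * ‖C'.symm (dHat d x ξ)‖ := by
  have h := lyapunovInner_le_dHat hx hx' hΛ ξ
  rw [hC.norm_symm_sq_eq, hC'.norm_symm_sq_eq] at h
  refine (sq_le_sq₀ (norm_nonneg _) (by positivity)).1 ?_
  rw [mul_pow, mul_pow, Real.sq_sqrt (by norm_num)]
  exact h.trans (mul_le_mul_of_nonneg_right (by nlinarith) (sq_nonneg _))

/-- A vector at `shift x` is pulled back to `x` at cost `Λ`, measured there by `C.symm`, and pushed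
forward in the Lyapunov norms at cost `√2 * Λ`. -/
theorem IsLyapunovChange.norm_symm_shift_le (hC : IsLyapunovChange hx C)
    (hC' : IsLyapunovChange hx' C') (h1 : 1 ≤ Λ) (hΛ : ∀ η, ‖dHat d x η‖ ≤ Λ * ‖η‖)
    (hΛ' : ∀ η, ‖η‖ ≤ Λ * ‖dHat d x η‖) :
    ‖(C'.symm : TangentSpace (𝓡 d) (proj (shift x)) →L[ℝ] EuclideanSpace ℝ (Fin d))‖ ≤
      √2 * Λ ^ 2 *
        ‖(C.symm : TangentSpace (𝓡 d) (proj x) →L[ℝ] EuclideanSpace ℝ (Fin d))‖ := by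
  obtain ⟨e, he⟩ := hx.isInvertible_dHat
  refine ContinuousLinearMap.opNorm_le_bound _ (by positivity) fun ξ => ?_
  obtain ⟨η, rfl⟩ := e.surjective ξ
  have hη : e η = dHat d x η := by rw [← he]; rfl
  rw [hη]
  have h2 := hC.norm_symm_dHat_le hC' h1 hΛ η
  have h3 : ‖C.symm η‖ ≤
    ‖(C.symm : TangentSpace (𝓡 d) (proj x) →L[ℝ] EuclideanSpace ℝ (Fin d))‖ * ‖η‖ :=
    (C.symm : TangentSpace (𝓡 d) (proj x) →L[ℝ] EuclideanSpace ℝ (Fin d)).le_opNorm η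
  have h4 := hΛ' η
  calc ‖C'.symm (dHat d x η)‖ ≤ √2 * Λ * ‖C.symm η‖ := h2
    _ ≤ √2 * Λ * (‖(C.symm : TangentSpace (𝓡 d) (proj x) →L[ℝ] EuclideanSpace ℝ (Fin d))‖ *
        (Λ * ‖dHat d x η‖)) := by gcongr; exact h3.trans (by gcongr)
    _ = _ := by ring

theorem IsLyapunovChange.norm_symm_le_shift (hC : IsLyapunovChange hx C)
    (hC' : IsLyapunovChange hx' C') (h1 : 1 ≤ Λ) (hΛ : ∀ η, ‖dHat d x η‖ ≤ Λ * ‖η‖)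
    (hΛ' : ∀ η, ‖η‖ ≤ Λ * ‖dHat d x η‖) :
    ‖(C.symm : TangentSpace (𝓡 d) (proj x) →L[ℝ] EuclideanSpace ℝ (Fin d))‖ ≤
      √2 * Λ ^ 2 *
        ‖(C'.symm : TangentSpace (𝓡 d) (proj (shift x)) →L[ℝ] EuclideanSpace ℝ (Fin d))‖ := by
  refine ContinuousLinearMap.opNorm_le_bound _ (by positivity) fun η => ?_
  have h2 := hC.norm_symm_le_dHat hC' h1 hΛ' η
  have h3 : ‖C'.symm (dHat d x η)‖ ≤
    ‖(C'.symm : TangentSpace (𝓡 d) (proj (shift x)) →L[ℝ] EuclideanSpace ℝ (Fin d))‖ *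
      ‖dHat d x η‖ :=
    (C'.symm : TangentSpace (𝓡 d) (proj (shift x)) →L[ℝ] EuclideanSpace ℝ (Fin d)).le_opNorm _
  have h4 := hΛ η
  calc ‖C.symm η‖ ≤ √2 * Λ * ‖C'.symm (dHat d x η)‖ := h2
    _ ≤ √2 * Λ *
      (‖(C'.symm : TangentSpace (𝓡 d) (proj (shift x)) →L[ℝ] EuclideanSpace ℝ (Fin d))‖ *
        (Λ * ‖η‖)) := by gcongr; exact h3.trans (by gcongr)
    _ = _ := by ring

end Lyapunov

/-! ### The ladder of sizes -/

section Ladder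

variable {Γ γ : ℝ} {J : ℝ → ℝ}

/-- `J` need not be continuous, but its fourth iterate is, so the intermediate value theorem makes
that iterate, and hence `J`, onto. The factor `exp (-Γ)` in `t₀` absorbs the exponential, whose
exponent is at most `Γ` on `(0, 1]`. -/
theorem IsQuarterLadder.exists_eq (hJ : IsQuarterLadder Γ γ J) (hΓ : 0 < Γ) (hγ : 0 < γ) {y : ℝ}
    (hy : 0 < y) : ∃ q, 0 < q ∧ J q = y := by
  set t₀ := min 1 y * Real.exp (-Γ) with ht₀
  have h0 : 0 < t₀ := by positivity
  have hexp : Real.exp (-Γ) ≤ 1 := Real.exp_le_one_iff.2 (by linarith)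
  have hm0 : 0 < min 1 y := lt_min one_pos hy
  have h1 : t₀ ≤ min 1 y := mul_le_of_le_one_right hm0.le hexp
  have hcont : ContinuousOn (fun t : ℝ => t * Real.exp (Γ * t ^ (1 / γ))) (Set.Icc t₀ y) := by
    refine continuousOn_id.mul (Real.continuous_exp.comp_continuousOn
      (continuousOn_const.mul (continuousOn_id.rpow_const fun t ht => Or.inl ?_)))
    exact (h0.trans_le ht.1).ne'
  have hlow : t₀ * Real.exp (Γ * t₀ ^ (1 / γ)) ≤ y := by
    have h2 : t₀ ^ (1 / γ) ≤ 1 :=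
      Real.rpow_le_one h0.le (h1.trans (min_le_left _ _)) (by positivity)
    calc t₀ * Real.exp (Γ * t₀ ^ (1 / γ)) ≤ t₀ * Real.exp (Γ * 1) := by gcongr
      _ = min 1 y := by rw [ht₀, mul_assoc, ← Real.exp_add]; simp
      _ ≤ y := min_le_right _ _
  have hup : y ≤ y * Real.exp (Γ * y ^ (1 / γ)) :=
    le_mul_of_one_le_right hy.le (Real.one_le_exp (by positivity))
  obtain ⟨t, ht, hty⟩ := intermediate_value_Icc (h1.trans (min_le_right _ _)) hcont ⟨hlow, hup⟩
  have ht0 : 0 < t := h0.trans_le ht.1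
  refine ⟨J (J (J t)), hJ.mapsTo (hJ.mapsTo (hJ.mapsTo ht0)), ?_⟩
  exact (hJ.iterate_four t ht0).trans hty

theorem IsQuarterLadder.exists_iterate_eq (hJ : IsQuarterLadder Γ γ J) (hΓ : 0 < Γ) (hγ : 0 < γ)
    (n : ℕ) : ∀ y, 0 < y → ∃ q, 0 < q ∧ J^[n] q = y := by
  induction n with
  | zero => exact fun y hy => ⟨y, hy, rfl⟩
  | succ n ih =>
    intro y hy
    obtain ⟨p, hp, hpy⟩ := ih y hy
    obtain ⟨q, hq, hqp⟩ := hJ.exists_eq hΓ hγ hp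
    exact ⟨q, hq, by rw [Function.iterate_succ_apply, hqp, hpy]⟩

/-- The ladder accumulates at `0`. -/
theorem IsQuarterLadder.exists_mem_le (hJ : IsQuarterLadder Γ γ J) (hΓ : 0 < Γ) (hγ : 0 < γ)
    {δ : ℝ} (hδ : 0 < δ) : ∃ q ∈ ladderSet J, q ≤ δ := by
  by_contra! h
  set c := Real.exp (Γ * δ ^ (1 / γ)) with hc
  have hc1 : 1 < c := Real.one_lt_exp_iff.2 (by positivity)
  -- Above `δ`, four applications of `J` multiply by at least `c > 1`; a point that reaches `1`
  -- after `n` such blocks is therefore at most `c⁻ⁿ`.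
  have key : ∀ n : ℕ, ∀ q, 0 < q → J^[4 * n] q = 1 → q * c ^ n ≤ 1 := by
    intro n
    induction n with
    | zero =>
      intro q _ hq1
      rw [pow_zero, mul_one]
      exact hq1.le
    | succ n ih =>
      intro q hq hq1
      have hδq : δ < q := h q ⟨hq, _, hq1⟩
      have h4 := hJ.iterate_four q hq
      have h1 : J^[4 * n] (J^[4] q) = 1 := by rw [← Function.iterate_add_apply]; exact hq1
      have hpos : 0 < J^[4] q := by rw [h4]; positivity
      have h2 := ih _ hpos h1
      have h3 : q * c ≤ J^[4] q := by
        rw [h4, hc]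
        gcongr
      calc q * c ^ (n + 1) = q * c * c ^ n := by ring
        _ ≤ J^[4] q * c ^ n := by gcongr
        _ ≤ 1 := h2
  obtain ⟨n, hn⟩ := pow_unbounded_of_one_lt (1 / δ) hc1
  obtain ⟨q, hq, hq1⟩ := hJ.exists_iterate_eq hΓ hγ (4 * n) 1 one_pos
  have h1 := key n q hq hq1
  have h2 : δ < q := h q ⟨hq, _, hq1⟩
  rw [div_lt_iff₀ hδ] at hn
  have h3 : c ^ n * δ ≤ c ^ n * q := by gcongr
  linarith

/-- These two bounds are all that the estimates need from the ladder; whether the supremum is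
attained does not matter. -/
theorem IsQuarterLadder.sSup_bounds (hJ : IsQuarterLadder Γ γ J) (hΓ : 0 < Γ) (hγ : 0 < γ)
    {δ : ℝ} (hδ : 0 < δ) :
    0 < sSup {q ∈ ladderSet J | q ≤ δ} ∧ sSup {q ∈ ladderSet J | q ≤ δ} ≤ δ := by
  obtain ⟨q, hq, hqδ⟩ := hJ.exists_mem_le hΓ hγ hδ
  exact ⟨hq.1.trans_le (le_csSup ⟨δ, fun _ h => h.2⟩ ⟨hq, hqδ⟩),
    csSup_le ⟨q, hq, hqδ⟩ fun _ h => h.2⟩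

end Ladder

/-! ### Numerical bounds for the size of a chart -/

/-- `P` plays the role of `ρ`, `N` of `‖C₀⁻¹‖` and `D` of `d(x₀, Γ_∞)`. The first bound serves the
inclusions, the second the Hölder norm. After raising to the power `β / 2`, the size still contains
`P ^ (4 * a)`, which cancels `D ^ (-4 * a)`, and `N ^ (-γ * β)`, which is at most `N⁻¹` because `γ *
β > 20`. -/
theorem size_bounds {ε P N D a β γ q : ℝ} (hε : 0 < ε) (hε1 : ε ≤ 1) (hP : 0 < P) (hPD : P ≤ D)
    (hD : D ≤ 1) (hN : 1 ≤ N) (ha : 1 < a) (hβ : 0 < β) (hβ1 : β ≤ 1) (hγ : 20 / β < γ)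
    (hq : 0 < q) (hqle : q ≤ ε ^ (20 / β) * P ^ (8 * a / β) * N ^ (-2 * γ)) :
    q * N * (D ^ (-a)) ^ 4 ≤ ε * P ^ a ∧
      (2 * q) ^ (β / 2) * (N * (D ^ (-a)) ^ 4) ≤ 2 * ε ^ 2 := by
  have hD0 : 0 < D := hP.trans_le hPD
  have hP1 : P ≤ 1 := hPD.trans hD
  have hN0 : 0 < N := by linarith
  have h20 : 20 ≤ 20 / β := by rw [le_div_iff₀ hβ]; nlinarith
  have hcancel : P ^ (4 * a) * (D ^ (-a)) ^ 4 ≤ 1 := by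
    have h1 : (D ^ (-a)) ^ 4 = D ^ (-(4 * a)) := by
      rw [← Real.rpow_natCast, ← Real.rpow_mul hD0.le]; congr 1; push_cast; ring
    rw [h1]
    calc P ^ (4 * a) * D ^ (-(4 * a)) ≤ D ^ (4 * a) * D ^ (-(4 * a)) := by gcongr
      _ = 1 := by rw [← Real.rpow_add hD0]; simp
  have hNinv : N ^ (-1 : ℝ) * N = 1 := by rw [Real.rpow_neg_one]; exact inv_mul_cancel₀ hN0.ne'
  constructor
  · have h1 : ε ^ (20 / β) ≤ ε := by
      have := Real.rpow_le_rpow_of_exponent_ge hε hε1 (show (1 : ℝ) ≤ 20 / β by linarith)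
      rwa [Real.rpow_one] at this
    have h2 : P ^ (8 * a / β) ≤ P ^ a * P ^ (4 * a) := by
      rw [← Real.rpow_add hP]
      refine Real.rpow_le_rpow_of_exponent_ge hP hP1 ?_
      rw [le_div_iff₀ hβ]; nlinarith
    have h3 : N ^ (-2 * γ) ≤ N ^ (-1 : ℝ) :=
      Real.rpow_le_rpow_of_exponent_le hN (by linarith)
    calc q * N * (D ^ (-a)) ^ 4
        ≤ (ε * (P ^ a * P ^ (4 * a)) * N ^ (-1 : ℝ)) * N * (D ^ (-a)) ^ 4 := by
          have : q ≤ ε * (P ^ a * P ^ (4 * a)) * N ^ (-1 : ℝ) := hqle.trans (by gcongr)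
          gcongr
      _ = ε * P ^ a * (P ^ (4 * a) * (D ^ (-a)) ^ 4) * (N ^ (-1 : ℝ) * N) := by ring
      _ ≤ ε * P ^ a * 1 * 1 := by rw [hNinv]; gcongr
      _ = ε * P ^ a := by ring
  · have h1 : q ^ (β / 2) ≤ ε ^ (10 : ℝ) * P ^ (4 * a) * N ^ (-(γ * β)) := by
      have := Real.rpow_le_rpow hq.le hqle (show 0 ≤ β / 2 by positivity)
      rw [Real.mul_rpow (by positivity) (by positivity), Real.mul_rpow (by positivity)
        (by positivity), ← Real.rpow_mul hε.le, ← Real.rpow_mul hP.le,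
        ← Real.rpow_mul hN0.le] at this
      have e1 : 20 / β * (β / 2) = 10 := by field_simp; norm_num
      have e2 : 8 * a / β * (β / 2) = 4 * a := by field_simp; norm_num
      have e3 : -2 * γ * (β / 2) = -(γ * β) := by ring
      rwa [e1, e2, e3] at this
    have h2 : ε ^ (10 : ℝ) ≤ ε ^ 2 := by
      have := Real.rpow_le_rpow_of_exponent_ge hε hε1 (show (2 : ℝ) ≤ 10 by norm_num)
      rwa [Real.rpow_two] at this
    have h3 : N ^ (-(γ * β)) ≤ N ^ (-1 : ℝ) := by
      refine Real.rpow_le_rpow_of_exponent_le hN ?_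
      rw [div_lt_iff₀ hβ] at hγ
      linarith
    have h4 : (2 : ℝ) ^ (β / 2) ≤ 2 := by
      have := Real.rpow_le_rpow_of_exponent_le (x := 2) (by norm_num) (show β / 2 ≤ 1 by linarith)
      rwa [Real.rpow_one] at this
    rw [Real.mul_rpow (by norm_num) hq.le]
    calc 2 ^ (β / 2) * q ^ (β / 2) * (N * (D ^ (-a)) ^ 4)
        ≤ 2 * (ε ^ 2 * P ^ (4 * a) * N ^ (-1 : ℝ)) * (N * (D ^ (-a)) ^ 4) := by
          have : q ^ (β / 2) ≤ ε ^ 2 * P ^ (4 * a) * N ^ (-1 : ℝ) := h1.trans (by gcongr)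
          gcongr
      _ = 2 * ε ^ 2 * (P ^ (4 * a) * (D ^ (-a)) ^ 4) * (N ^ (-1 : ℝ) * N) := by ring
      _ ≤ 2 * ε ^ 2 * 1 * 1 := by rw [hNinv]; gcongr
      _ = 2 * ε ^ 2 := by ring

/-! ### The error term of a chart map -/

section ErrorTerm

variable {E : Type*} [NormedAddCommGroup E] [NormedSpace ℝ E]

theorem c1HolderNorm_le {H : E → E} {U : Set E} {c α : ℝ} (hα : 0 ≤ α)
    (h0 : ∀ u ∈ U, ‖H u‖ ≤ c) (h1 : ∀ u ∈ U, ‖fderiv ℝ H u‖ ≤ c)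
    (h2 : ∀ u ∈ U, ∀ w ∈ U, ‖fderiv ℝ H u - fderiv ℝ H w‖ ≤ c * ‖u - w‖ ^ α) (hc : 0 ≤ c) :
    c1HolderNorm α U H ≤ ENNReal.ofReal (3 * c) := by
  have e : ENNReal.ofReal (3 * c) = ENNReal.ofReal c + ENNReal.ofReal c + ENNReal.ofReal c := by
    rw [← ENNReal.ofReal_add hc hc, ← ENNReal.ofReal_add (by positivity) hc]
    congr 1; ring
  rw [e]
  refine add_le_add (add_le_add ?_ ?_) ?_
  · refine iSup₂_le fun u hu => ?_
    rw [← ofReal_norm]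
    exact ENNReal.ofReal_le_ofReal (h0 u hu)
  · refine iSup₂_le fun u hu => ?_
    rw [← ofReal_norm]
    exact ENNReal.ofReal_le_ofReal (h1 u hu)
  · refine iSup₂_le fun u hu => iSup₂_le fun w hw => iSup_le fun _ => ?_
    refine ENNReal.div_le_of_le_mul ?_
    rw [← ofReal_norm, ← ofReal_norm, ENNReal.ofReal_rpow_of_nonneg (norm_nonneg _) hα,
      ← ENNReal.ofReal_mul hc]
    exact ENNReal.ofReal_le_ofReal (h2 u hu w hw)

/-- Take `H = F - D`. Its derivative oscillates like that of `F` and vanishes at `0`, so on a ball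
of radius at most `1` the Hölder bound `c` also bounds `dH` and, by the mean value inequality, `H`.
The three parts of the norm add up to `3 * c`. -/
theorem exists_error_term {F : E → E} {D : E →L[ℝ] E} {Q c α ε : ℝ} (hQ0 : 0 < Q) (hQ : Q ≤ 1)
    (hα : 0 < α) (hc : 0 ≤ c) (hε : 3 * c < ε)
    (hF : ∀ u ∈ Metric.ball (0 : E) Q, ContDiffAt ℝ 1 F u) (hF0 : F 0 = 0)
    (hD : HasFDerivAt F D 0)
    (hh : ∀ u ∈ Metric.ball (0 : E) Q, ∀ w ∈ Metric.ball (0 : E) Q,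
      ‖fderiv ℝ F u - fderiv ℝ F w‖ ≤ c * ‖u - w‖ ^ α) :
    ∃ H : E → E, (∀ u ∈ Metric.ball (0 : E) Q, F u = D u + H u) ∧ H 0 = 0 ∧
      HasFDerivAt H (0 : E →L[ℝ] E) 0 ∧ ContDiffOn ℝ 1 H (Metric.ball 0 Q) ∧
      c1HolderNorm α (Metric.ball 0 Q) H < ENNReal.ofReal ε := by
  set H : E → E := fun u => F u - D u with hH
  have h0 : (0 : E) ∈ Metric.ball (0 : E) Q := Metric.mem_ball_self hQ0
  have hH0 : H 0 = 0 := by simp [hH, hF0]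
  have hd : ∀ u ∈ Metric.ball (0 : E) Q, HasFDerivAt H (fderiv ℝ F u - D) u := fun u hu =>
    ((hF u hu).differentiableAt one_ne_zero).hasFDerivAt.sub D.hasFDerivAt
  have hsmall : ∀ u ∈ Metric.ball (0 : E) Q, ‖fderiv ℝ H u‖ ≤ c := by
    intro u hu
    rw [(hd u hu).fderiv, ← hD.fderiv]
    have h1 := hh u hu 0 h0
    rw [sub_zero] at h1
    have h2 : ‖u‖ ^ α ≤ 1 :=
      Real.rpow_le_one (norm_nonneg _) ((mem_ball_zero_iff.1 hu).le.trans hQ) hα.le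
    exact h1.trans (mul_le_of_le_one_right hc h2)
  refine ⟨H, fun u _ => by simp [hH], hH0, ?_, ?_, ?_⟩
  · have := hD.sub D.hasFDerivAt
    rwa [sub_self] at this
  · exact fun u hu => ((hF u hu).sub D.contDiff.contDiffAt).contDiffWithinAt
  · refine (c1HolderNorm_le hα.le (fun u hu => ?_) hsmall (fun u hu w hw => ?_) hc).trans_lt
      ((ENNReal.ofReal_lt_ofReal_iff (by linarith)).2 hε)
    · have h1 := (convex_ball (0 : E) Q).norm_image_sub_le_of_norm_fderiv_le (𝕜 := ℝ) (f := H)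
        (fun u hu => (hd u hu).differentiableAt) hsmall h0 hu
      rw [hH0, sub_zero, sub_zero] at h1
      exact h1.trans (mul_le_of_le_one_right hc ((mem_ball_zero_iff.1 hu).le.trans hQ))
    · rw [(hd u hu).fderiv, (hd w hw).fderiv, sub_sub_sub_cancel_right]
      exact hh u hu w hw

end ErrorTerm

/-! ### Consequences of the assumptions on the map -/

section System

variable {d : ℕ} {M : Type*} [MetricSpace M] [ChartedSpace (EuclideanSpace ℝ (Fin d)) M]
  [RiemannianBundle (fun x : M => TangentSpace (𝓡 d) x)]
  [IsManifold (𝓡 d) ∞ M] {r : ℝ} {ι : Type*} {𝒟 : FrameCover d M r ι} {f : M → M}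
  {β a K : ℝ} {τ : M → ℝ} {finv : M → M → M} {z : M}

theorem distSing_lt_one [CompactSpace M] (hdiam : Metric.diam (Set.univ : Set M) < 1)
    (hne : (singularSet d f).Nonempty) (z : M) : distSing d f z < 1 := by
  obtain ⟨s, hs⟩ := hne
  exact ((Metric.infDist_le_dist_of_mem hs).trans (Metric.dist_le_diam_of_mem
    isCompact_univ.isBounded (Set.mem_univ _) (Set.mem_univ _))).trans_lt hdiam

namespace IsSingularSystem

theorem τ_pos (hf : IsSingularSystem 𝒟 f β a K τ finv) (hz : z ∉ singularSet d f)
    (hfz : f z ∉ singularSet d f) : 0 < τ z :=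
  (le_min (Real.rpow_nonneg Metric.infDist_nonneg _)
    (Real.rpow_nonneg Metric.infDist_nonneg _)).trans_lt (hf.lt_τ z hz hfz)

theorem distSing_pos (hf : IsSingularSystem 𝒟 f β a K τ finv) (hd : 2 ≤ d)
    (hz : z ∉ singularSet d f) (hfz : f z ∉ singularSet d f) : 0 < distSing d f z := by
  refine lt_of_le_of_ne Metric.infDist_nonneg fun h => ?_
  have h1 := (hf.norm_df z hz hfz z (Metric.mem_ball_self
    (by linarith [hf.τ_pos hz hfz]))).2
  -- At distance `0` the upper bound in (A2) is `0 ^ (-a)`, and this real power has the value `0`;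
  -- then `df` would vanish although it is invertible on a nonzero space.
  rw [← h, Real.zero_rpow (by linarith [hf.one_lt_a])] at h1
  obtain ⟨e, he⟩ := not_not.1 hz
  have : Nonempty (Fin d) := ⟨⟨0, by omega⟩⟩
  obtain ⟨v, hv⟩ := exists_ne (0 : EuclideanSpace ℝ (Fin d))
  have h2 : mfderiv (𝓡 d) (𝓡 d) f z = 0 := norm_le_zero_iff.1 h1
  have h3 : e v = 0 := by
    have := congrArg (fun l => l v) (he.trans h2)
    exact this
  exact hv (e.map_eq_zero_iff.1 h3)

theorem one_le_rpow (hf : IsSingularSystem 𝒟 f β a K τ finv) [CompactSpace M]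
    (hdiam : Metric.diam (Set.univ : Set M) < 1) (hd : 2 ≤ d)
    (hz : z ∉ singularSet d f) (hfz : f z ∉ singularSet d f) : 1 ≤ distSing d f z ^ (-a) :=
  Real.one_le_rpow_of_pos_of_le_one_of_nonpos (hf.distSing_pos hd hz hfz)
    (distSing_lt_one hdiam hf.nonempty_sing z).le (by linarith [hf.one_lt_a])

/-- The map and its inverse branch are branches in suitable frames. -/
theorem exists_isBranch (hf : IsSingularSystem 𝒟 f β a K τ finv) [CompactSpace M]
    (hdiam : Metric.diam (Set.univ : Set M) < 1) (hd : 2 ≤ d) {y : M} (hy : f z = y)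
    (hz : z ∉ singularSet d f) (hfz : f z ∉ singularSet d f) :
    ∃ i j, 𝒟.IsBranch f z y (2 * τ z) (distSing d f z ^ (-a)) K β i j ∧
      𝒟.IsBranch (finv z) y z (2 * τ z) (distSing d f z ^ (-a)) K β j i := by
  subst hy
  obtain ⟨i, j, hi, hj, h1, h2⟩ := hf.holder z hz hfz
  have hΛ := hf.one_le_rpow hdiam hd hz hfz
  exact ⟨i, j, ⟨rfl, hΛ, hf.c1Holder.1.contMDiffOn, fun p hp => (hf.norm_df z hz hfz p hp).2, hi,
    hj, h1⟩, ⟨hf.finv_base z hz hfz, hΛ, hf.finv_smooth z hz hfz,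
    fun p hp => (hf.norm_dfinv z hz hfz p hp).2, hj, hi, h2⟩⟩

/-- The second bound comes from differentiating `f ∘ finv z = id` at `f z`: the derivative of the
branch inverts `df`, and (A2) bounds it. -/
theorem norm_mfderiv_bounds (hf : IsSingularSystem 𝒟 f β a K τ finv) (hz : z ∉ singularSet d f)
    (hfz : f z ∉ singularSet d f) (η : TangentSpace (𝓡 d) z) :
    ‖mfderiv (𝓡 d) (𝓡 d) f z η‖ ≤ distSing d f z ^ (-a) * ‖η‖ ∧
      ‖η‖ ≤ distSing d f z ^ (-a) * ‖mfderiv (𝓡 d) (𝓡 d) f z η‖ := by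
  have hτ := hf.τ_pos hz hfz
  have hτ2 : 0 < 2 * τ z := by linarith
  refine ⟨((mfderiv (𝓡 d) (𝓡 d) f z).le_opNorm η).trans (mul_le_mul_of_nonneg_right
    (hf.norm_df z hz hfz z (Metric.mem_ball_self hτ2)).2 (norm_nonneg _)), ?_⟩
  have hb : finv z (f z) = z := hf.finv_base z hz hfz
  have h1 : HasMFDerivAt (𝓡 d) (𝓡 d) f (finv z (f z)) (mfderiv (𝓡 d) (𝓡 d) f (finv z (f z))) :=
    (hf.c1Holder.1.contMDiffAt.mdifferentiableAt one_ne_zero).hasMFDerivAt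
  have h2 : HasMFDerivAt (𝓡 d) (𝓡 d) (finv z) (f z) (mfderiv (𝓡 d) (𝓡 d) (finv z) (f z)) :=
    (((hf.finv_smooth z hz hfz).contMDiffAt (Metric.ball_mem_nhds _ hτ2)).mdifferentiableAt
      one_ne_zero).hasMFDerivAt
  have h3 := HasMFDerivAt.comp (f z) h1 h2
  have h4 : HasMFDerivAt (𝓡 d) (𝓡 d) (f ∘ finv z) (f z)
      (ContinuousLinearMap.id ℝ (TangentSpace (𝓡 d) (f z))) := by
    refine (hasMFDerivAt_id (f z)).congr_of_eventuallyEq ?_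
    filter_upwards [Metric.ball_mem_nhds (f z) hτ2] with w hw
    exact hf.finv_right z hz hfz w hw
  have h5 : ∀ ζ : EuclideanSpace ℝ (Fin d), (mfderiv (𝓡 d) (𝓡 d) f (finv z (f z))
      (mfderiv (𝓡 d) (𝓡 d) (finv z) (f z) ζ) : EuclideanSpace ℝ (Fin d)) = ζ := fun ζ =>
    congrArg (fun l => l ζ) (hasMFDerivAt_unique h3 h4)
  have h6 : ∀ p, p = z → ∀ ζ : EuclideanSpace ℝ (Fin d),
      (mfderiv (𝓡 d) (𝓡 d) f p ζ : EuclideanSpace ℝ (Fin d)) = mfderiv (𝓡 d) (𝓡 d) f z ζ := by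
    rintro p rfl ζ; rfl
  obtain ⟨e, he⟩ := not_not.1 hz
  set ξ : EuclideanSpace ℝ (Fin d) := mfderiv (𝓡 d) (𝓡 d) (finv z) (f z)
    (mfderiv (𝓡 d) (𝓡 d) f z η) with hξ
  have h7 : (mfderiv (𝓡 d) (𝓡 d) f z ξ : EuclideanSpace ℝ (Fin d)) =
      mfderiv (𝓡 d) (𝓡 d) f z η :=
    (h6 _ hb ξ).symm.trans (h5 _)
  have h8 : ξ = η := by
    rw [← he] at h7
    exact e.injective h7
  have h9 : ‖(mfderiv (𝓡 d) (𝓡 d) (finv z) (f z) (mfderiv (𝓡 d) (𝓡 d) f z η) :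
      TangentSpace (𝓡 d) (finv z (f z)))‖ ≤
      distSing d f z ^ (-a) * ‖mfderiv (𝓡 d) (𝓡 d) f z η‖ :=
    ((mfderiv (𝓡 d) (𝓡 d) (finv z) (f z)).le_opNorm _).trans (mul_le_mul_of_nonneg_right
      (hf.norm_dfinv z hz hfz _ (Metric.mem_ball_self hτ2)).2 (norm_nonneg _))
  have h10 : ∀ p, p = z → ∀ ζ : EuclideanSpace ℝ (Fin d),
      ‖(show TangentSpace (𝓡 d) p from ζ)‖ = ‖(show TangentSpace (𝓡 d) z from ζ)‖ := by
    rintro p rfl ζ; rfl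
  have h11 : ‖(show TangentSpace (𝓡 d) (finv z (f z)) from ξ)‖ = ‖η‖ :=
    (h10 _ hb ξ).trans (congrArg (fun ζ : TangentSpace (𝓡 d) z => ‖ζ‖) h8)
  exact h11.symm.le.trans h9

theorem norm_tangentCast {p q : M} (h : p = q) (ξ : TangentSpace (𝓡 d) p) :
    ‖tangentCast d h ξ‖ = ‖ξ‖ := by
  subst h; rfl

theorem norm_dHat_bounds (hf : IsSingularSystem 𝒟 f β a K τ finv) {x : OrbitSpace f}
    (hx : IsSummablePoint d x) (η : TangentSpace (𝓡 d) (proj x)) :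
    ‖dHat d x η‖ ≤ distSing d f (proj x) ^ (-a) * ‖η‖ ∧
      ‖η‖ ≤ distSing d f (proj x) ^ (-a) * ‖dHat d x η‖ := by
  have h : f (proj x) ∉ singularSet d f := by
    rw [f_proj x]; exact hx.regular 1
  have h1 := hf.norm_mfderiv_bounds (hx.regular 0) h η
  have h2 : ‖dHat d x η‖ = ‖mfderiv (𝓡 d) (𝓡 d) f (proj x) η‖ := norm_tangentCast _ _
  rw [h2]
  exact h1

end IsSingularSystem

end System

/-! ### Chart maps -/

/-- One bound on `q * N * Λ ^ 4` covers every smaller product that occurs in the inclusions. -/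
theorem size_mono {q N Λ : ℝ} (hq : 0 ≤ q) (hN : 1 ≤ N) (hΛ : 1 ≤ Λ) :
    q ≤ q * N * Λ ^ 4 ∧ Λ * q ≤ q * N * Λ ^ 4 ∧ Λ ^ 2 * q ≤ q * N * Λ ^ 4 ∧
      N * Λ ^ 3 * q ≤ q * N * Λ ^ 4 := by
  have h : ∀ k ≤ 4, N * Λ ^ k * q ≤ q * N * Λ ^ 4 := fun k hk => by
    calc N * Λ ^ k * q ≤ N * Λ ^ 4 * q := by gcongr
      _ = _ := by ring
  have h' : ∀ k ≤ 4, Λ ^ k * q ≤ q * N * Λ ^ 4 := fun k hk =>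
    le_trans (by rw [mul_assoc]; exact le_mul_of_one_le_left (by positivity) hN) (h k hk)
  refine ⟨?_, ?_, h' 2 (by norm_num), h 3 (by norm_num)⟩
  · simpa using h' 0 (by norm_num)
  · simpa using h' 1 (by norm_num)

/-- The chain rule in both compositions at the common fixed point makes the two derivatives inverse
to each other. -/
theorem isInvertible_and_hasFDerivAt_inverse {E : Type*} [NormedAddCommGroup E] [NormedSpace ℝ E]
    {F G : E → E} {D : E →L[ℝ] E} (hF : HasFDerivAt F D 0) (hG : DifferentiableAt ℝ G 0)
    (hF0 : F 0 = 0) (hG0 : G 0 = 0) (hFG : ∀ᶠ v in 𝓝 0, F (G v) = v)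
    (hGF : ∀ᶠ u in 𝓝 0, G (F u) = u) : D.IsInvertible ∧ HasFDerivAt G D.inverse 0 := by
  have h1 : D ∘L fderiv ℝ G 0 = ContinuousLinearMap.id ℝ E := by
    have h := HasFDerivAt.comp (0 : E) (g := F) (g' := D) (by rwa [hG0]) hG.hasFDerivAt
    exact h.unique ((hasFDerivAt_id (0 : E)).congr_of_eventuallyEq hFG)
  have h2 : fderiv ℝ G 0 ∘L D = ContinuousLinearMap.id ℝ E := by
    have h := HasFDerivAt.comp (0 : E) (g := G) (g' := fderiv ℝ G 0)
      (by rw [hF0]; exact hG.hasFDerivAt) hF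
    exact h.unique ((hasFDerivAt_id (0 : E)).congr_of_eventuallyEq hGF)
  have hD : D = (ContinuousLinearEquiv.equivOfInverse D (fderiv ℝ G 0)
      (fun v => congrArg (fun l => l v) h2) (fun v => congrArg (fun l => l v) h1) : E ≃L[ℝ] E) := by
    ext; rfl
  have hinv : D.inverse = fderiv ℝ G 0 := by
    rw [hD, ContinuousLinearMap.inverse_equiv]
    ext; rfl
  exact ⟨⟨_, hD.symm⟩, hinv ▸ hG.hasFDerivAt⟩

/-! ### Estimates for a branch in Lyapunov charts -/

section

variable {d : ℕ} {M : Type*} [MetricSpace M] [ChartedSpace (EuclideanSpace ℝ (Fin d)) M]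
  [RiemannianBundle (fun x : M => TangentSpace (𝓡 d) x)]
  [IsManifold (𝓡 d) ∞ M] [IsContMDiffRiemannianBundle (𝓡 d) ∞ (EuclideanSpace ℝ (Fin d))
      (fun x : M => TangentSpace (𝓡 d) x)] [IsRiemannianManifold (𝓡 d) M] {r : ℝ} {ι : Type*}
  {𝒟 : FrameCover d M r ι} {g : M → M} {x y : M} {s Λ K β : ℝ} {i j : ι}
  {C : EuclideanSpace ℝ (Fin d) ≃L[ℝ] TangentSpace (𝓡 d) x}
  {C' : EuclideanSpace ℝ (Fin d) ≃L[ℝ] TangentSpace (𝓡 d) y}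

namespace FrameCover.IsBranch

theorem branchMap_zero (h : 𝒟.IsBranch g x y s Λ K β i j) (hr : IsAdmissibleRadius d M r) :
    branchMap r g x y C C' 0 = 0 := by
  rw [branchMap, map_zero, expMap_zero, h.map_eq, hr.expInv_self, map_zero]

theorem map_mem_ball (h : 𝒟.IsBranch g x y s Λ K β i j) (hr : IsAdmissibleRadius d M r)
    (hC : ∀ u, ‖C u‖ ≤ ‖u‖) {R : ℝ} (hR : R ≤ r) (hRs : 2 * R ≤ s) (hΛR : 2 * Λ * R ≤ r)
    {u : EuclideanSpace ℝ (Fin d)} (hu : ‖u‖ < R) :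
    expMap x (C u) ∈ Metric.ball x s ∧ g (expMap x (C u)) ∈ Metric.ball y r := by
  have h1 : ‖C u‖ < R := (hC u).trans_lt hu
  have hΛ := h.one_le
  have h2 := h.dist_le hr (h1.trans_le hR) (by linarith)
  refine ⟨hr.expMap_mem_ball (h1.trans_le hR) (by linarith), ?_⟩
  have h3 : 2 * Λ * ‖C u‖ < 2 * Λ * R := by gcongr
  rw [Metric.mem_ball]
  linarith

theorem norm_branchMap_le (h : 𝒟.IsBranch g x y s Λ K β i j) (hr : IsAdmissibleRadius d M r)
    (hC : ∀ u, ‖C u‖ ≤ ‖u‖) {R : ℝ} (hR : R ≤ r) (hRs : 2 * R ≤ s) (hΛR : 2 * Λ * R ≤ r)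
    {u : EuclideanSpace ℝ (Fin d)} (hu : ‖u‖ < R) :
    ‖branchMap r g x y C C' u‖ ≤
      ‖(C'.symm : TangentSpace (𝓡 d) y →L[ℝ] EuclideanSpace ℝ (Fin d))‖ * (4 * Λ * ‖u‖) := by
  have hΛ := h.one_le
  have h1 := (h.map_mem_ball hr hC hR hRs hΛR hu).2
  have h2 := hr.norm_expInv_le (d := d) h1
  have h3 := h.dist_le hr (((hC u).trans_lt hu).trans_le hR) (by linarith [hC u])
  have h4 : Λ * ‖C u‖ ≤ Λ * ‖u‖ := by gcongr; exact hC u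
  refine ((C'.symm : TangentSpace (𝓡 d) y →L[ℝ] EuclideanSpace ℝ (Fin d)).le_opNorm _).trans ?_
  gcongr
  linarith

/-- Half of the Hölder exponent is traded for smallness: distances are at most `2 * Q`, so `‖u - w‖
^ β ≤ (2 * Q) ^ (β / 2) * ‖u - w‖ ^ (β / 2)`. By `hQN` the first factor beats `N * Λ ^ 4`, which
leaves the constant `c = 4 * A * ε ^ 2`, and `hεA` gives `3 * c < ε`. -/
theorem chart_estimates (h : 𝒟.IsBranch g x y s Λ K β i j)
    (hr : IsAdmissibleRadius d M r) (hK : 0 ≤ K) (hβ : 0 < β) (hβ1 : β ≤ 1) {δ L : ℝ} (hL : 0 ≤ L)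
    (hδr : δ ≤ r) (hlip : ∀ (i : ι) (x : M), ∀ v w : TangentSpace (𝓡 d) x, ‖v‖ < δ → ‖w‖ < δ →
        expMap x v ∈ 𝒟.dom i → expMap x w ∈ 𝒟.dom i → ∀ ξ,
        ‖𝒟.dexpFrame i x v ξ - 𝒟.dexpFrame i x w ξ‖ ≤ L * ‖v - w‖ * ‖ξ‖)
    (hC : ∀ u, ‖C u‖ ≤ ‖u‖) {Q N ε : ℝ} (hQ0 : 0 < Q) (hQδ : 4 * Λ * Q ≤ δ)
    (hQs : 2 * Λ * Q ≤ s) (hε : 0 < ε) (hεA : 12 * (34 * L + 8 * K) * ε < 1)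
    (hC' : ‖(C'.symm : TangentSpace (𝓡 d) y →L[ℝ] EuclideanSpace ℝ (Fin d))‖ ≤ √2 * Λ ^ 2 * N)
    (hN : 0 ≤ N) (hQN : (2 * Q) ^ (β / 2) * (N * Λ ^ 4) ≤ 2 * ε ^ 2)
    {D : EuclideanSpace ℝ (Fin d) →L[ℝ] EuclideanSpace ℝ (Fin d)}
    (hD : HasFDerivAt (branchMap r g x y C C') D 0) :
    (∃ H : EuclideanSpace ℝ (Fin d) → EuclideanSpace ℝ (Fin d),
      (∀ u ∈ Metric.ball (0 : EuclideanSpace ℝ (Fin d)) Q,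
        branchMap r g x y C C' u = D u + H u) ∧ H 0 = 0 ∧
      HasFDerivAt H (0 : EuclideanSpace ℝ (Fin d) →L[ℝ] EuclideanSpace ℝ (Fin d)) 0 ∧
      ContDiffOn ℝ 1 H (Metric.ball 0 Q) ∧
      c1HolderNorm (β / 2) (Metric.ball 0 Q) H < ENNReal.ofReal ε) ∧
    ∀ u ∈ Metric.ball (0 : EuclideanSpace ℝ (Fin d)) Q,
      ‖fderiv ℝ (branchMap r g x y C C') u‖ ≤ ‖D‖ + ε := by
  have hΛ := h.one_le
  have hΛ0 : 0 < Λ := by linarith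
  have hr1 := hr.lt_one
  have hQΛ : Q ≤ Λ * Q := le_mul_of_one_le_left hQ0.le hΛ
  have hA : 0 ≤ 34 * L + 8 * K := by positivity
  set A := 34 * L + 8 * K with hAdef
  set c := 4 * A * ε ^ 2 with hc
  have hc0 : 0 ≤ c := by positivity
  have hcε : 3 * c < ε := by nlinarith
  have hsmooth : ∀ u ∈ Metric.ball (0 : EuclideanSpace ℝ (Fin d)) Q,
      ContDiffAt ℝ 1 (branchMap r g x y C C') u := by
    intro u hu
    rw [mem_ball_zero_iff] at hu
    have hCu := (hC u).trans_lt hu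
    exact (h.contDiffAt_branchMap hr (by linarith) (by linarith)
      (h.map_mem_ball hr hC (R := Q) (by linarith) (by linarith) (by linarith) hu).2).1
  have hhol : ∀ u ∈ Metric.ball (0 : EuclideanSpace ℝ (Fin d)) Q,
      ∀ w ∈ Metric.ball (0 : EuclideanSpace ℝ (Fin d)) Q,
      ‖fderiv ℝ (branchMap r g x y C C') u - fderiv ℝ (branchMap r g x y C C') w‖ ≤
        c * ‖u - w‖ ^ (β / 2) := by
    intro u hu w hw
    rw [mem_ball_zero_iff] at hu hw
    have h1 := h.norm_fderiv_sub_le (C' := C') hr hK hβ hβ1 hL hδr hlip hC hQδ hQs hu hw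
    have h2 : √2 ≤ 2 := by
      rw [Real.sqrt_le_left (by norm_num)]; norm_num
    have h3 : ‖(C'.symm : TangentSpace (𝓡 d) y →L[ℝ] EuclideanSpace ℝ (Fin d))‖ ≤
        2 * Λ ^ 2 * N := hC'.trans (by gcongr)
    have h4 : ‖u - w‖ ≤ 2 * Q := (norm_sub_le _ _).trans (by linarith)
    have h5 : ‖u - w‖ ^ β ≤ (2 * Q) ^ (β / 2) * ‖u - w‖ ^ (β / 2) := by
      have e : ‖u - w‖ ^ β = ‖u - w‖ ^ (β / 2) * ‖u - w‖ ^ (β / 2) := by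
        rw [← Real.rpow_add_of_nonneg (norm_nonneg _) (by positivity) (by positivity)]
        congr 1; ring
      rw [e]
      gcongr
    calc _ ≤ _ := h1
      _ ≤ 2 * Λ ^ 2 * N * (A * Λ ^ 2 * ((2 * Q) ^ (β / 2) * ‖u - w‖ ^ (β / 2))) := by gcongr
      _ = 2 * A * ((2 * Q) ^ (β / 2) * (N * Λ ^ 4)) * ‖u - w‖ ^ (β / 2) := by ring
      _ ≤ 2 * A * (2 * ε ^ 2) * ‖u - w‖ ^ (β / 2) := by gcongr
      _ = c * ‖u - w‖ ^ (β / 2) := by rw [hc]; ring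
  have hQ1 : Q ≤ 1 := by linarith
  refine ⟨exists_error_term hQ0 hQ1 (by positivity) hc0 hcε hsmooth (h.branchMap_zero hr) hD hhol,
    fun u hu => ?_⟩
  have h1 := hhol u hu 0 (Metric.mem_ball_self hQ0)
  rw [hD.fderiv, sub_zero] at h1
  have h2 : ‖u‖ ^ (β / 2) ≤ 1 :=
    Real.rpow_le_one (norm_nonneg _) ((mem_ball_zero_iff.1 hu).le.trans hQ1) (by positivity)
  have h3 : c * ‖u‖ ^ (β / 2) ≤ c := mul_le_of_le_one_right hc0 h2
  have h4 := norm_le_norm_add_norm_sub' (fderiv ℝ (branchMap r g x y C C') u) D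
  linarith

end FrameCover.IsBranch

end

end

end PesinCharts

end

/-! ### The main theorem -/

set_option maxHeartbeats 4000000 in
theorem mainTheorem8 {d : ℕ} (hd : 2 ≤ d)
    {M : Type*} [MetricSpace M] [CompactSpace M] [ChartedSpace (EuclideanSpace ℝ (Fin d)) M]
    [IsManifold (𝓡 d) ∞ M] [RiemannianBundle (fun x : M => TangentSpace (𝓡 d) x)]
    [IsContMDiffRiemannianBundle (𝓡 d) ∞ (EuclideanSpace ℝ (Fin d))
      (fun x : M => TangentSpace (𝓡 d) x)]
    [IsRiemannianManifold (𝓡 d) M]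
    (hdiam : Metric.diam (Set.univ : Set M) < 1)
    (r : ℝ) (hr : PesinCharts.IsAdmissibleRadius d M r)
    {ι : Type*} [Countable ι] (𝒟 : PesinCharts.FrameCover d M r ι)
    (f : M → M) (β a K : ℝ) (τ : M → ℝ) (finv : M → M → M)
    (hβ : 0 < β) (hβ1 : β ≤ 1)
    (hf : PesinCharts.IsSingularSystem 𝒟 f β a K τ finv)
    (Γ γ : ℝ) (hΓ : 0 < Γ) (hγ : 20 / β < γ)
    (J : ℝ → ℝ) (hJ : PesinCharts.IsQuarterLadder Γ γ J) :
    ∃ ε₀ : ℝ, 0 < ε₀ ∧ ∀ ε : ℝ, 0 < ε → ε < ε₀ →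
      ∀ C₀ : (∀ x : PesinCharts.OrbitSpace f,
          EuclideanSpace ℝ (Fin d) ≃L[ℝ] TangentSpace (𝓡 d) (PesinCharts.proj x)),
      (∀ (x : PesinCharts.OrbitSpace f) (hx : PesinCharts.IsSummablePoint d x),
        PesinCharts.IsLyapunovChange hx (C₀ x)) →
      ∀ x : PesinCharts.OrbitSpace f, PesinCharts.IsSummablePoint d x →
        let F := PesinCharts.chartF r C₀ x
        let G := PesinCharts.chartFInv r finv C₀ x
        let D := PesinCharts.D₀ C₀ x
        let Q := PesinCharts.Qsize β a γ ε J x (C₀ x)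
        let Q' := PesinCharts.Qsize β a γ ε J (PesinCharts.shift x) (C₀ (PesinCharts.shift x))
        let R := PesinCharts.iotaSize d r a τ x
        let B := Metric.ball (0 : EuclideanSpace ℝ (Fin d)) Q
        let B' := Metric.ball (0 : EuclideanSpace ℝ (Fin d)) Q'
        -- the maps are well defined on the balls of radii `Q` and `Q'`, and on the ball of radius `R`
        (0 < Q ∧ Q ≤ R ∧ 0 < Q' ∧ Q' ≤ R ∧
          (∀ u ∈ Metric.ball (0 : EuclideanSpace ℝ (Fin d)) R,
            f (PesinCharts.pesinChart x (C₀ x) u) ∈ Metric.ball (f (PesinCharts.proj x)) r) ∧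
          (∀ v ∈ Metric.ball (0 : EuclideanSpace ℝ (Fin d)) R,
            PesinCharts.pesinChart (PesinCharts.shift x) (C₀ (PesinCharts.shift x)) v ∈
              Metric.ball (f (PesinCharts.proj x)) (2 * τ (PesinCharts.proj x)) ∧
            finv (PesinCharts.proj x)
                (PesinCharts.pesinChart (PesinCharts.shift x) (C₀ (PesinCharts.shift x)) v) ∈
              Metric.ball (PesinCharts.proj x) r)) ∧
        -- the maps are inverse to each other
        ((∀ v ∈ B', G v ∈ Metric.ball 0 R ∧ F (G v) = v) ∧
          (∀ u ∈ B, F u ∈ Metric.ball 0 R ∧ G (F u) = u)) ∧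
        -- the origin is fixed, and the derivatives there
        (F 0 = 0 ∧ G 0 = 0 ∧ HasFDerivAt F D 0 ∧ D.IsInvertible ∧ HasFDerivAt G D.inverse 0) ∧
        -- the error terms
        ((∃ H : EuclideanSpace ℝ (Fin d) → EuclideanSpace ℝ (Fin d),
            (∀ u ∈ B, F u = D u + H u) ∧ H 0 = 0 ∧
            HasFDerivAt H (0 : EuclideanSpace ℝ (Fin d) →L[ℝ] EuclideanSpace ℝ (Fin d)) 0 ∧ ContDiffOn ℝ 1 H B ∧
            PesinCharts.c1HolderNorm (β / 2) B H < ENNReal.ofReal ε) ∧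
          (∃ H : EuclideanSpace ℝ (Fin d) → EuclideanSpace ℝ (Fin d),
            (∀ v ∈ B', G v = D.inverse v + H v) ∧ H 0 = 0 ∧
            HasFDerivAt H (0 : EuclideanSpace ℝ (Fin d) →L[ℝ] EuclideanSpace ℝ (Fin d)) 0 ∧
            ContDiffOn ℝ 1 H B' ∧
            PesinCharts.c1HolderNorm (β / 2) B' H < ENNReal.ofReal ε)) ∧
        -- the bounds for the derivatives
        ((∀ u ∈ B, ‖fderiv ℝ F u‖ ≤
            2 * Real.sqrt 2 * PesinCharts.distSing d f (PesinCharts.proj x) ^ (-a)) ∧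
          (∀ v ∈ B', ‖fderiv ℝ G v‖ ≤
            2 * Real.sqrt 2 * PesinCharts.distSing d f (PesinCharts.proj x) ^ (-a))) := by
  have hr0 := hr.pos
  have hr1 := hr.lt_one
  have ha := hf.one_lt_a
  have hK : 0 ≤ K := by linarith [hf.one_lt_K]
  have hγ0 : 0 < γ := lt_trans (by positivity) hγ
  obtain ⟨δ, hδ, hδr, L, hL, hlip⟩ := 𝒟.exists_lipschitz_dexpFrame hr
  have hA : 0 ≤ 34 * L + 8 * K := by positivity
  -- `16 * ε ≤ r` keeps the images of the small balls inside radius `R`, `4 * ε ≤ δ` keeps the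
  -- points where the derivative of `exp` is Lipschitz, and the third bound makes the error terms
  -- smaller than `ε`.
  refine ⟨min (r / 16) (min (δ / 4) (1 / (12 * (34 * L + 8 * K) + 1))), by positivity,
    fun ε hε hεε C₀ hC₀ x hx => ?_⟩
  have hεr : 16 * ε ≤ r := by linarith [hεε.le.trans (min_le_left _ _)]
  have hεδ : 4 * ε ≤ δ := by
    linarith [hεε.le.trans ((min_le_right _ _).trans (min_le_left _ _))]
  have hεA : 12 * (34 * L + 8 * K) * ε < 1 := by
    have := hεε.trans_le ((min_le_right _ _).trans (min_le_right _ _))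
    rw [lt_div_iff₀ (by positivity)] at this
    linarith
  have hε1 : ε ≤ 1 := by linarith
  intro F G D Q Q' R B B'
  have hx' := hx.shift
  have hC := hC₀ x hx
  have hC' := hC₀ (PesinCharts.shift x) hx'
  have hz : PesinCharts.proj x ∉ PesinCharts.singularSet d f := hx.regular 0
  have hy : f (PesinCharts.proj x) = PesinCharts.proj (PesinCharts.shift x) :=
    PesinCharts.f_proj x
  have hfz : f (PesinCharts.proj x) ∉ PesinCharts.singularSet d f := by
    rw [hy]; exact hx.regular 1
  have hpos : ∀ n : ℤ, 0 < PesinCharts.distSing d f (x.1 n) := fun n =>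
    hf.distSing_pos hd (hx.regular n) (by rw [x.2 n]; exact hx.regular _)
  have hrho : ∀ z : PesinCharts.OrbitSpace f, PesinCharts.IsSummablePoint d z →
      0 < PesinCharts.rho d z := fun z hz => by
    have hp : ∀ n : ℤ, 0 < PesinCharts.distSing d f (z.1 n) := fun n =>
      hf.distSing_pos hd (hz.regular n) (by rw [z.2 n]; exact hz.regular _)
    exact lt_min (hp _) (lt_min (hp _) (hp _))
  set Δ := PesinCharts.distSing d f (PesinCharts.proj x) with hΔ
  have hΔ0 : 0 < Δ := hpos 0
  have hΔ1 : Δ ≤ 1 := (PesinCharts.distSing_lt_one hdiam hf.nonempty_sing _).le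
  set τ₀ := τ (PesinCharts.proj x) with hτ₀
  have hτ0 : 0 < τ₀ := hf.τ_pos hz hfz
  set Λ := Δ ^ (-a) with hΛdef
  have hΛ : 1 ≤ Λ := hf.one_le_rpow hdiam hd hz hfz
  have hΛ0 : 0 < Λ := by linarith
  have hΛΔ : Λ * Δ ^ a = 1 := by rw [hΛdef, ← Real.rpow_add hΔ0]; simp
  obtain ⟨i, j, hbf, hbg⟩ := hf.exists_isBranch hdiam hd hy hz hfz
  -- the sizes of the two charts
  set N := ‖((C₀ x).symm : TangentSpace (𝓡 d) (PesinCharts.proj x) →L[ℝ]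
    EuclideanSpace ℝ (Fin d))‖ with hN
  set N' := ‖((C₀ (PesinCharts.shift x)).symm :
    TangentSpace (𝓡 d) (PesinCharts.proj (PesinCharts.shift x)) →L[ℝ]
    EuclideanSpace ℝ (Fin d))‖ with hN'
  have hN1 : 1 ≤ N := hC.one_le_norm_symm hd
  have hN1' : 1 ≤ N' := hC'.one_le_norm_symm hd
  have hNN' : N' ≤ √2 * Λ ^ 2 * N := hC.norm_symm_shift_le hC' hΛ
    (fun η => (hf.norm_dHat_bounds hx η).1) (fun η => (hf.norm_dHat_bounds hx η).2)
  have hNN : N ≤ √2 * Λ ^ 2 * N' := hC.norm_symm_le_shift hC' hΛ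
    (fun η => (hf.norm_dHat_bounds hx η).1) (fun η => (hf.norm_dHat_bounds hx η).2)
  have h2 : √2 ≤ 2 := by rw [Real.sqrt_le_left (by norm_num)]; norm_num
  have h12 : 1 ≤ √2 := by rw [Real.one_le_sqrt]; norm_num
  have hP := hrho x hx
  have hP' := hrho _ hx'
  set P := PesinCharts.rho d x with hPdef
  set P' := PesinCharts.rho d (PesinCharts.shift x) with hPdef'
  -- Both `ρ(x̃)` and `ρ(f̂x̃)` take `x₀` and `x₁` into account, and the distances of these two
  -- points bound `τ(x₀)` from below.
  have hPΔ : P ≤ Δ := (min_le_right _ _).trans (min_le_left _ _)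
  have hPy : P ≤ PesinCharts.distSing d f (f (PesinCharts.proj x)) := by
    rw [hy]; exact (min_le_right _ _).trans (min_le_right _ _)
  have hPΔ' : P' ≤ Δ := min_le_left _ _
  have hPy' : P' ≤ PesinCharts.distSing d f (f (PesinCharts.proj x)) := by
    rw [hy]; exact (min_le_right _ _).trans (min_le_left _ _)
  have hτP : ∀ p : ℝ, 0 < p → p ≤ Δ → p ≤ PesinCharts.distSing d f (f (PesinCharts.proj x)) →
      p ^ a ≤ τ₀ ∧ p ^ a ≤ Δ ^ a := by
    intro p hp h1 h2
    have e1 : p ^ a ≤ Δ ^ a := Real.rpow_le_rpow hp.le h1 (by linarith)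
    have e2 := Real.rpow_le_rpow hp.le h2 (show 0 ≤ a by linarith)
    exact ⟨(le_min e1 e2).trans (hf.lt_τ _ hz hfz).le, e1⟩
  obtain ⟨hPτ, hPa⟩ := hτP P hP hPΔ hPy
  obtain ⟨hPτ', hPa'⟩ := hτP P' hP' hPΔ' hPy'
  obtain ⟨hQ0, hQle⟩ : 0 < Q ∧ Q ≤ PesinCharts.Qtilde β a γ ε x (C₀ x) :=
    hJ.sSup_bounds hΓ hγ0 (by unfold PesinCharts.Qtilde; positivity)
  obtain ⟨hQ0', hQle'⟩ : 0 < Q' ∧ Q' ≤ PesinCharts.Qtilde β a γ ε (PesinCharts.shift x)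
      (C₀ (PesinCharts.shift x)) :=
    hJ.sSup_bounds hΓ hγ0 (by unfold PesinCharts.Qtilde; positivity)
  obtain ⟨hS, hT⟩ := PesinCharts.size_bounds hε hε1 hP hPΔ hΔ1 hN1 ha hβ hβ1 hγ hQ0 hQle
  obtain ⟨hS', hT'⟩ := PesinCharts.size_bounds hε hε1 hP' hPΔ' hΔ1 hN1' ha hβ hβ1 hγ hQ0' hQle'
  have hΔa1 : Δ ^ a ≤ 1 := Real.rpow_le_one hΔ0.le hΔ1 (by linarith)
  have hR : R = min (1 / 2 * r * Δ ^ a) τ₀ := rfl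
  have hRτ : R ≤ τ₀ := min_le_right _ _
  have hRΔ : R ≤ 1 / 2 * r * Δ ^ a := min_le_left _ _
  have hΔa0 : 0 < Δ ^ a := by positivity
  have hRr : R ≤ r := by
    have h1 : 1 / 2 * r * Δ ^ a ≤ 1 / 2 * r * 1 := by gcongr
    linarith
  -- The term `r d(x₀, Γ_∞)^a / 2` in `ι` is chosen for this: the maps expand normal coordinates by
  -- at most `2 * Λ`, so the image stays within radius `r`.
  have hΛR : 2 * Λ * R ≤ r := by
    have h1 : Λ * R ≤ Λ * (1 / 2 * r * Δ ^ a) := by gcongr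
    have h3 : Λ * (1 / 2 * r * Δ ^ a) = 1 / 2 * r * (Λ * Δ ^ a) := by ring
    rw [h3, hΛΔ] at h1
    linarith
  -- a small multiple of `p ^ a` is at most `R`
  have hεp : ∀ p : ℝ, 0 < p → p ^ a ≤ τ₀ → p ^ a ≤ Δ ^ a →
      8 * (ε * p ^ a) ≤ R ∧ ε * p ^ a ≤ ε := by
    intro p hp h1 h3
    have hpa : 0 < p ^ a := by positivity
    refine ⟨le_min ?_ ?_, ?_⟩
    · calc 8 * (ε * p ^ a) ≤ 8 * (ε * Δ ^ a) := by gcongr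
        _ = 8 * ε * Δ ^ a := by ring
        _ ≤ 1 / 2 * r * Δ ^ a := mul_le_mul_of_nonneg_right (by linarith) hΔa0.le
    · calc 8 * (ε * p ^ a) = 8 * ε * p ^ a := by ring
        _ ≤ 1 * p ^ a := mul_le_mul_of_nonneg_right (by linarith) hpa.le
        _ ≤ τ₀ := by linarith
    · exact mul_le_of_le_one_right hε.le (h3.trans hΔa1)
  obtain ⟨hεR, hεP⟩ := hεp P hP hPτ hPa
  obtain ⟨hεR', hεP'⟩ := hεp P' hP' hPτ' hPa'
  obtain ⟨q1, q2, q3, q4⟩ := PesinCharts.size_mono hQ0.le hN1 hΛ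
  obtain ⟨q1', q2', q3', q4'⟩ := PesinCharts.size_mono hQ0'.le hN1' hΛ
  have hm0 : 0 ≤ ε * P ^ a := by positivity
  have hm0' : 0 ≤ ε * P' ^ a := by positivity
  have hQR : Q ≤ R := by linarith
  have hQR' : Q' ≤ R := by linarith
  have hCle := hC.norm_apply_le
  have hCle' := hC'.norm_apply_le
  have hRs : 2 * R ≤ 2 * τ₀ := by linarith
  -- well-definedness
  have wellF : ∀ u ∈ Metric.ball (0 : EuclideanSpace ℝ (Fin d)) R,
      PesinCharts.pesinChart x (C₀ x) u ∈ Metric.ball (PesinCharts.proj x) (2 * τ₀) ∧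
      f (PesinCharts.pesinChart x (C₀ x) u) ∈
        Metric.ball (PesinCharts.proj (PesinCharts.shift x)) r := fun u hu =>
    hbf.map_mem_ball hr hCle hRr hRs hΛR (mem_ball_zero_iff.1 hu)
  have wellG : ∀ v ∈ Metric.ball (0 : EuclideanSpace ℝ (Fin d)) R,
      PesinCharts.pesinChart (PesinCharts.shift x) (C₀ (PesinCharts.shift x)) v ∈
        Metric.ball (PesinCharts.proj (PesinCharts.shift x)) (2 * τ₀) ∧
      finv (PesinCharts.proj x)
        (PesinCharts.pesinChart (PesinCharts.shift x) (C₀ (PesinCharts.shift x)) v) ∈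
        Metric.ball (PesinCharts.proj x) r := fun v hv =>
    hbg.map_mem_ball hr hCle' hRr hRs hΛR (mem_ball_zero_iff.1 hv)
  have hBR : B ⊆ Metric.ball 0 R := Metric.ball_subset_ball hQR
  have hBR' : B' ⊆ Metric.ball 0 R := Metric.ball_subset_ball hQR'
  -- the two maps are inverse to each other
  have GR : ∀ v ∈ B', G v ∈ Metric.ball 0 R := by
    intro v hv
    have hvn := mem_ball_zero_iff.1 hv
    rw [mem_ball_zero_iff]
    have h1 : ‖G v‖ ≤ N * (4 * Λ * ‖v‖) :=
      hbg.norm_branchMap_le hr hCle' hRr hRs hΛR (hvn.trans_le hQR')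
    -- `G` ends in the chart at `x` and brings in `N`, whereas `Q'` is calibrated to `N'`; hence the
    -- exchange `N ≤ 2 * Λ ^ 2 * N'`.
    calc ‖G v‖ ≤ N * (4 * Λ * ‖v‖) := h1
      _ < N * (4 * Λ * Q') := by gcongr
      _ ≤ (2 * Λ ^ 2 * N') * (4 * Λ * Q') := by
        gcongr
        exact hNN.trans (by gcongr)
      _ = 8 * (N' * Λ ^ 3 * Q') := by ring
      _ ≤ 8 * (ε * P' ^ a) := by linarith
      _ ≤ R := hεR'
  have FR : ∀ u ∈ B, F u ∈ Metric.ball 0 R := by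
    intro u hu
    have hun := mem_ball_zero_iff.1 hu
    rw [mem_ball_zero_iff]
    have h1 : ‖F u‖ ≤ N' * (4 * Λ * ‖u‖) :=
      hbf.norm_branchMap_le hr hCle hRr hRs hΛR (hun.trans_le hQR)
    calc ‖F u‖ ≤ N' * (4 * Λ * ‖u‖) := h1
      _ < N' * (4 * Λ * Q) := by gcongr
      _ ≤ (2 * Λ ^ 2 * N) * (4 * Λ * Q) := by
        gcongr
        exact hNN'.trans (by gcongr)
      _ = 8 * (N * Λ ^ 3 * Q) := by ring
      _ ≤ 8 * (ε * P ^ a) := by linarith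
      _ ≤ R := hεR
  have FG : ∀ v ∈ B', F (G v) = v := by
    intro v hv
    obtain ⟨w1, w2⟩ := wellG v (hBR' hv)
    have hvr : ‖C₀ (PesinCharts.shift x) v‖ < r :=
      (hCle' v).trans_lt ((mem_ball_zero_iff.1 (hBR' hv)).trans_le hRr)
    have e1 : C₀ x (G v) = PesinCharts.expInv (d := d) r (PesinCharts.proj x)
        (finv (PesinCharts.proj x)
          (PesinCharts.pesinChart (PesinCharts.shift x) (C₀ (PesinCharts.shift x)) v)) :=
      (C₀ x).apply_symm_apply _
    change (C₀ (PesinCharts.shift x)).symm (PesinCharts.expInv (d := d) r _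
      (f (PesinCharts.expMap (PesinCharts.proj x) (C₀ x (G v))))) = v
    rw [e1, hr.expMap_expInv w2, hf.finv_right _ hz hfz _ (by rw [hy]; exact w1)]
    change (C₀ (PesinCharts.shift x)).symm (PesinCharts.expInv (d := d) r _
      (PesinCharts.expMap _ (C₀ (PesinCharts.shift x) v))) = v
    rw [hr.expInv_expMap hvr]
    exact (C₀ (PesinCharts.shift x)).symm_apply_apply v
  -- While `FG` rests on `f ∘ f_x⁻¹ = id`, here the branch has to return to the given point `p`.
  -- Both `p` and `f_x⁻¹ (f p)` have image `f p`; the estimates place the latter in `D_x` too, where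
  -- `f` is injective.
  have GF : ∀ u ∈ B, G (F u) = u := by
    intro u hu
    have hun := mem_ball_zero_iff.1 hu
    obtain ⟨w1, w2⟩ := wellF u (hBR hu)
    have hur : ‖C₀ x u‖ < r := (hCle u).trans_lt ((hun.trans_le hQR).trans_le hRr)
    set p := PesinCharts.pesinChart x (C₀ x) u with hp
    set v := PesinCharts.expInv (d := d) r (PesinCharts.proj (PesinCharts.shift x)) (f p) with hv
    have e1 : C₀ (PesinCharts.shift x) (F u) = v := (C₀ (PesinCharts.shift x)).apply_symm_apply _
    have e2 : PesinCharts.expMap (PesinCharts.proj (PesinCharts.shift x)) v = f p :=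
      hr.expMap_expInv w2
    have d1 : dist (f p) (PesinCharts.proj (PesinCharts.shift x)) ≤ 2 * Λ * Q := by
      have h1 := hbf.dist_le hr hur (by linarith [hCle u])
      have h3 : 2 * Λ * ‖C₀ x u‖ ≤ 2 * Λ * Q := by gcongr; exact (hCle u).trans hun.le
      exact h1.trans h3
    have d2 : ‖v‖ ≤ 4 * (Λ * Q) := by
      have := hr.norm_expInv_le (d := d) w2
      linarith
    have hvr : ‖v‖ < r := hr.expInv_mem w2
    have hετ : ε * P ^ a ≤ ε * τ₀ := by gcongr
    have hετ' : ε * τ₀ ≤ 1 / 16 * τ₀ := by gcongr; linarith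
    have d3 : dist (finv (PesinCharts.proj x) (f p)) (PesinCharts.proj x) ≤
        8 * (Λ ^ 2 * Q) := by
      have h1 := hbg.dist_le hr hvr (by linarith)
      rw [e2] at h1
      have h3 : 2 * Λ * ‖v‖ ≤ 2 * Λ * (4 * (Λ * Q)) := by gcongr
      linarith
    have hfp : f p ∈ Metric.ball (f (PesinCharts.proj x)) (2 * τ₀) := by
      rw [hy, Metric.mem_ball]
      linarith
    have e3 : finv (PesinCharts.proj x) (f p) = p := by
      refine hf.injOn _ hz hfz ?_ w1 (hf.finv_right _ hz hfz _ hfp)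
      rw [Metric.mem_ball]
      linarith
    change (C₀ x).symm (PesinCharts.expInv (d := d) r _ (finv (PesinCharts.proj x)
      (PesinCharts.expMap _ (C₀ (PesinCharts.shift x) (F u))))) = u
    rw [e1, e2, e3, hp]
    change (C₀ x).symm (PesinCharts.expInv (d := d) r _
      (PesinCharts.expMap _ (C₀ x u))) = u
    rw [hr.expInv_expMap hur]
    exact (C₀ x).symm_apply_apply u
  -- derivatives at the origin
  have hτ2 : 0 < 2 * τ₀ := by linarith
  have F0 : F 0 = 0 := hbf.branchMap_zero hr
  have G0 : G 0 = 0 := hbg.branchMap_zero hr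
  have dF : HasFDerivAt F D 0 := hbf.hasFDerivAt_branchMap_zero hr hτ2
  have dG' : DifferentiableAt ℝ G 0 := (hbg.hasFDerivAt_branchMap_zero hr hτ2).differentiableAt
  obtain ⟨hDinv, dG⟩ := PesinCharts.isInvertible_and_hasFDerivAt_inverse dF dG' F0 G0
    (Filter.eventually_of_mem (Metric.ball_mem_nhds 0 hQ0') FG)
    (Filter.eventually_of_mem (Metric.ball_mem_nhds 0 hQ0) GF)
  have nD : ‖D‖ ≤ √2 * Λ := by
    refine ContinuousLinearMap.opNorm_le_bound _ (by positivity) fun u => ?_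
    have h1 := hC.norm_symm_dHat_le hC' hΛ (fun η => (hf.norm_dHat_bounds hx η).1) (C₀ x u)
    rw [(C₀ x).symm_apply_apply] at h1
    exact h1
  have nD' : ‖D.inverse‖ ≤ √2 * Λ := by
    refine ContinuousLinearMap.opNorm_le_bound _ (by positivity) fun v => ?_
    obtain ⟨e, he⟩ := hDinv
    obtain ⟨u, rfl⟩ := e.surjective v
    have h1 := hC.norm_symm_le_dHat hC' hΛ (fun η => (hf.norm_dHat_bounds hx η).2) (C₀ x u)
    rw [(C₀ x).symm_apply_apply] at h1
    rw [← he, ContinuousLinearMap.inverse_equiv]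
    change ‖e.symm (e u)‖ ≤ √2 * Λ * ‖e u‖
    rw [e.symm_apply_apply]
    have h3 : e u = D u := by rw [← he]; rfl
    rw [h3]
    exact h1
  -- the error terms
  obtain ⟨errF, bF⟩ := hbf.chart_estimates hr hK hβ hβ1 hL hδr hlip hCle hQ0 (by linarith)
    (by linarith) hε hεA hNN' (by linarith) hT dF
  obtain ⟨errG, bG⟩ := hbg.chart_estimates hr hK hβ hβ1 hL hδr hlip hCle' hQ0' (by linarith)
    (by linarith) hε hεA hNN (by linarith) hT' dG
  -- Added to the bound `√2 * Λ` for the norms of `D` and its inverse, this gives the constant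
  -- `2√2`.
  have hεΛ : ε ≤ √2 * Λ := hε1.trans (one_le_mul_of_one_le_of_one_le h12 hΛ)
  refine ⟨⟨hQ0, hQR, hQ0', hQR', fun u hu => ?_, fun v hv => ?_⟩,
    ⟨fun v hv => ⟨GR v hv, FG v hv⟩, fun u hu => ⟨FR u hu, GF u hu⟩⟩,
    ⟨F0, G0, dF, hDinv, dG⟩, ⟨errF, errG⟩, fun u hu => ?_, fun v hv => ?_⟩
  · rw [hy]; exact (wellF u hu).2
  · rw [hy]; exact wellG v hv
  · have h1 : ‖fderiv ℝ F u‖ ≤ ‖D‖ + ε := bF u hu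
    linarith
  · have h1 : ‖fderiv ℝ G v‖ ≤ ‖D.inverse‖ + ε := bG v hv
    linarith
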